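/- **Setting.** A signature $\Sigma$ consists of type constants $\mathsf t$, function symbols $\mathsf f:\sigma\to\tau$ and distribution symbols $\mathsf d:\sigma\to\tau$, where types are $\tau ::= \mathsf t \mid 1 \mid \mathsf{Bool} \mid \tau\times\tau$. Expressions are $x,\ \checkmark,\ \mathsf{true},\ \mathsf{false},\ \mathsf f\,e,\ (e_1,e_2),\ \mathsf{fst}\,e,\ \mathsf{snd}\,e$. Reactions are $R ::= \mathsf{ret}\,e \mid \mathsf{samp}\,\mathsf d\,e \mid \mathsf{read}\,c \mid \mathsf{if}\ e\ \mathsf{then}\ R_1\ \mathsf{else}\ R_2 \mid x\leftarrow R;\,R'$. Protocols are $P ::= 0 \mid o:=R \mid P\,\|\,Q \mid \mathsf{new}\ o:\tau\ \mathsf{in}\ P$. The judgement $\Delta\vdash P:I\to O$ says that, over the channel context $\Delta$, $P$ reads from the input channels $I$ (and from its own channels) and assigns exactly one reaction to each channel of $O$, where $I\cap O=\emptyset$. An exact theory $\mathbb T$ is a set of axioms $\Delta\vdash P=Q:I\to O$ between protocols with $\Delta\vdash P:I\to O$ and $\Delta\vdash Q:I\to O$. Exact equality $\Delta\vdash P=Q:I\to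 O$ over $\mathbb T$ is the least relation that contains the axioms and is closed under reflexivity, symmetry and transitivity; embedding of channel contexts; addition of unused inputs; congruence for assignments (from equality of reactions), parallel composition and $\mathsf{new}$; commutativity and associativity of $\|$; exchange of $\mathsf{new}$s; and the following equations between well-typed protocols, where $c$ is a new channel in the fold rules and a variable occurs in a reaction only where indicated: comp-new, $P\,\|\,(\mathsf{new}\ o:\tau\ \mathsf{in}\ Q)=\mathsf{new}\ o:\tau\ \mathsf{in}\ (P\,\|\,Q)$ if $o$ does not occur in $P$; absorb, $P\,\|\,Q=P$ if $Q$ has no outputs; diverge, $(o:=x\leftarrow\mathsf{read}\,o;R)=(o:=\mathsf{read}\,o)$; fold-bind, $(\mathsf{new}\ c\ \mathsf{in}\ (o:=x\leftarrow\mathsf{read}\,c;S)\,\|\,(c:=R))=(o:=x\leftarrow R;S)$; fold-if, $(\mathsf{new}\ c\ \mathsf{in}\ (o:=x\leftarrow R;\mathsf{if}\ x\ \mathsf{then}\ \mathsf{read}\,c\ \mathsf{else}\ R_2)\,\|\,(c:=R_1))=(o:=x\leftarrow R;\mathsf{if}\ x\ \mathsf{then}\ R_1\ \mathsf{else}\ R_2)$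 and symmetrically for the second branch; subsume, $(o_1:=x_0\leftarrow\mathsf{read}\,c;R_1)\,\|\,(o_2:=x_0\leftarrow\mathsf{read}\,c;x_1\leftarrow\mathsf{read}\,o_1;R_2)=(o_1:=x_0\leftarrow\mathsf{read}\,c;R_1)\,\|\,(o_2:=x_1\leftarrow\mathsf{read}\,o_1;R_2)$ if $c\in I$ and $x_0$ does not occur in $R_2$; subst, $(o_1:=R_1)\,\|\,(o_2:=x_1\leftarrow\mathsf{read}\,o_1;R_2)=(o_1:=R_1)\,\|\,(o_2:=x_1\leftarrow R_1;R_2)$ if $(x\leftarrow R_1;y\leftarrow R_1;\mathsf{ret}\,(x,y))=(x\leftarrow R_1;\mathsf{ret}\,(x,x))$; drop, $(o_1:=R_1)\,\|\,(o_2:=x_1\leftarrow\mathsf{read}\,o_1;R_2)=(o_1:=R_1)\,\|\,(o_2:=R_2)$ if $x_1$ does not occur in $R_2$, $R_1$ and $R_2$ read only from $I$, and $(x_1\leftarrow R_1;R_2)=R_2$. Equality of reactions is the congruence generated by the monad laws, exchange of independent binds, discarding of an unused sampling, $(x\leftarrow\mathsf{read}\,c;\,y\leftarrow\mathsf{read}\,c;\,R)=(x\leftarrow\mathsf{read}\,c;\,R[y:=x])$,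 and the laws of conditionals. Equality of expressions is generated by the laws of $1$ and of pairs. An interpretation $\llbracket-\rrbracket$ of $\Sigma$ assigns to each type constant a set of strings over $\{0,1,\star\}$ of a fixed length, to each $\mathsf f:\sigma\to\tau$ a function $\llbracket\sigma\rrbracket\to\llbracket\tau\rrbracket$, and to each $\mathsf d:\sigma\to\tau$ a map from $\llbracket\sigma\rrbracket$ to probability distributions on $\llbracket\tau\rrbracket$. Write $P\Downarrow\eta$ for the IPDL operational semantics: reactions are executed probabilistically, a finished reaction $o:=\mathsf{val}\,v$ outputs $v$ on $o$, which turns it into $o:=v$ and replaces $\mathsf{read}\,o$ by $\mathsf{val}\,v$ in the rest of the scope, and this continues in any order until no step is possible, which results in the distribution $\eta$ on protocols. A bisimulation for $\Delta\vdash I\to O$ is a relation $\sim$ between distributions on protocols such that $\eta\sim\varepsilon$ implies: (i) $\eta[\mathsf{read}\,i:=\mathsf{val}\,v]\sim\varepsilon[\mathsf{read}\,i:=\mathsf{val}\,v]$ for all $i:\tau$ in $I$ and $v\in\llbracket\tau\rrbracket$; (ii) $\eta'\sim\varepsilon'$ if $\eta\Downarrow\eta'$ and $\varepsilon\Downarrow\varepsilon'$;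 (iii) for each $o:\tau$ in $O$ there is a joint convex combination $\eta=\sum_k c_k\eta_k$, $\varepsilon=\sum_k c_k\varepsilon_k$ with $\eta_k\sim\varepsilon_k$ such that, for each $k$, all protocols in the supports of $\eta_k$ and $\varepsilon_k$ carry the same value in $\llbracket\tau\rrbracket\cup\{\bot\}$ on $o$. The theory $\mathbb T$ is sound in $\llbracket-\rrbracket$ if for each of its axioms $\Delta\vdash P=Q:I\to O$ some bisimulation relates the point masses $1[P]$ and $1[Q]$. An adversary $\mathsf{Adv}$ for protocols $\Delta\vdash I\to O$ consists of a channel context $\Delta'$, an embedding $\phi$ of $\Delta$ into $\Delta'$ (an injective, type-preserving renaming of channels), sets $I',O'$ of channels of $\Delta'$ with $I'\subseteq\phi(O)$, $\phi(I)\subseteq O'$ and $\phi(O)\cap O'=\emptyset$, a number of rounds $\#\ge1$, a number of tapes $\geq 1$, a finite set $\mathsf{Symb}$ of additional symbols, a set $\mathsf{St}$ of strings over $\{0,1\}\sqcup\mathsf{Symb}$ of a fixed length $\ge1$, an initial state $s_\star\in\mathsf{St}$, a partial probabilistic function $\mathsf T:\mathsf{St}\rightharpoonup(\{\bot\}\cup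 I'\cup O')\times\mathsf{St}$ computed by a probabilistic multi-tape Turing machine, and functions $\mathsf{In}_o:\mathsf{St}\times\llbracket\tau\rrbracket\to\mathsf{St}$ for $o:\tau$ in $I'$, $\mathsf{Out}_i:\mathsf{St}\to\llbracket\tau\rrbracket\cup\{\bot\}$ for $i:\tau$ in $O'$, and $\mathsf{Dec}:\mathsf{St}\to\{0,1\}$, computed by deterministic ones. Each machine halts within a number of steps that is fixed for that machine; apart from this no bound is placed on resources. The interaction $\mathsf{Adv}(P)$, for $\Delta\vdash P:I\to O$, is the following random process with values in $\{0,1\}$, which may also end without a value. Start with $s:=s_\star$ and $P:=\phi^\star(P)$ ($P$ renamed along $\phi$). In each of $\#$ rounds draw $P'$ from the distribution $\eta$ with $P\Downarrow\eta$ and, independently, $(q,s')$ from $\mathsf T(s)$; end without a value if $\mathsf T(s)$ is undefined. If $q=i\in O'$ and $\mathsf{Out}_i(s')=v\ne\bot$, put $s:=s'$ and $P:=P'[\mathsf{read}\,i:=\mathsf{val}\,v]$. If $q=o\in I'$ and $P'$ contains $o:=v$ for a value $v$, put $s:=\mathsf{In}_o(s',v)$ and $P:=P'$. In all other cases put $s:=s'$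 and $P:=P'$. After the last round return $\mathsf{Dec}(s)$. **Lemma (Perfect indistinguishability).** Let $\mathbb T$ be an exact theory over $\Sigma$, let $\llbracket-\rrbracket$ be an interpretation of $\Sigma$ in which $\mathbb T$ is sound, and let $\Delta\vdash P=Q:I\to O$ be derivable over $\mathbb T$. Then for every adversary $\mathsf{Adv}$ for protocols $\Delta\vdash I\to O$, $$\Big|\Pr[\mathsf{Adv}(P)=1]-\Pr[\mathsf{Adv}(Q)=1]\Big|=0.$$ -/

import Mathlib

/-! # IPDL: syntax, exact equational logic, semantics, adversaries, interaction -/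

namespace IPDL

/-! ## Signatures, types, contexts -/

/-- Data types over a set `B` of type constants. -/
inductive Ty (B : Type) : Type
  | base (t : B) : Ty B
  | unit : Ty B
  | bool : Ty B
  | prod (σ τ : Ty B) : Ty B

/-- A signature: type constants, typed function symbols and typed distribution symbols. -/
structure Sig where
  TyConst : Type
  Fn : Type
  Dist : Type
  fnDom : Fn → Ty TyConst
  fnCod : Fn → Ty TyConst
  distDom : Dist → Ty TyConst
  distCod : Dist → Ty TyConst

abbrev Sig.Typ (S : Sig) : Type := Ty S.TyConst

/-- Type contexts `Γ` and channel contexts `Δ` are lists of types; names are de Bruijn indices. -/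
abbrev Sig.Ctx (S : Sig) : Type := List S.Typ

/-- `Mem l a`: the positions of `l` that hold `a`. These are the variables of type `a` in the type
context `l`, respectively the channels of type `a` in the channel context `l`. -/
inductive Mem {α : Type} : List α → α → Type
  | zero {a : α} {l : List α} : Mem (a :: l) a
  | succ {a b : α} {l : List α} : Mem l a → Mem (b :: l) a

/-- Type-preserving maps of names. -/
abbrev Ren {α : Type} (l l' : List α) : Type := ∀ a : α, Mem l a → Mem l' a

def Ren.weaken {α : Type} {b : α} {l : List α} : Ren l (b :: l) := fun _ x => Mem.succ x

def Ren.lift {α : Type} {b : α} {l l' : List α} (ρ : Ren l l') : Ren (b :: l) (b :: l')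
  | _, Mem.zero => Mem.zero
  | _, Mem.succ x => Mem.succ (ρ _ x)

def Ren.swap {α : Type} {a b : α} {l : List α} : Ren (a :: b :: l) (b :: a :: l)
  | _, Mem.zero => Mem.succ Mem.zero
  | _, Mem.succ Mem.zero => Mem.zero
  | _, Mem.succ (Mem.succ x) => Mem.succ (Mem.succ x)

/-- A channel of a channel context, together with its type. -/
abbrev Chan {α : Type} (l : List α) : Type := Σ a : α, Mem l a

/-- The untyped view of a channel. -/
abbrev Mem.chan {α : Type} {l : List α} {a : α} (x : Mem l a) : Chan l := ⟨a, x⟩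

/-- The image `φ⋆(I)` of a set of channels. -/
def Ren.image {α : Type} {l l' : List α} (φ : Ren l l') (I : Set (Chan l)) : Set (Chan l') :=
  (fun c : Chan l => (⟨c.1, φ c.1 c.2⟩ : Chan l')) '' I

/-- The set `I`, seen in a channel context with one more channel. -/
abbrev shift {α : Type} {b : α} {l : List α} (I : Set (Chan l)) : Set (Chan (b :: l)) :=
  (Ren.weaken (b := b)).image I

/-- An embedding of the channel context `Δ` into `Δ'`: an injective, type-preserving renaming. -/
structure Embedding {α : Type} (Δ Δ' : List α) where
  toRen : Ren Δ Δ'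
  inj : ∀ a, Function.Injective (toRen a)

/-! ## Syntax

The syntax is parametrised by a family `V` of literals. Protocols proper have no literals
(`V = NoVal`). The operational semantics works on the syntax augmented by the intermediate values
of an interpretation. -/

section Terms

variable (S : Sig) (V : S.Typ → Type)

inductive Expr : S.Ctx → S.Typ → Type
  | val {Γ : S.Ctx} {τ : S.Typ} (v : V τ) : Expr Γ τ
  | var {Γ : S.Ctx} {τ : S.Typ} (x : Mem Γ τ) : Expr Γ τ
  | star {Γ : S.Ctx} : Expr Γ Ty.unit
  | tt {Γ : S.Ctx} : Expr Γ Ty.bool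
  | ff {Γ : S.Ctx} : Expr Γ Ty.bool
  | app {Γ : S.Ctx} (f : S.Fn) (e : Expr Γ (S.fnDom f)) : Expr Γ (S.fnCod f)
  | pair {Γ : S.Ctx} {σ τ : S.Typ} (e₁ : Expr Γ σ) (e₂ : Expr Γ τ) : Expr Γ (Ty.prod σ τ)
  | fst {Γ : S.Ctx} {σ τ : S.Typ} (e : Expr Γ (Ty.prod σ τ)) : Expr Γ σ
  | snd {Γ : S.Ctx} {σ τ : S.Typ} (e : Expr Γ (Ty.prod σ τ)) : Expr Γ τ

/-- Reactions; `bind R R'` is `x ← R; R'`. -/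
inductive React (Δ : S.Ctx) : S.Ctx → S.Typ → Type
  | val {Γ : S.Ctx} {τ : S.Typ} (v : V τ) : React Δ Γ τ
  | ret {Γ : S.Ctx} {τ : S.Typ} (e : Expr S V Γ τ) : React Δ Γ τ
  | samp {Γ : S.Ctx} (d : S.Dist) (e : Expr S V Γ (S.distDom d)) : React Δ Γ (S.distCod d)
  | read {Γ : S.Ctx} {τ : S.Typ} (c : Mem Δ τ) : React Δ Γ τ
  | ifte {Γ : S.Ctx} {τ : S.Typ} (e : Expr S V Γ Ty.bool) (R₁ R₂ : React Δ Γ τ) : React Δ Γ τ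
  | bind {Γ : S.Ctx} {σ τ : S.Typ} (R : React Δ Γ σ) (R' : React Δ (σ :: Γ) τ) : React Δ Γ τ

/-- Protocols; `react o R` is `o := R`, `done o v` is the intermediate form `o := v`, and in
`new τ P` the bound channel has index `0` in `P`. -/
inductive Proto : S.Ctx → Type
  | zero {Δ : S.Ctx} : Proto Δ
  | react {Δ : S.Ctx} {τ : S.Typ} (o : Mem Δ τ) (R : React S V Δ [] τ) : Proto Δ
  | done {Δ : S.Ctx} {τ : S.Typ} (o : Mem Δ τ) (v : V τ) : Proto Δ
  | par {Δ : S.Ctx} (P Q : Proto Δ) : Proto Δ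
  | new {Δ : S.Ctx} (τ : S.Typ) (P : Proto (τ :: Δ)) : Proto Δ

end Terms

/-- The empty family of literals. -/
abbrev NoVal (S : Sig) : S.Typ → Type := fun _ => Empty

section Operations

variable {S : Sig} {V W : S.Typ → Type}

/-! ### Renaming and substitution of variables -/

def Expr.rename {Γ Γ' : S.Ctx} (ρ : Ren Γ Γ') {τ : S.Typ} : Expr S V Γ τ → Expr S V Γ' τ
  | .val v => .val v
  | .var x => .var (ρ _ x)
  | .star => .star
  | .tt => .tt
  | .ff => .ff
  | .app f e => .app f (e.rename ρ)
  | .pair e₁ e₂ => .pair (e₁.rename ρ) (e₂.rename ρ)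
  | .fst e => .fst (e.rename ρ)
  | .snd e => .snd (e.rename ρ)

/-- Substitutions `Γ' → Γ`: an expression over `Γ'` for every variable of `Γ`. -/
abbrev Sub (S : Sig) (V : S.Typ → Type) (Γ Γ' : S.Ctx) : Type := ∀ τ, Mem Γ τ → Expr S V Γ' τ

def Sub.lift {Γ Γ' : S.Ctx} {σ : S.Typ} (θ : Sub S V Γ Γ') : Sub S V (σ :: Γ) (σ :: Γ')
  | _, Mem.zero => .var Mem.zero
  | _, Mem.succ x => (θ _ x).rename Ren.weaken

/-- The substitution `[x := e]` of the last variable. -/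
def Sub.single {Γ : S.Ctx} {σ : S.Typ} (e : Expr S V Γ σ) : Sub S V (σ :: Γ) Γ
  | _, Mem.zero => e
  | _, Mem.succ x => .var x

def Expr.subst {Γ Γ' : S.Ctx} (θ : Sub S V Γ Γ') {τ : S.Typ} : Expr S V Γ τ → Expr S V Γ' τ
  | .val v => .val v
  | .var x => θ _ x
  | .star => .star
  | .tt => .tt
  | .ff => .ff
  | .app f e => .app f (e.subst θ)
  | .pair e₁ e₂ => .pair (e₁.subst θ) (e₂.subst θ)
  | .fst e => .fst (e.subst θ)
  | .snd e => .snd (e.subst θ)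

def React.rename {Δ : S.Ctx} :
    ∀ {Γ Γ' : S.Ctx} (_ : Ren Γ Γ') {τ : S.Typ}, React S V Δ Γ τ → React S V Δ Γ' τ
  | _, _, _, _, .val v => .val v
  | _, _, ρ, _, .ret e => .ret (e.rename ρ)
  | _, _, ρ, _, .samp d e => .samp d (e.rename ρ)
  | _, _, _, _, .read c => .read c
  | _, _, ρ, _, .ifte e R₁ R₂ => .ifte (e.rename ρ) (R₁.rename ρ) (R₂.rename ρ)
  | _, _, ρ, _, .bind R R' => .bind (R.rename ρ) (R'.rename ρ.lift)

/-- Weakening of a reaction by one unused variable. -/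
abbrev React.weaken {Δ Γ : S.Ctx} {σ τ : S.Typ} (R : React S V Δ Γ τ) : React S V Δ (σ :: Γ) τ :=
  R.rename Ren.weaken

def React.subst {Δ : S.Ctx} :
    ∀ {Γ Γ' : S.Ctx} (_ : Sub S V Γ Γ') {τ : S.Typ}, React S V Δ Γ τ → React S V Δ Γ' τ
  | _, _, _, _, .val v => .val v
  | _, _, θ, _, .ret e => .ret (e.subst θ)
  | _, _, θ, _, .samp d e => .samp d (e.subst θ)
  | _, _, _, _, .read c => .read c
  | _, _, θ, _, .ifte e R₁ R₂ => .ifte (e.subst θ) (R₁.subst θ) (R₂.subst θ)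
  | _, _, θ, _, .bind R R' => .bind (R.subst θ) (R'.subst θ.lift)

/-- `R[x := e]`. -/
abbrev React.inst {Δ Γ : S.Ctx} {σ τ : S.Typ} (R : React S V Δ (σ :: Γ) τ) (e : Expr S V Γ σ) :
    React S V Δ Γ τ :=
  R.subst (Sub.single e)

/-! ### Renaming of channels -/

def React.mapChan {Δ Δ' : S.Ctx} (φ : Ren Δ Δ') :
    ∀ {Γ : S.Ctx} {τ : S.Typ}, React S V Δ Γ τ → React S V Δ' Γ τ
  | _, _, .val v => .val v
  | _, _, .ret e => .ret e
  | _, _, .samp d e => .samp d e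
  | _, _, .read c => .read (φ _ c)
  | _, _, .ifte e R₁ R₂ => .ifte e (R₁.mapChan φ) (R₂.mapChan φ)
  | _, _, .bind R R' => .bind (R.mapChan φ) (R'.mapChan φ)

/-- `φ⋆(P)`. -/
def Proto.mapChan : ∀ {Δ Δ' : S.Ctx} (_ : Ren Δ Δ'), Proto S V Δ → Proto S V Δ'
  | _, _, _, .zero => .zero
  | _, _, φ, .react o R => .react (φ _ o) (R.mapChan φ)
  | _, _, φ, .done o v => .done (φ _ o) v
  | _, _, φ, .par P Q => .par (P.mapChan φ) (Q.mapChan φ)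
  | _, _, φ, .new τ P => .new τ (P.mapChan φ.lift)

/-! ### Replacement of literals -/

def Expr.mapVal (f : ∀ τ, V τ → W τ) {Γ : S.Ctx} {τ : S.Typ} : Expr S V Γ τ → Expr S W Γ τ
  | .val v => .val (f _ v)
  | .var x => .var x
  | .star => .star
  | .tt => .tt
  | .ff => .ff
  | .app g e => .app g (e.mapVal f)
  | .pair e₁ e₂ => .pair (e₁.mapVal f) (e₂.mapVal f)
  | .fst e => .fst (e.mapVal f)
  | .snd e => .snd (e.mapVal f)

def React.mapVal (f : ∀ τ, V τ → W τ) {Δ Γ : S.Ctx} {τ : S.Typ} :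
    React S V Δ Γ τ → React S W Δ Γ τ
  | .val v => .val (f _ v)
  | .ret e => .ret (e.mapVal f)
  | .samp d e => .samp d (e.mapVal f)
  | .read c => .read c
  | .ifte e R₁ R₂ => .ifte (e.mapVal f) (R₁.mapVal f) (R₂.mapVal f)
  | .bind R R' => .bind (R.mapVal f) (R'.mapVal f)

def Proto.mapVal (f : ∀ τ, V τ → W τ) {Δ : S.Ctx} : Proto S V Δ → Proto S W Δ
  | .zero => .zero
  | .react o R => .react o (R.mapVal f)
  | .done o v => .done o (f _ v)
  | .par P Q => .par (P.mapVal f) (Q.mapVal f)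
  | .new τ P => .new τ (P.mapVal f)

/-- A protocol without literals, seen in the augmented syntax. -/
abbrev Proto.lit {Δ : S.Ctx} (P : Proto S (NoVal S) Δ) : Proto S V Δ :=
  P.mapVal fun _ v => v.elim

/-! ## Typing

Data types are built into the syntax; what is left of the typing judgements is the bookkeeping of
the channels that are read and assigned. -/

/-- `Δ; Γ ⊢ R : I → τ`: every channel that `R` reads belongs to `I`. -/
def React.ReadsIn {Δ : S.Ctx} (I : Set (Chan Δ)) :
    ∀ {Γ : S.Ctx} {τ : S.Typ}, React S V Δ Γ τ → Prop
  | _, _, .val _ => True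
  | _, _, .ret _ => True
  | _, _, .samp _ _ => True
  | _, _, .read c => c.chan ∈ I
  | _, _, .ifte _ R₁ R₂ => R₁.ReadsIn I ∧ R₂.ReadsIn I
  | _, _, .bind R R' => R.ReadsIn I ∧ R'.ReadsIn I

/-- `Δ ⊢ P : I → O`. The inputs `I` and outputs `O` are then automatically disjoint. A reaction may
refer to its own channel, in which case it waits forever. -/
inductive Proto.Typed : ∀ {Δ : S.Ctx}, Proto S V Δ → Set (Chan Δ) → Set (Chan Δ) → Prop
  | zero {Δ : S.Ctx} {I : Set (Chan Δ)} : Typed .zero I ∅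
  | react {Δ : S.Ctx} {I : Set (Chan Δ)} {τ : S.Typ} {o : Mem Δ τ} {R : React S V Δ [] τ}
      (ho : o.chan ∉ I) (hR : R.ReadsIn (I ∪ {o.chan})) : Typed (.react o R) I {o.chan}
  | done {Δ : S.Ctx} {I : Set (Chan Δ)} {τ : S.Typ} {o : Mem Δ τ} {v : V τ}
      (ho : o.chan ∉ I) : Typed (.done o v) I {o.chan}
  | par {Δ : S.Ctx} {I O₁ O₂ : Set (Chan Δ)} {P Q : Proto S V Δ}
      (hP : Typed P (I ∪ O₂) O₁) (hQ : Typed Q (I ∪ O₁) O₂) : Typed (.par P Q) I (O₁ ∪ O₂)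
  | new {Δ : S.Ctx} {I O : Set (Chan Δ)} {τ : S.Typ} {P : Proto S V (τ :: Δ)}
      (hP : Typed P (shift I) (shift O ∪ {Mem.zero.chan})) : Typed (.new τ P) I O

end Operations

/-! ## The exact equational logic -/

/-- Equality of expressions, `Γ ⊢ e = e' : τ`. -/
inductive ExprEq {S : Sig} : ∀ {Γ : S.Ctx} {τ : S.Typ},
    Expr S (NoVal S) Γ τ → Expr S (NoVal S) Γ τ → Prop
  | refl {Γ : S.Ctx} {τ : S.Typ} (e : Expr S (NoVal S) Γ τ) : ExprEq e e
  | symm {Γ : S.Ctx} {τ : S.Typ} {e₁ e₂ : Expr S (NoVal S) Γ τ} : ExprEq e₁ e₂ → ExprEq e₂ e₁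
  | trans {Γ : S.Ctx} {τ : S.Typ} {e₁ e₂ e₃ : Expr S (NoVal S) Γ τ} :
      ExprEq e₁ e₂ → ExprEq e₂ e₃ → ExprEq e₁ e₃
  | subst {Γ Γ' : S.Ctx} {τ : S.Typ} {e₁ e₂ : Expr S (NoVal S) Γ τ} (θ : Sub S (NoVal S) Γ Γ') :
      ExprEq e₁ e₂ → ExprEq (e₁.subst θ) (e₂.subst θ)
  | congApp {Γ : S.Ctx} (f : S.Fn) {e e' : Expr S (NoVal S) Γ (S.fnDom f)} :
      ExprEq e e' → ExprEq (.app f e) (.app f e')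
  | congPair {Γ : S.Ctx} {σ τ : S.Typ} {e₁ e₁' : Expr S (NoVal S) Γ σ}
      {e₂ e₂' : Expr S (NoVal S) Γ τ} :
      ExprEq e₁ e₁' → ExprEq e₂ e₂' → ExprEq (.pair e₁ e₂) (.pair e₁' e₂')
  | congFst {Γ : S.Ctx} {σ τ : S.Typ} {e e' : Expr S (NoVal S) Γ (Ty.prod σ τ)} :
      ExprEq e e' → ExprEq (.fst e) (.fst e')
  | congSnd {Γ : S.Ctx} {σ τ : S.Typ} {e e' : Expr S (NoVal S) Γ (Ty.prod σ τ)} :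
      ExprEq e e' → ExprEq (.snd e) (.snd e')
  | unitExt {Γ : S.Ctx} (e : Expr S (NoVal S) Γ Ty.unit) : ExprEq e .star
  | fstPair {Γ : S.Ctx} {σ τ : S.Typ} (e₁ : Expr S (NoVal S) Γ σ) (e₂ : Expr S (NoVal S) Γ τ) :
      ExprEq (.fst (.pair e₁ e₂)) e₁
  | sndPair {Γ : S.Ctx} {σ τ : S.Typ} (e₁ : Expr S (NoVal S) Γ σ) (e₂ : Expr S (NoVal S) Γ τ) :
      ExprEq (.snd (.pair e₁ e₂)) e₂
  | pairExt {Γ : S.Ctx} {σ τ : S.Typ} (e : Expr S (NoVal S) Γ (Ty.prod σ τ)) :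
      ExprEq (.pair (.fst e) (.snd e)) e

/-- Equality of reactions, `Δ; Γ ⊢ R = R' : I → τ`. -/
inductive ReactEq {S : Sig} : ∀ {Δ : S.Ctx} (_ : Set (Chan Δ)) {Γ : S.Ctx} {τ : S.Typ},
    React S (NoVal S) Δ Γ τ → React S (NoVal S) Δ Γ τ → Prop
  | refl {Δ Γ : S.Ctx} {I : Set (Chan Δ)} {τ : S.Typ} {R : React S (NoVal S) Δ Γ τ}
      (hR : R.ReadsIn I) : ReactEq I R R
  | symm {Δ Γ : S.Ctx} {I : Set (Chan Δ)} {τ : S.Typ} {R₁ R₂ : React S (NoVal S) Δ Γ τ} :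
      ReactEq I R₁ R₂ → ReactEq I R₂ R₁
  | trans {Δ Γ : S.Ctx} {I : Set (Chan Δ)} {τ : S.Typ} {R₁ R₂ R₃ : React S (NoVal S) Δ Γ τ} :
      ReactEq I R₁ R₂ → ReactEq I R₂ R₃ → ReactEq I R₁ R₃
  | inputUnused {Δ Γ : S.Ctx} {I : Set (Chan Δ)} {τ : S.Typ} {R₁ R₂ : React S (NoVal S) Δ Γ τ}
      (c : Chan Δ) (hc : c ∉ I) : ReactEq I R₁ R₂ → ReactEq (I ∪ {c}) R₁ R₂
  | subst {Δ Γ Γ' : S.Ctx} {I : Set (Chan Δ)} {τ : S.Typ} {R₁ R₂ : React S (NoVal S) Δ Γ τ}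
      (θ : Sub S (NoVal S) Γ Γ') : ReactEq I R₁ R₂ → ReactEq I (R₁.subst θ) (R₂.subst θ)
  | embed {Δ Δ' Γ : S.Ctx} {I : Set (Chan Δ)} {τ : S.Typ} {R₁ R₂ : React S (NoVal S) Δ Γ τ}
      (φ : Embedding Δ Δ') : ReactEq I R₁ R₂ →
      ReactEq (φ.toRen.image I) (R₁.mapChan φ.toRen) (R₂.mapChan φ.toRen)
  | congRet {Δ Γ : S.Ctx} {I : Set (Chan Δ)} {τ : S.Typ} {e e' : Expr S (NoVal S) Γ τ} :
      ExprEq e e' → ReactEq I (.ret e) (.ret e')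
  | congSamp {Δ Γ : S.Ctx} {I : Set (Chan Δ)} (d : S.Dist)
      {e e' : Expr S (NoVal S) Γ (S.distDom d)} :
      ExprEq e e' → ReactEq I (.samp d e) (.samp d e')
  | congIf {Δ Γ : S.Ctx} {I : Set (Chan Δ)} {τ : S.Typ} {e e' : Expr S (NoVal S) Γ Ty.bool}
      {R₁ R₁' R₂ R₂' : React S (NoVal S) Δ Γ τ} :
      ExprEq e e' → ReactEq I R₁ R₁' → ReactEq I R₂ R₂' →
      ReactEq I (.ifte e R₁ R₂) (.ifte e' R₁' R₂')
  | congBind {Δ Γ : S.Ctx} {I : Set (Chan Δ)} {σ τ : S.Typ} {R R' : React S (NoVal S) Δ Γ σ}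
      {K K' : React S (NoVal S) Δ (σ :: Γ) τ} :
      ReactEq I R R' → ReactEq I K K' → ReactEq I (.bind R K) (.bind R' K')
  /-- `(x ← ret e; K) = K[x := e]` -/
  | retBind {Δ Γ : S.Ctx} {I : Set (Chan Δ)} {σ τ : S.Typ} (e : Expr S (NoVal S) Γ σ)
      {K : React S (NoVal S) Δ (σ :: Γ) τ} (hK : K.ReadsIn I) :
      ReactEq I (.bind (.ret e) K) (K.inst e)
  /-- `(x ← R; ret x) = R` -/
  | bindRet {Δ Γ : S.Ctx} {I : Set (Chan Δ)} {τ : S.Typ} {R : React S (NoVal S) Δ Γ τ}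
      (hR : R.ReadsIn I) : ReactEq I (.bind R (.ret (.var Mem.zero))) R
  /-- `(x₂ ← (x₁ ← R₁; R₂); K) = (x₁ ← R₁; x₂ ← R₂; K)` -/
  | bindBind {Δ Γ : S.Ctx} {I : Set (Chan Δ)} {σ₁ σ₂ τ : S.Typ} {R₁ : React S (NoVal S) Δ Γ σ₁}
      {R₂ : React S (NoVal S) Δ (σ₁ :: Γ) σ₂} {K : React S (NoVal S) Δ (σ₂ :: Γ) τ}
      (h₁ : R₁.ReadsIn I) (h₂ : R₂.ReadsIn I) (hK : K.ReadsIn I) :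
      ReactEq I (.bind (.bind R₁ R₂) K) (.bind R₁ (.bind R₂ (K.rename Ren.weaken.lift)))
  /-- `(x₁ ← R₁; x₂ ← R₂; K) = (x₂ ← R₂; x₁ ← R₁; K)` -/
  | exch {Δ Γ : S.Ctx} {I : Set (Chan Δ)} {σ₁ σ₂ τ : S.Typ} {R₁ : React S (NoVal S) Δ Γ σ₁}
      {R₂ : React S (NoVal S) Δ Γ σ₂} {K : React S (NoVal S) Δ (σ₂ :: σ₁ :: Γ) τ}
      (h₁ : R₁.ReadsIn I) (h₂ : R₂.ReadsIn I) (hK : K.ReadsIn I) :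
      ReactEq I (.bind R₁ (.bind R₂.weaken K)) (.bind R₂ (.bind R₁.weaken (K.rename Ren.swap)))
  /-- `(x ← samp d e; R) = R` if `x` does not occur in `R` -/
  | sampPure {Δ Γ : S.Ctx} {I : Set (Chan Δ)} {τ : S.Typ} (d : S.Dist)
      (e : Expr S (NoVal S) Γ (S.distDom d)) {R : React S (NoVal S) Δ Γ τ} (hR : R.ReadsIn I) :
      ReactEq I (.bind (.samp d e) R.weaken) R
  /-- `(x ← read c; y ← read c; K) = (x ← read c; K[y := x])` -/
  | readDet {Δ Γ : S.Ctx} {I : Set (Chan Δ)} {σ τ : S.Typ} {c : Mem Δ σ}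
      {K : React S (NoVal S) Δ (σ :: σ :: Γ) τ} (hc : c.chan ∈ I) (hK : K.ReadsIn I) :
      ReactEq I (.bind (.read c) (.bind (.read c) K))
        (.bind (.read c) (K.inst (.var Mem.zero)))
  | ifLeft {Δ Γ : S.Ctx} {I : Set (Chan Δ)} {τ : S.Typ} {R₁ R₂ : React S (NoVal S) Δ Γ τ}
      (h₁ : R₁.ReadsIn I) (h₂ : R₂.ReadsIn I) : ReactEq I (.ifte .tt R₁ R₂) R₁
  | ifRight {Δ Γ : S.Ctx} {I : Set (Chan Δ)} {τ : S.Typ} {R₁ R₂ : React S (NoVal S) Δ Γ τ}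
      (h₁ : R₁.ReadsIn I) (h₂ : R₂.ReadsIn I) : ReactEq I (.ifte .ff R₁ R₂) R₂
  /-- `(if e then K[x := true] else K[x := false]) = K[x := e]` -/
  | ifExt {Δ Γ : S.Ctx} {I : Set (Chan Δ)} {τ : S.Typ} (e : Expr S (NoVal S) Γ Ty.bool)
      {K : React S (NoVal S) Δ (Ty.bool :: Γ) τ} (hK : K.ReadsIn I) :
      ReactEq I (.ifte e (K.inst .tt) (K.inst .ff)) (K.inst e)

/-- A theory of exact equality: the axioms `Δ ⊢ P = Q : I → O` by which the logic is
parametrised. -/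
structure Theory (S : Sig) where
  Ax : ∀ {Δ : S.Ctx}, Set (Chan Δ) → Set (Chan Δ) →
    Proto S (NoVal S) Δ → Proto S (NoVal S) Δ → Prop
  typed_left : ∀ {Δ : S.Ctx} {I O : Set (Chan Δ)} {P Q : Proto S (NoVal S) Δ},
    Ax I O P Q → P.Typed I O
  typed_right : ∀ {Δ : S.Ctx} {I O : Set (Chan Δ)} {P Q : Proto S (NoVal S) Δ},
    Ax I O P Q → Q.Typed I O

/-- Exact equality of protocols, `Δ ⊢ P = Q : I → O`, over a theory. -/
inductive ProtEq {S : Sig} (T : Theory S) : ∀ {Δ : S.Ctx}, Set (Chan Δ) → Set (Chan Δ) →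
    Proto S (NoVal S) Δ → Proto S (NoVal S) Δ → Prop
  | refl {Δ : S.Ctx} {I O : Set (Chan Δ)} {P : Proto S (NoVal S) Δ} (hP : P.Typed I O) :
      ProtEq T I O P P
  | symm {Δ : S.Ctx} {I O : Set (Chan Δ)} {P Q : Proto S (NoVal S) Δ} :
      ProtEq T I O P Q → ProtEq T I O Q P
  | trans {Δ : S.Ctx} {I O : Set (Chan Δ)} {P₁ P₂ P₃ : Proto S (NoVal S) Δ} :
      ProtEq T I O P₁ P₂ → ProtEq T I O P₂ P₃ → ProtEq T I O P₁ P₃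
  | ax {Δ : S.Ctx} {I O : Set (Chan Δ)} {P Q : Proto S (NoVal S) Δ} :
      T.Ax I O P Q → ProtEq T I O P Q
  | inputUnused {Δ : S.Ctx} {I O : Set (Chan Δ)} {P Q : Proto S (NoVal S) Δ} (c : Chan Δ)
      (hc : c ∉ I ∪ O) : ProtEq T I O P Q → ProtEq T (I ∪ {c}) O P Q
  | embed {Δ Δ' : S.Ctx} {I O : Set (Chan Δ)} {P Q : Proto S (NoVal S) Δ}
      (φ : Embedding Δ Δ') : ProtEq T I O P Q →
      ProtEq T (φ.toRen.image I) (φ.toRen.image O) (P.mapChan φ.toRen) (Q.mapChan φ.toRen)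
  | congReact {Δ : S.Ctx} {I : Set (Chan Δ)} {τ : S.Typ} {o : Mem Δ τ}
      {R R' : React S (NoVal S) Δ [] τ} (ho : o.chan ∉ I) :
      ReactEq (I ∪ {o.chan}) R R' → ProtEq T I {o.chan} (.react o R) (.react o R')
  | congComp {Δ : S.Ctx} {I O₁ O₂ : Set (Chan Δ)} {P P' Q : Proto S (NoVal S) Δ} :
      ProtEq T (I ∪ O₂) O₁ P P' → Q.Typed (I ∪ O₁) O₂ →
      ProtEq T I (O₁ ∪ O₂) (.par P Q) (.par P' Q)
  | congNew {Δ : S.Ctx} {I O : Set (Chan Δ)} {τ : S.Typ} {P P' : Proto S (NoVal S) (τ :: Δ)} :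
      ProtEq T (shift I) (shift O ∪ {Mem.zero.chan}) P P' →
      ProtEq T I O (.new τ P) (.new τ P')
  | compComm {Δ : S.Ctx} {I O₁ O₂ : Set (Chan Δ)} {P Q : Proto S (NoVal S) Δ}
      (hP : P.Typed (I ∪ O₂) O₁) (hQ : Q.Typed (I ∪ O₁) O₂) :
      ProtEq T I (O₁ ∪ O₂) (.par P Q) (.par Q P)
  | compAssoc {Δ : S.Ctx} {I O₁ O₂ O₃ : Set (Chan Δ)} {P Q R : Proto S (NoVal S) Δ}
      (hP : P.Typed (I ∪ O₂ ∪ O₃) O₁) (hQ : Q.Typed (I ∪ O₁ ∪ O₃) O₂)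
      (hR : R.Typed (I ∪ O₁ ∪ O₂) O₃) :
      ProtEq T I (O₁ ∪ O₂ ∪ O₃) (.par (.par P Q) R) (.par P (.par Q R))
  | newExch {Δ : S.Ctx} {I O : Set (Chan Δ)} {σ τ : S.Typ} {P : Proto S (NoVal S) (τ :: σ :: Δ)}
      (hP : P.Typed (shift (shift I))
        (shift (shift O ∪ {Mem.zero.chan}) ∪ {Mem.zero.chan})) :
      ProtEq T I O (.new σ (.new τ P)) (.new τ (.new σ (P.mapChan Ren.swap)))
  /-- `P || (new o : τ in Q) = new o : τ in (P || Q)` -/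
  | compNew {Δ : S.Ctx} {I O₁ O₂ : Set (Chan Δ)} {τ : S.Typ} {P : Proto S (NoVal S) Δ}
      {Q : Proto S (NoVal S) (τ :: Δ)}
      (hP : P.Typed (I ∪ O₂) O₁) (hQ : Q.Typed (shift (I ∪ O₁)) (shift O₂ ∪ {Mem.zero.chan})) :
      ProtEq T I (O₁ ∪ O₂) (.par P (.new τ Q)) (.new τ (.par (P.mapChan Ren.weaken) Q))
  /-- `P || Q = P` if `Q` has no outputs -/
  | absorb {Δ : S.Ctx} {I O : Set (Chan Δ)} {P Q : Proto S (NoVal S) Δ}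
      (hP : P.Typed I O) (hQ : Q.Typed (I ∪ O) ∅) : ProtEq T I O (.par P Q) P
  /-- `(o := x ← read o; R) = (o := read o)` -/
  | diverge {Δ : S.Ctx} {I : Set (Chan Δ)} {τ : S.Typ} {o : Mem Δ τ}
      {R : React S (NoVal S) Δ [τ] τ} (ho : o.chan ∉ I) (hR : R.ReadsIn (I ∪ {o.chan})) :
      ProtEq T I {o.chan} (.react o (.bind (.read o) R)) (.react o (.read o))
  /-- `(new c : σ in (o := x ← read c; K) || (c := R)) = (o := x ← R; K)` -/
  | foldBind {Δ : S.Ctx} {I : Set (Chan Δ)} {σ τ : S.Typ} {o : Mem Δ τ}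
      {R : React S (NoVal S) Δ [] σ} {K : React S (NoVal S) Δ [σ] τ}
      (ho : o.chan ∉ I) (hR : R.ReadsIn (I ∪ {o.chan})) (hK : K.ReadsIn (I ∪ {o.chan})) :
      ProtEq T I {o.chan}
        (.new σ (.par (.react o.succ (.bind (.read Mem.zero) (K.mapChan Ren.weaken)))
          (.react Mem.zero (R.mapChan Ren.weaken))))
        (.react o (.bind R K))
  /-- `(new c : τ in (o := x ← R; if x then read c else R₂) || (c := R₁))
  = (o := x ← R; if x then R₁ else R₂)` -/
  | foldIfLeft {Δ : S.Ctx} {I : Set (Chan Δ)} {τ : S.Typ} {o : Mem Δ τ}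
      {R : React S (NoVal S) Δ [] Ty.bool} {R₁ R₂ : React S (NoVal S) Δ [] τ}
      (ho : o.chan ∉ I) (hR : R.ReadsIn (I ∪ {o.chan})) (h₁ : R₁.ReadsIn (I ∪ {o.chan}))
      (h₂ : R₂.ReadsIn (I ∪ {o.chan})) :
      ProtEq T I {o.chan}
        (.new τ (.par
          (.react o.succ (.bind (R.mapChan Ren.weaken)
            (.ifte (.var Mem.zero) (.read Mem.zero) (R₂.weaken.mapChan Ren.weaken))))
          (.react Mem.zero (R₁.mapChan Ren.weaken))))
        (.react o (.bind R (.ifte (.var Mem.zero) R₁.weaken R₂.weaken)))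
  /-- `(new c : τ in (o := x ← R; if x then R₁ else read c) || (c := R₂))
  = (o := x ← R; if x then R₁ else R₂)` -/
  | foldIfRight {Δ : S.Ctx} {I : Set (Chan Δ)} {τ : S.Typ} {o : Mem Δ τ}
      {R : React S (NoVal S) Δ [] Ty.bool} {R₁ R₂ : React S (NoVal S) Δ [] τ}
      (ho : o.chan ∉ I) (hR : R.ReadsIn (I ∪ {o.chan})) (h₁ : R₁.ReadsIn (I ∪ {o.chan}))
      (h₂ : R₂.ReadsIn (I ∪ {o.chan})) :
      ProtEq T I {o.chan}
        (.new τ (.par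
          (.react o.succ (.bind (R.mapChan Ren.weaken)
            (.ifte (.var Mem.zero) (R₁.weaken.mapChan Ren.weaken) (.read Mem.zero))))
          (.react Mem.zero (R₂.mapChan Ren.weaken))))
        (.react o (.bind R (.ifte (.var Mem.zero) R₁.weaken R₂.weaken)))
  /-- `(o₁ := x₀ ← read c; R₁) || (o₂ := x₀ ← read c; x₁ ← read o₁; R₂)
  = (o₁ := x₀ ← read c; R₁) || (o₂ := x₁ ← read o₁; R₂)` if `x₀` does not occur in `R₂` -/
  | subsume {Δ : S.Ctx} {I : Set (Chan Δ)} {σ τ₁ τ₂ : S.Typ} {c : Mem Δ σ} {o₁ : Mem Δ τ₁}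
      {o₂ : Mem Δ τ₂} {R₁ : React S (NoVal S) Δ [σ] τ₁} {R₂ : React S (NoVal S) Δ [τ₁] τ₂}
      (hne : o₁.chan ≠ o₂.chan) (ho₁ : o₁.chan ∉ I) (ho₂ : o₂.chan ∉ I) (hc : c.chan ∈ I)
      (h₁ : R₁.ReadsIn (I ∪ {o₁.chan, o₂.chan})) (h₂ : R₂.ReadsIn (I ∪ {o₁.chan, o₂.chan})) :
      ProtEq T I {o₁.chan, o₂.chan}
        (.par (.react o₁ (.bind (.read c) R₁))
          (.react o₂ (.bind (.read c) (.bind (.read o₁) (R₂.rename Ren.weaken.lift)))))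
        (.par (.react o₁ (.bind (.read c) R₁)) (.react o₂ (.bind (.read o₁) R₂)))
  /-- `(o₁ := R₁) || (o₂ := x₁ ← read o₁; R₂) = (o₁ := R₁) || (o₂ := x₁ ← R₁; R₂)` if
  `(x ← R₁; y ← R₁; ret (x, y)) = (x ← R₁; ret (x, x))` -/
  | subst {Δ : S.Ctx} {I : Set (Chan Δ)} {τ₁ τ₂ : S.Typ} {o₁ : Mem Δ τ₁} {o₂ : Mem Δ τ₂}
      {R₁ : React S (NoVal S) Δ [] τ₁} {R₂ : React S (NoVal S) Δ [τ₁] τ₂}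
      (hne : o₁.chan ≠ o₂.chan) (ho₁ : o₁.chan ∉ I) (ho₂ : o₂.chan ∉ I)
      (h₁ : R₁.ReadsIn (I ∪ {o₁.chan, o₂.chan})) (h₂ : R₂.ReadsIn (I ∪ {o₁.chan, o₂.chan})) :
      ReactEq (I ∪ {o₁.chan, o₂.chan})
        (.bind R₁ (.bind R₁.weaken (.ret (.pair (.var Mem.zero.succ) (.var Mem.zero)))))
        (.bind R₁ (.ret (.pair (.var Mem.zero) (.var Mem.zero)))) →
      ProtEq T I {o₁.chan, o₂.chan}
        (.par (.react o₁ R₁) (.react o₂ (.bind (.read o₁) R₂)))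
        (.par (.react o₁ R₁) (.react o₂ (.bind R₁ R₂)))
  /-- `(o₁ := R₁) || (o₂ := x₁ ← read o₁; R₂) = (o₁ := R₁) || (o₂ := R₂)` if `x₁` does not occur
  in `R₂` and `(x₁ ← R₁; R₂) = R₂` -/
  | drop {Δ : S.Ctx} {I : Set (Chan Δ)} {τ₁ τ₂ : S.Typ} {o₁ : Mem Δ τ₁} {o₂ : Mem Δ τ₂}
      {R₁ : React S (NoVal S) Δ [] τ₁} {R₂ : React S (NoVal S) Δ [] τ₂}
      (hne : o₁.chan ≠ o₂.chan) (ho₁ : o₁.chan ∉ I) (ho₂ : o₂.chan ∉ I)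
      (h₁ : R₁.ReadsIn I) (h₂ : R₂.ReadsIn I) :
      ReactEq I (.bind R₁ R₂.weaken) R₂ →
      ProtEq T I {o₁.chan, o₂.chan}
        (.par (.react o₁ R₁) (.react o₂ (.bind (.read o₁) R₂.weaken)))
        (.par (.react o₁ R₁) (.react o₂ R₂))

/-! ## Interpretations -/

/-- The symbols of bitstrings, including the placeholder. -/
inductive Sym : Type
  | zero : Sym
  | one : Sym
  | parm : Sym

def Sym.ofBool : Bool → Sym
  | false => .zero
  | true => .one

/-- Interpretation of the type constants as sets of bitstrings of a fixed length. -/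
structure TyInterp (S : Sig) where
  len : S.TyConst → ℕ
  carrier : ∀ t : S.TyConst, Set (List.Vector Sym (len t))

/-- The values `⟦τ⟧` of a type. -/
def TyInterp.Val {S : Sig} (M : TyInterp S) : S.Typ → Type
  | .base t => ↥(M.carrier t)
  | .unit => Unit
  | .bool => Bool
  | .prod σ τ => M.Val σ × M.Val τ

/-- The bitstring that a value stands for; it determines the value, and its length depends only on
the type. -/
def TyInterp.enc {S : Sig} (M : TyInterp S) : ∀ τ : S.Typ, M.Val τ → List Sym
  | .base _, v => v.1.toList
  | .unit, _ => []
  | .bool, b => [Sym.ofBool b]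
  | .prod σ τ, v => M.enc σ v.1 ++ M.enc τ v.2

/-- An interpretation of a signature. -/
structure Interp (S : Sig) extends TyInterp S where
  fn : ∀ f : S.Fn, toTyInterp.Val (S.fnDom f) → toTyInterp.Val (S.fnCod f)
  dist : ∀ d : S.Dist, toTyInterp.Val (S.distDom d) → PMF (toTyInterp.Val (S.distCod d))

section Semantics

variable {S : Sig} (M : Interp S)

/-- The values of the interpretation, as a family of literals. -/
abbrev Interp.Lit : S.Typ → Type := M.toTyInterp.Val

/-! ## Operational semantics -/

variable {M}

/-- The value of an expression in an environment. -/
def Expr.eval {Γ : S.Ctx} (γ : ∀ τ, Mem Γ τ → M.Lit τ) : ∀ {τ : S.Typ},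
    Expr S M.Lit Γ τ → M.Lit τ
  | _, .val v => v
  | _, .var x => γ _ x
  | _, .star => ()
  | _, .tt => true
  | _, .ff => false
  | _, .app f e => M.fn f (e.eval γ)
  | _, .pair e₁ e₂ => (e₁.eval γ, e₂.eval γ)
  | _, .fst e => (e.eval γ).1
  | _, .snd e => (e.eval γ).2

/-- The value of a reaction that has finished. -/
def React.value? {V : S.Typ → Type} {Δ Γ : S.Ctx} {τ : S.Typ} : React S V Δ Γ τ → Option (V τ)
  | .val v => some v
  | _ => none

/-- Small steps of reactions, in an environment `γ` for the variables in scope; `none` means that `R`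
has no step, because it has finished or is waiting for a channel. -/
noncomputable def React.stepIn {Δ Γ : S.Ctx} (γ : ∀ τ, Mem Γ τ → M.Lit τ) : ∀ {τ : S.Typ},
    React S M.Lit Δ Γ τ → Option (PMF (React S M.Lit Δ Γ τ))
  | _, .val _ => none
  | _, .ret e => some (PMF.pure (.val (e.eval γ)))
  | _, .samp d e => some ((M.dist d (e.eval γ)).map .val)
  | _, .read _ => none
  | _, .ifte e R₁ R₂ =>
    match e.eval γ with
    | true => some (PMF.pure R₁)
    | false => some (PMF.pure R₂)
  | _, .bind R K =>
    match R.value? with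
    | some v => some (PMF.pure (K.inst (.val v)))
    | none => (R.stepIn γ).map fun η => η.map fun R' => .bind R' K

/-- The small-step relation `R → η` on closed reactions, which is deterministic. -/
noncomputable def React.step {Δ : S.Ctx} {τ : S.Typ} (R : React S M.Lit Δ [] τ) :
    Option (PMF (React S M.Lit Δ [] τ)) :=
  R.stepIn (Γ := []) fun _ x => nomatch x

/-- Partial assignments of values to channels. -/
abbrev Asg (V : S.Typ → Type) (Δ : S.Ctx) : Type := ∀ τ, Mem Δ τ → Option (V τ)

/-- The assignment of `v` to the channel `i`, and of nothing to the other channels. -/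
def Asg.single {V : S.Typ → Type} : ∀ {Δ : S.Ctx} {σ : S.Typ}, Mem Δ σ → V σ → Asg V Δ
  | _, _, .zero, v, _, .zero => some v
  | _, _, .zero, _, _, .succ _ => none
  | _, _, .succ _, _, _, .zero => none
  | _, _, .succ i, v, _, .succ c => Asg.single i v _ c

/-- The assignment in the scope of a new channel, which has no value. -/
def Asg.lift {V : S.Typ → Type} {Δ : S.Ctx} {σ : S.Typ} (a : Asg V Δ) : Asg V (σ :: Δ)
  | _, .zero => none
  | _, .succ c => a _ c

def React.assign {V : S.Typ → Type} {Δ : S.Ctx} (a : Asg V Δ) :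
    ∀ {Γ : S.Ctx} {τ : S.Typ}, React S V Δ Γ τ → React S V Δ Γ τ
  | _, _, .val v => .val v
  | _, _, .ret e => .ret e
  | _, _, .samp d e => .samp d e
  | _, _, .read c => match a _ c with
    | some v => .val v
    | none => .read c
  | _, _, .ifte e R₁ R₂ => .ifte e (R₁.assign a) (R₂.assign a)
  | _, _, .bind R K => .bind (R.assign a) (K.assign a)

def Proto.assign {V : S.Typ → Type} : ∀ {Δ : S.Ctx}, Asg V Δ → Proto S V Δ → Proto S V Δ
  | _, _, .zero => .zero
  | _, a, .react o R => .react o (R.assign a)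
  | _, _, .done o v => .done o v
  | _, a, .par P Q => .par (P.assign a) (Q.assign a)
  | _, a, .new τ P => .new τ (P.assign a.lift)

/-- `P[read i := val v]`. -/
abbrev Proto.input {V : S.Typ → Type} {Δ : S.Ctx} {σ : S.Typ} (P : Proto S V Δ) (i : Mem Δ σ)
    (v : V σ) : Proto S V Δ :=
  P.assign (Asg.single i v)

/-- The value `v` with `(o := v) ∈ P`, if there is one. -/
def Proto.valueAt {V : S.Typ → Type} : ∀ {Δ : S.Ctx} {σ : S.Typ},
    Proto S V Δ → Mem Δ σ → Option (V σ)
  | _, _, .zero, _ => none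
  | _, _, .react _ _, _ => none
  | _, _, .done o v, c => Asg.single o v _ c
  | _, _, .par P Q, c => (P.valueAt c).orElse fun _ => Q.valueAt c
  | _, _, .new _ P, c => P.valueAt c.succ

/-- The output relation: in `OutStep P o v Q`, the protocol `P` outputs `v` on the channel `o`. -/
inductive OutStep : ∀ {Δ : S.Ctx} {σ : S.Typ},
    Proto S M.Lit Δ → Mem Δ σ → M.Lit σ → Proto S M.Lit Δ → Prop
  | react {Δ : S.Ctx} {σ : S.Typ} (o : Mem Δ σ) (v : M.Lit σ) :
      OutStep (.react o (.val v)) o v (.done o v)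
  | parLeft {Δ : S.Ctx} {σ : S.Typ} {o : Mem Δ σ} {v : M.Lit σ} {P P' : Proto S M.Lit Δ}
      (Q : Proto S M.Lit Δ) : OutStep P o v P' → OutStep (.par P Q) o v (.par P' (Q.input o v))
  | parRight {Δ : S.Ctx} {σ : S.Typ} {o : Mem Δ σ} {v : M.Lit σ} {Q Q' : Proto S M.Lit Δ}
      (P : Proto S M.Lit Δ) : OutStep Q o v Q' → OutStep (.par P Q) o v (.par (P.input o v) Q')
  | new {Δ : S.Ctx} {σ τ : S.Typ} {o : Mem Δ σ} {v : M.Lit σ} {P P' : Proto S M.Lit (τ :: Δ)} :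
      OutStep P o.succ v P' → OutStep (.new τ P) o v (.new τ P')

/-- Internal steps `P → η`. -/
inductive Step : ∀ {Δ : S.Ctx}, Proto S M.Lit Δ → PMF (Proto S M.Lit Δ) → Prop
  | react {Δ : S.Ctx} {τ : S.Typ} (o : Mem Δ τ) {R : React S M.Lit Δ [] τ}
      {η : PMF (React S M.Lit Δ [] τ)} : R.step = some η → Step (.react o R) (η.map (.react o))
  | parLeft {Δ : S.Ctx} {P : Proto S M.Lit Δ} {η : PMF (Proto S M.Lit Δ)}
      (Q : Proto S M.Lit Δ) : Step P η → Step (.par P Q) (η.map fun P' => .par P' Q)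
  | parRight {Δ : S.Ctx} {Q : Proto S M.Lit Δ} {η : PMF (Proto S M.Lit Δ)}
      (P : Proto S M.Lit Δ) : Step Q η → Step (.par P Q) (η.map fun Q' => .par P Q')
  | new {Δ : S.Ctx} {τ : S.Typ} {P : Proto S M.Lit (τ :: Δ)} {η : PMF (Proto S M.Lit (τ :: Δ))} :
      Step P η → Step (.new τ P) (η.map (.new τ))
  | newOut {Δ : S.Ctx} {τ : S.Typ} {P P' : Proto S M.Lit (τ :: Δ)} {v : M.Lit τ} :
      OutStep P Mem.zero v P' → Step (.new τ P) (PMF.pure (.new τ P'))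

/-- `P ⇓ η`: output and internal steps are performed, in any order, until none is possible. -/
inductive BigStep {Δ : S.Ctx} : Proto S M.Lit Δ → PMF (Proto S M.Lit Δ) → Prop
  | halt {P : Proto S M.Lit Δ} (hs : ∀ η, ¬ Step P η)
      (ho : ∀ (σ : S.Typ) (o : Mem Δ σ) (v : M.Lit σ) (P' : Proto S M.Lit Δ),
        ¬ OutStep P o v P') : BigStep P (PMF.pure P)
  | out {σ : S.Typ} {o : Mem Δ σ} {v : M.Lit σ} {P P' : Proto S M.Lit Δ}
      {η : PMF (Proto S M.Lit Δ)} : OutStep P o v P' → BigStep P' η → BigStep P η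
  | step {P : Proto S M.Lit Δ} {μ : PMF (Proto S M.Lit Δ)}
      {κ : Proto S M.Lit Δ → PMF (Proto S M.Lit Δ)} :
      Step P μ → (∀ Q ∈ μ.support, BigStep Q (κ Q)) → BigStep P (μ.bind κ)

end Semantics

section Termination

variable {S : Sig} {M : Interp S}

/-! Every step decreases the size of a protocol, so that evaluation terminates. -/

def React.size {V : S.Typ → Type} {Δ : S.Ctx} : ∀ {Γ : S.Ctx} {τ : S.Typ}, React S V Δ Γ τ → ℕ
  | _, _, .val _ => 0
  | _, _, .ret _ => 1
  | _, _, .samp _ _ => 1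
  | _, _, .read _ => 0
  | _, _, .ifte _ R₁ R₂ => R₁.size + R₂.size + 1
  | _, _, .bind R K => R.size + K.size + 1

def Proto.size {V : S.Typ → Type} : ∀ {Δ : S.Ctx}, Proto S V Δ → ℕ
  | _, .zero => 0
  | _, .react _ R => R.size + 1
  | _, .done _ _ => 0
  | _, .par P Q => P.size + Q.size
  | _, .new _ P => P.size

theorem React.size_subst {V : S.Typ → Type} {Δ Γ : S.Ctx} {τ : S.Typ} (R : React S V Δ Γ τ) :
    ∀ {Γ' : S.Ctx} (θ : Sub S V Γ Γ'), (R.subst θ).size = R.size := by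
  induction R with
  | ifte e R₁ R₂ h₁ h₂ => intro Γ' θ; simp [React.subst, React.size, h₁, h₂]
  | bind R K h₁ h₂ => intro Γ' θ; simp [React.subst, React.size, h₁, h₂]
  | _ => intros; rfl

theorem React.size_assign {V : S.Typ → Type} {Δ Γ : S.Ctx} {τ : S.Typ} (a : Asg V Δ)
    (R : React S V Δ Γ τ) : (R.assign a).size = R.size := by
  induction R with
  | read c => simp only [React.assign]; split <;> rfl
  | ifte e R₁ R₂ h₁ h₂ => simp [React.assign, React.size, h₁, h₂]
  | bind R K h₁ h₂ => simp [React.assign, React.size, h₁, h₂]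
  | _ => rfl

theorem Proto.size_assign {V : S.Typ → Type} {Δ : S.Ctx} (P : Proto S V Δ) :
    ∀ a : Asg V Δ, (P.assign a).size = P.size := by
  induction P with
  | react o R => intro a; simp [Proto.assign, Proto.size, React.size_assign]
  | par P Q h₁ h₂ => intro a; simp [Proto.assign, Proto.size, h₁, h₂]
  | new τ P h => intro a; simp [Proto.assign, Proto.size, h]
  | _ => intros; rfl

theorem React.size_stepIn {Δ Γ : S.Ctx} {τ : S.Typ} (R : React S M.Lit Δ Γ τ) :
    ∀ (γ : ∀ τ, Mem Γ τ → M.Lit τ) (η : PMF (React S M.Lit Δ Γ τ)), R.stepIn γ = some η →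
    ∀ R' ∈ η.support, R'.size < R.size := by
  induction R with
  | val v => intro γ η h; simp [React.stepIn] at h
  | ret e => intro γ η h; simp [React.stepIn] at h; subst h; simp [React.size]
  | samp d e =>
    intro γ η h; simp only [React.stepIn, Option.some.injEq] at h; subst h
    intro R' hR'
    simp only [PMF.mem_support_map_iff] at hR'
    obtain ⟨v, _, rfl⟩ := hR'
    simp [React.size]
  | read c => intro γ η h; simp [React.stepIn] at h
  | ifte e R₁ R₂ h₁ h₂ =>
    intro γ η h
    simp only [React.stepIn] at h
    intro R' hR'
    split at h <;>
    · simp only [Option.some.injEq] at h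
      subst h
      simp only [PMF.support_pure, Set.mem_singleton_iff] at hR'
      subst hR'
      simp only [React.size]; omega
  | bind R K h₁ h₂ =>
    intro γ η h
    simp only [React.stepIn] at h
    split at h
    · simp only [Option.some.injEq] at h; subst h
      intro R' hR'
      simp only [PMF.support_pure, Set.mem_singleton_iff] at hR'
      subst hR'
      simp only [React.inst, React.size_subst, React.size]; omega
    · simp only [Option.map_eq_some_iff] at h
      obtain ⟨η', h, rfl⟩ := h
      intro R' hR'
      simp only [PMF.mem_support_map_iff] at hR'
      obtain ⟨R'', hR'', rfl⟩ := hR'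
      have := h₁ γ η' h R'' hR''
      simp only [React.size]; omega

theorem OutStep.size {Δ : S.Ctx} {σ : S.Typ} {o : Mem Δ σ} {v : M.Lit σ} {P P' : Proto S M.Lit Δ}
    (h : OutStep P o v P') : P'.size < P.size := by
  induction h with
  | react o v => simp [Proto.size]
  | parLeft Q h ih => simpa [Proto.size, Proto.size_assign] using ih
  | parRight Q h ih => simpa [Proto.size, Proto.size_assign] using ih
  | new h ih => simpa [Proto.size] using ih

theorem Step.size {Δ : S.Ctx} {P : Proto S M.Lit Δ} {μ : PMF (Proto S M.Lit Δ)} (h : Step P μ) :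
    ∀ Q ∈ μ.support, Q.size < P.size := by
  induction h with
  | react o h =>
    intro Q hQ
    simp only [PMF.mem_support_map_iff] at hQ
    obtain ⟨R', hR', rfl⟩ := hQ
    have := React.size_stepIn _ _ _ h R' hR'
    simpa [Proto.size] using this
  | parLeft Q h ih =>
    intro Q hQ
    simp only [PMF.mem_support_map_iff] at hQ
    obtain ⟨R', hR', rfl⟩ := hQ
    simpa [Proto.size] using ih R' hR'
  | parRight Q h ih =>
    intro Q hQ
    simp only [PMF.mem_support_map_iff] at hQ
    obtain ⟨R', hR', rfl⟩ := hQ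
    simpa [Proto.size] using ih R' hR'
  | new h ih =>
    intro Q hQ
    simp only [PMF.mem_support_map_iff] at hQ
    obtain ⟨R', hR', rfl⟩ := hQ
    simpa [Proto.size] using ih R' hR'
  | newOut h =>
    intro Q hQ
    simp only [PMF.support_pure, Set.mem_singleton_iff] at hQ
    subst hQ
    simpa [Proto.size] using h.size

/-- Every protocol evaluates to some distribution. -/
theorem BigStep.exists {Δ : S.Ctx} (P : Proto S M.Lit Δ) : ∃ η, BigStep P η := by
  induction hn : P.size using Nat.strong_induction_on generalizing P with
  | _ n ih =>
    subst hn
    by_cases hs : ∃ μ, Step P μ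
    · obtain ⟨μ, hμ⟩ := hs
      have h : ∀ Q : Proto S M.Lit Δ, ∃ η, Q ∈ μ.support → BigStep Q η := fun Q => by
        by_cases hQ : Q ∈ μ.support
        · obtain ⟨η, hη⟩ := ih _ (hμ.size Q hQ) Q rfl
          exact ⟨η, fun _ => hη⟩
        · exact ⟨PMF.pure Q, fun h => absurd h hQ⟩
      choose κ hκ using h
      exact ⟨_, .step hμ hκ⟩
    · by_cases ho : ∃ (σ : S.Typ) (o : Mem Δ σ) (v : M.Lit σ) (P' : Proto S M.Lit Δ), OutStep P o v P'
      · obtain ⟨σ, o, v, P', h⟩ := ho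
        obtain ⟨η, hη⟩ := ih _ h.size P' rfl
        exact ⟨η, .out h hη⟩
      · push Not at hs ho
        exact ⟨_, .halt hs ho⟩
end Termination

section Indistinguishability

variable {S : Sig} (M : Interp S)

/-- The evaluation of a protocol: the distribution `η` with `P ⇓ η`. For well-typed protocols it
does not depend on the order of the steps. -/
noncomputable def Proto.eval {M : Interp S} {Δ : S.Ctx} (P : Proto S M.Lit Δ) :
    PMF (Proto S M.Lit Δ) :=
  Classical.choose (BigStep.exists P)

/-! ## Bisimulations and sound theories -/

/-- Bisimulations between distributions on protocols `Δ ⊢ I → O`: relations that are closed under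
inputs and under computation, and for which related distributions can be split, for every output
channel, into a joint convex combination of related distributions that agree on the value of this
channel. The convex combination is given by a distribution `ν` on pairs of components. -/
structure IsBisimulation {Δ : S.Ctx} (I O : Set (Chan Δ))
    (r : PMF (Proto S M.Lit Δ) → PMF (Proto S M.Lit Δ) → Prop) : Prop where
  input : ∀ {η ε : PMF (Proto S M.Lit Δ)}, r η ε → ∀ (σ : S.Typ) (i : Mem Δ σ), i.chan ∈ I →
    ∀ v : M.Lit σ, r (η.map fun P => P.input i v) (ε.map fun P => P.input i v)
  eval : ∀ {η ε : PMF (Proto S M.Lit Δ)}, r η ε → r (η.bind Proto.eval) (ε.bind Proto.eval)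
  valuation : ∀ {η ε : PMF (Proto S M.Lit Δ)}, r η ε →
    ∀ (σ : S.Typ) (o : Mem Δ σ), o.chan ∈ O →
    ∃ ν : PMF (PMF (Proto S M.Lit Δ) × PMF (Proto S M.Lit Δ)),
      (ν.bind fun p => p.1) = η ∧ (ν.bind fun p => p.2) = ε ∧
      ∀ p ∈ ν.support, r p.1 p.2 ∧ ∃ v : Option (M.Lit σ),
        (∀ P ∈ p.1.support, P.valueAt o = v) ∧ (∀ P ∈ p.2.support, P.valueAt o = v)

/-- An equation `Δ ⊢ P = Q : I → O` is sound in an interpretation if a bisimulation relates its two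
sides. -/
def Interp.SoundEq {Δ : S.Ctx} (I O : Set (Chan Δ)) (P Q : Proto S (NoVal S) Δ) : Prop :=
  ∃ r : PMF (Proto S M.Lit Δ) → PMF (Proto S M.Lit Δ) → Prop,
    IsBisimulation M I O r ∧ r (PMF.pure P.lit) (PMF.pure Q.lit)

/-- A theory is sound in an interpretation if all its axioms are. -/
def Theory.Sound (T : Theory S) : Prop :=
  ∀ (Δ : S.Ctx) (I O : Set (Chan Δ)) (P Q : Proto S (NoVal S) Δ),
    T.Ax I O P Q → M.SoundEq I O P Q

/-! ## Turing machines -/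

/-- A probabilistic Turing machine with `k` tapes over the alphabet `A`; `none` is the blank. A
transition draws, from a distribution that depends on the state and on the scanned symbols, a new
state, the symbols to write and the moves of the heads (`none`: no move). The machine halts where
no transition is given. -/
structure PTM (A : Type) (k : ℕ) where
  State : Type
  finite_state : Finite State
  start : State
  accept : Set State
  step : State → (Fin k → Option A) →
    Option (PMF (State × (Fin k → Option A × Option Turing.Dir)))
  accept_halts : ∀ q ∈ accept, ∀ a, step q a = none

namespace PTM

variable {A : Type} {k : ℕ} (T : PTM A k)

/-- A deterministic Turing machine. -/
def Deterministic : Prop :=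
  ∀ q a μ, T.step q a = some μ → ∃ x, μ = PMF.pure x

/-- Configurations: a state and the contents of the tapes, with the positions of the heads. -/
abbrev Config : Type := T.State × (Fin k → Turing.Tape (Option A))

def Halted (c : T.Config) : Prop := T.step c.1 (fun i => (c.2 i).head) = none

/-- Write a symbol and move the head. -/
def act (t : Turing.Tape (Option A)) (x : Option A × Option Turing.Dir) :
    Turing.Tape (Option A) :=
  match x.2 with
  | none => t.write x.1
  | some d => (t.write x.1).move d

/-- One transition, if there is one. -/
noncomputable def next (c : T.Config) : PMF T.Config :=
  match T.step c.1 (fun i => (c.2 i).head) with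
  | none => PMF.pure c
  | some μ => μ.map fun x => (x.1, fun i => act (c.2 i) (x.2 i))

noncomputable def run : ℕ → T.Config → PMF T.Config
  | 0, c => PMF.pure c
  | n + 1, c => (T.next c).bind (run n)

/-- The initial configuration: the input is on the first tape, the other tapes are blank. -/
def init (w : List A) : T.Config :=
  (T.start, fun i => Turing.Tape.mk₁ (if i.val = 0 then w.map some else []))

/-- The machine has accepted with the output `w` on its first tape. -/
def Accepts (c : T.Config) (w : List A) : Prop :=
  c.1 ∈ T.accept ∧ ∀ i : Fin k, i.val = 0 → c.2 i = Turing.Tape.mk₁ (w.map some)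

/-- `T` computes the partial probabilistic function `f`, with respect to an encoding of its inputs
and an encoding of its outputs: it halts within a number of steps that is the same for all inputs
and random choices, either in an accepting state with an output, or not in an accepting state, which
means that no value is computed. -/
def Computes {X Y : Type} (encX : X → List A) (encY : Y → List A) (f : X → PMF (Option Y)) :
    Prop :=
  ∃ N : ℕ, ∀ x : X,
    (∀ c ∈ (T.run N (T.init (encX x))).support,
      T.Halted c ∧ (c.1 ∈ T.accept → ∃ y, T.Accepts c (encY y))) ∧
    ∀ y : Y, f x (some y) = (T.run N (T.init (encX x))).toOuterMeasure {c | T.Accepts c (encY y)}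

/-- `T` is a deterministic machine that computes the function `f`. -/
def ComputesFun {X Y : Type} (encX : X → List A) (encY : Y → List A) (f : X → Y) : Prop :=
  T.Deterministic ∧ T.Computes encX encY fun x => PMF.pure (some (f x))

end PTM

/-! ## Adversaries -/

/-- The symbols of values and adversary states: the symbols of bitstrings, and additional ones. -/
abbrev TapeSym (Symb : Type) : Type := Sym ⊕ Symb

/-- Strings over `{0, 1}` and the additional symbols, as strings of tape symbols. -/
def encState {Symb : Type} {l : ℕ} (s : List.Vector (Bool ⊕ Symb) l) : List (TapeSym Symb) :=
  s.toList.map (Sum.map Sym.ofBool id)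

def encVal {Symb : Type} {τ : S.Typ} (v : M.Lit τ) : List (TapeSym Symb) :=
  (M.enc τ v).map Sum.inl

/-- Adversaries for protocols `Δ ⊢ I → O`. No bound is imposed on their resources. -/
structure Adversary (Δ : S.Ctx) (I O : Set (Chan Δ)) where
  /-- The larger channel context `Δ'`. -/
  Ctx' : S.Ctx
  /-- The channels `I'` that the adversary can query. -/
  I' : Set (Chan Ctx')
  /-- The channels `O'` to which the adversary can assign a value. -/
  O' : Set (Chan Ctx')
  /-- The embedding of `Δ` into `Δ'`. -/
  φ : Embedding Δ Ctx'
  rounds : ℕ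
  rounds_pos : 1 ≤ rounds
  tapes : ℕ
  tapes_pos : 1 ≤ tapes
  Symb : Type
  finite_symb : Finite Symb
  /-- The length of the strings that are states. -/
  len : ℕ
  len_pos : 1 ≤ len
  St : Set (List.Vector (Bool ⊕ Symb) len)
  start : ↥St
  /-- The transition function, a partial probabilistic function
  `St ⇀ ({⊥} ∪ I' ∪ O') × St`, with a Turing machine that computes it. -/
  trans : ↥St → PMF (Option (Option ↥(I' ∪ O') × ↥St))
  transTM : PTM (TapeSym Symb ⊕ Option ↥(I' ∪ O')) tapes
  trans_computes : transTM.Computes (fun s => (encState s.1).map Sum.inl)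
    (fun y => Sum.inr y.1 :: (encState y.2.1).map Sum.inl) trans
  /-- The input functions `St × ⟦τ⟧ → St` for `o : τ` in `I'`, with Turing machines. -/
  inp : ∀ o : ↥I', ↥St → M.Lit o.1.1 → ↥St
  inpTM : ∀ _ : ↥I', PTM (TapeSym Symb) tapes
  inp_computes : ∀ o : ↥I', (inpTM o).ComputesFun
    (fun x : ↥St × M.Lit o.1.1 => encState x.1.1 ++ encVal M x.2)
    (fun s => encState s.1) (fun x => inp o x.1 x.2)
  /-- The output functions `St → ⟦τ⟧ ∪ {⊥}` for `i : τ` in `O'`, with Turing machines. -/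
  out : ∀ i : ↥O', ↥St → Option (M.Lit i.1.1)
  outTM : ∀ _ : ↥O', PTM (TapeSym Symb ⊕ Unit) tapes
  out_computes : ∀ i : ↥O', (outTM i).ComputesFun (fun s => (encState s.1).map Sum.inl)
    (fun y => match y with
      | none => [Sum.inr ()]
      | some v => (encVal M v).map Sum.inl) (out i)
  /-- The decision function `St → {0, 1}`, with a Turing machine. -/
  dec : ↥St → Bool
  decTM : PTM (TapeSym Symb) tapes
  dec_computes : decTM.ComputesFun (fun s => encState s.1) (fun b => [Sum.inl (Sym.ofBool b)]) dec
  I'_subset : I' ⊆ φ.toRen.image O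
  image_I_subset : φ.toRen.image I ⊆ O'
  disjoint : Disjoint (φ.toRen.image O) O'

/-! ## Interaction -/

namespace Adversary

variable {M} {Δ : S.Ctx} {I O : Set (Chan Δ)} (A : Adversary M Δ I O)

open scoped Classical in
/-- The update of the adversary state and of the protocol at the end of a round, after the protocol
has been evaluated to `P'` and the adversary has chosen the interaction `q` and the state `s'`. -/
noncomputable def update (q : Option ↥(A.I' ∪ A.O')) (s' : ↥A.St) (P' : Proto S M.Lit A.Ctx') :
    ↥A.St × Proto S M.Lit A.Ctx' :=
  match q with
  | none => (s', P')
  | some c =>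
    if hi : c.1 ∈ A.O' then
      match A.out ⟨c.1, hi⟩ s' with
      | some v => (s', P'.input c.1.2 v)
      | none => (s', P')
    else
      match P'.valueAt c.1.2 with
      | some v => (A.inp ⟨c.1, c.2.resolve_right hi⟩ s' v, P')
      | none => (s', P')

/-- One round of the interaction; `none` means that the adversary has halted. -/
noncomputable def round (x : ↥A.St × Proto S M.Lit A.Ctx') :
    PMF (Option (↥A.St × Proto S M.Lit A.Ctx')) :=
  x.2.eval.bind fun P' => (A.trans x.1).map fun
    | none => none
    | some (q, s') => some (A.update q s' P')

/-- The decision of the adversary after the given number of rounds. -/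
noncomputable def play : ℕ → ↥A.St × Proto S M.Lit A.Ctx' → PMF (Option Bool)
  | 0, x => PMF.pure (some (A.dec x.1))
  | n + 1, x => (A.round x).bind fun
    | none => PMF.pure none
    | some y => play n y

/-- The interaction of the adversary with a protocol: a sub-distribution on Booleans, as a
distribution on `Option Bool` where `none` stands for the absence of a decision. -/
noncomputable def interaction (P : Proto S (NoVal S) Δ) : PMF (Option Bool) :=
  A.play A.rounds (A.start, (P.lit (V := M.Lit)).mapChan A.φ.toRen)

/-- The probability that the interaction outputs `1`. -/
noncomputable def probOne (P : Proto S (NoVal S) Δ) : ℝ :=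
  (A.interaction P (some true)).toReal

end Adversary

end Indistinguishability

end IPDL

/-! # Perfect indistinguishability for exact equality -/

namespace IPDL

open scoped ENNReal

/-! ## Channels and assignments -/

section Channels

variable {α : Type} {l l' : List α} {a b : α}

/-! The proof replaces bisimulations by tests. A test (`Test`) is a function from protocols to [0,
∞] generated by the constant 1, weighted sums, inputs, evaluation and case distinction on the
observed outputs. Two protocols are test equivalent (`TestEq`) if no test separates them. This is an
equivalence relation for free, and a congruence rule becomes a closure property of tests: an
experiment with a context around `P` has to be an experiment with `P`.

The probability that an adversary answers 1 is a test, by induction on the rounds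
(`Adversary.test_play`). `Test.mono` and `Test.mapChan` carry it from the adversary's channel
context to that of the protocol. It remains to see that every derivable equation is a test
equivalence (`ProtEq.testEq`).

The groundwork is confluence. In a typed protocol each channel has one writer, so steps commute, and
since steps decrease the size, all evaluations give the same distribution (`BigStep.eq_eval`). Hence
`Proto.eval`, which is picked by choice, may start with any step (`Red.eval`).

Axioms: the clauses of a bisimulation match the constructors of tests (`IsBisimulation.test`).

Congruences: the main point is `Test.par`. A test of `P || Q` becomes a test of `P` that simulates
`Q`: it evaluates `P`, observes its outputs, hands them to `Q`, and turns outputs of `Q` into inputs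
of `P`.

Structural rules for composition and new channels: explicit simulations (`TestEq.of_sim`), where a
step on one side is matched by a partial evaluation of the other.

Rules with one output (congruence of assignments, divergence, folding): before the output appears,
such a protocol is determined, as far as tests can see, by the probabilities of its output values
under all assignments of channel values (`Test.sum_eq_of_outProb`). The induction passes to the runs
that are still without output, which form a subdistribution; therefore it is carried out for
weighted families. For an assignment of a reaction these probabilities are given by a denotation in
distributions on `Option` (`React.outProb`), in which reaction equality is sound (`ReactEq.den`).

Rules with two outputs: `subsume` costs one invisible step once `c` has a value. The side condition
of `subst` forces the denotation of the first reaction to be a point mass, and that of `drop` says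
that the first reaction cannot get stuck unless the second one does. These facts feed simulations up
to test equivalence (`TestEq.of_sim_upto`). -/

@[simp] theorem succ_mem_shift {I : Set (Chan l)} {x : Mem l a} :
    ((Mem.succ x : Mem (b :: l) a).chan ∈ shift (b := b) I) ↔ x.chan ∈ I := by
  constructor
  · rintro ⟨⟨d, y⟩, hd, h⟩
    cases h
    exact hd
  · intro h
    exact ⟨_, h, rfl⟩

@[simp] theorem zero_notMem_shift {I : Set (Chan l)} :
    (Mem.zero : Mem (b :: l) b).chan ∉ shift (b := b) I := by
  rintro ⟨⟨d, y⟩, hd, h⟩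
  cases h

theorem succ_chan_ne_zero {x : Mem l a} :
    (Mem.succ x : Mem (b :: l) a).chan ≠ (Mem.zero : Mem (b :: l) b).chan := by
  intro h; cases h

@[simp] theorem succ_chan_inj {x : Mem l a} {a' : α} {y : Mem l a'} :
    (Mem.succ x : Mem (b :: l) a).chan = (Mem.succ y : Mem (b :: l) a').chan ↔ x.chan = y.chan := by
  constructor
  · intro h; cases h; rfl
  · intro h; cases h; rfl

theorem shift_mono {I J : Set (Chan l)} (h : I ⊆ J) : shift (b := b) I ⊆ shift J :=
  Set.image_mono h

theorem Ren.weaken_injective (a : α) : Function.Injective ((Ren.weaken (b := b) (l := l)) a) := by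
  intro x y h; cases h; rfl

theorem Ren.lift_injective {φ : Ren l l'} (h : ∀ a, Function.Injective (φ a)) (a : α) :
    Function.Injective ((φ.lift (b := b)) a) := by
  intro x y hxy
  cases x <;> cases y <;> simp [Ren.lift] at hxy ⊢
  exact h _ hxy

theorem Ren.swap_injective (c : α) : Function.Injective ((Ren.swap (a := a) (b := b) (l := l)) c) := by
  intro x y hxy
  rcases x with _ | (_ | x) <;> rcases y with _ | (_ | y) <;> simp [Ren.swap] at hxy ⊢
  exact hxy

theorem chan_map_inj {φ : Ren l l'} (h : ∀ a, Function.Injective (φ a)) {x : Mem l a} {y : Mem l b}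
    (hxy : (φ a x).chan = (φ b y).chan) : x.chan = y.chan := by
  have h1 : a = b := congrArg Sigma.fst hxy
  subst h1
  have h2 : φ a x = φ a y := by simpa [Mem.chan] using hxy
  rw [h a h2]

theorem mem_image_of_mem (φ : Ren l l') {I : Set (Chan l)} {x : Mem l a} (h : x.chan ∈ I) :
    (φ a x).chan ∈ φ.image I := ⟨_, h, rfl⟩

theorem map_mem_image {φ : Ren l l'} (hφ : ∀ a, Function.Injective (φ a)) {I : Set (Chan l)}
    {x : Mem l a} : (φ a x).chan ∈ φ.image I ↔ x.chan ∈ I := by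
  refine ⟨?_, mem_image_of_mem φ⟩
  rintro ⟨⟨d, y⟩, hy, h⟩
  rw [← chan_map_inj hφ (x := y) (y := x) h]
  exact hy

theorem image_union {φ : Ren l l'} {I J : Set (Chan l)} :
    φ.image (I ∪ J) = φ.image I ∪ φ.image J := Set.image_union ..

theorem image_singleton {φ : Ren l l'} {x : Mem l a} :
    φ.image {x.chan} = {(φ a x).chan} := Set.image_singleton ..

theorem image_lift_shift {φ : Ren l l'} {I : Set (Chan l)} :
    (φ.lift (b := b)).image (shift I) = shift (φ.image I) := by
  simp only [shift, Ren.image, Set.image_image]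
  rfl

/-- A bisimulation splits along one output at a time; finiteness allows splitting along all of them.
-/
instance finite_chan (l : List α) : Finite (Chan l) := by
  induction l with
  | nil => exact Finite.of_injective (β := Empty) (fun x => nomatch x.2) (fun x => nomatch x.2)
  | cons b l ih =>
    refine Finite.of_surjective (α := Option (Chan l))
      (fun c => c.elim ⟨b, Mem.zero⟩ fun d => ⟨d.1, d.2.succ⟩) ?_
    rintro ⟨a, x⟩
    cases x with
    | zero => exact ⟨none, rfl⟩
    | succ x => exact ⟨some ⟨a, x⟩, rfl⟩

end Channels

/-! ### Partial assignments and their left-biased union -/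

section Assignments

variable {S : Sig} {V : S.Typ → Type} {Δ : S.Ctx}

/-- The assignment `a`, completed by `b`. -/
def Asg.or (a b : Asg V Δ) : Asg V Δ := fun τ c => (a τ c).or (b τ c)

/-- The assignment of nothing. -/
def Asg.none : Asg V Δ := fun _ _ => Option.none

@[simp] theorem Asg.or_apply (a b : Asg V Δ) {τ : S.Typ} (c : Mem Δ τ) :
    (a.or b) τ c = (a τ c).or (b τ c) := rfl

theorem Asg.or_assoc (a b c : Asg V Δ) : (a.or b).or c = a.or (b.or c) := by
  funext τ x; simp [Option.or_assoc]

@[simp] theorem Asg.or_none (a : Asg V Δ) : a.or Asg.none = a := by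
  funext τ x; exact Option.or_none

@[simp] theorem Asg.none_or (a : Asg V Δ) : Asg.none.or a = a := by
  funext τ x; exact Option.none_or

theorem Asg.or_comm {a b : Asg V Δ} (h : ∀ τ c, a τ c = Option.none ∨ b τ c = Option.none) :
    a.or b = b.or a := by
  funext τ c; rcases h τ c with h | h <;> simp [h]

@[simp] theorem Asg.single_self {σ : S.Typ} (i : Mem Δ σ) (v : V σ) :
    Asg.single i v σ i = some v := by
  induction i with
  | zero => rfl
  | succ i ih => exact ih v

theorem Asg.single_ne {σ τ : S.Typ} {i : Mem Δ σ} {v : V σ} {c : Mem Δ τ} (h : i.chan ≠ c.chan) :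
    Asg.single i v τ c = Option.none := by
  induction i with
  | zero =>
    cases c with
    | zero => exact absurd rfl h
    | succ c => rfl
  | succ i ih =>
    cases c with
    | zero => rfl
    | succ c => exact ih (fun h' => h (succ_chan_inj.2 h'))

theorem Asg.single_map {Δ' : S.Ctx} {φ : Ren Δ Δ'} (hφ : ∀ a, Function.Injective (φ a)) {σ : S.Typ}
    (i : Mem Δ σ) (v : V σ) :
    (fun τ c => Asg.single (φ _ i) v τ (φ τ c)) = Asg.single i v := by
  funext τ c
  by_cases h : i.chan = c.chan
  · cases h; simp
  · rw [Asg.single_ne h, Asg.single_ne]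
    exact fun h' => h (chan_map_inj hφ h')

theorem Asg.lift_single {σ τ : S.Typ} (i : Mem Δ σ) (v : V σ) :
    ((Asg.single i v).lift : Asg V (τ :: Δ)) = Asg.single i.succ v := by
  funext ρ c; cases c <;> rfl

theorem Asg.lift_or {σ : S.Typ} (a b : Asg V Δ) :
    ((a.or b).lift : Asg V (σ :: Δ)) = a.lift.or b.lift := by
  funext ρ c; cases c <;> rfl

theorem Asg.lift_none {σ : S.Typ} : ((Asg.none : Asg V Δ).lift : Asg V (σ :: Δ)) = Asg.none := by
  funext ρ c; cases c <;> rfl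

theorem Asg.lift_comp {Δ' : S.Ctx} (φ : Ren Δ Δ') {σ : S.Typ} (a : Asg V Δ') :
    (fun τ c => (a.lift : Asg V (σ :: Δ')) τ (φ.lift τ c)) =
      (Asg.lift (fun τ c => a τ (φ τ c)) : Asg V (σ :: Δ)) := by
  funext τ c; cases c <;> rfl

end Assignments

/-! ## Syntactic operations -/

section Terms

variable {S : Sig} {V W : S.Typ → Type} {Δ Δ' Γ Γ' : S.Ctx} {τ : S.Typ}

theorem React.assign_or (R : React S V Δ Γ τ) (a b : Asg V Δ) :
    (R.assign a).assign b = R.assign (a.or b) := by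
  induction R with
  | read c =>
    simp only [React.assign, Asg.or_apply]
    cases h : a _ c <;> simp [React.assign]
  | ifte e R₁ R₂ h₁ h₂ => simp [React.assign, h₁, h₂]
  | bind R K h₁ h₂ => simp [React.assign, h₁, h₂]
  | _ => rfl

theorem React.assign_subst (R : React S V Δ Γ τ) (a : Asg V Δ) :
    ∀ {Γ' : S.Ctx} (θ : Sub S V Γ Γ'), (R.subst θ).assign a = (R.assign a).subst θ := by
  induction R with
  | read c =>
    intro Γ' θ
    simp only [React.assign, React.subst]
    cases h : a _ c <;> simp [React.subst]
  | ifte e R₁ R₂ h₁ h₂ => intro Γ' θ; simp [React.assign, React.subst, h₁, h₂]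
  | bind R K h₁ h₂ => intro Γ' θ; simp [React.assign, React.subst, h₁, h₂]
  | _ => intros; rfl

theorem React.assign_rename (R : React S V Δ Γ τ) (a : Asg V Δ) :
    ∀ {Γ' : S.Ctx} (ρ : Ren Γ Γ'), (R.rename ρ).assign a = (R.assign a).rename ρ := by
  induction R with
  | read c =>
    intro Γ' θ
    simp only [React.assign, React.rename]
    cases h : a _ c <;> simp [React.rename]
  | ifte e R₁ R₂ h₁ h₂ => intro Γ' θ; simp [React.assign, React.rename, h₁, h₂]
  | bind R K h₁ h₂ => intro Γ' θ; simp [React.assign, React.rename, h₁, h₂]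
  | _ => intros; rfl

theorem React.mapChan_assign (φ : Ren Δ Δ') (R : React S V Δ Γ τ) (a : Asg V Δ') :
    (R.mapChan φ).assign a = (R.assign fun τ c => a τ (φ τ c)).mapChan φ := by
  induction R with
  | read c =>
    simp only [React.assign, React.mapChan]
    cases h : a _ (φ _ c) <;> simp [React.mapChan]
  | ifte e R₁ R₂ h₁ h₂ => simp [React.assign, React.mapChan, h₁, h₂]
  | bind R K h₁ h₂ => simp [React.assign, React.mapChan, h₁, h₂]
  | _ => rfl

theorem React.mapChan_subst (φ : Ren Δ Δ') (R : React S V Δ Γ τ) :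
    ∀ {Γ' : S.Ctx} (θ : Sub S V Γ Γ'), (R.subst θ).mapChan φ = (R.mapChan φ).subst θ := by
  induction R with
  | ifte e R₁ R₂ h₁ h₂ => intro Γ' θ; simp [React.subst, React.mapChan, h₁, h₂]
  | bind R K h₁ h₂ => intro Γ' θ; simp [React.subst, React.mapChan, h₁, h₂]
  | _ => intros; rfl

theorem React.mapChan_mapVal (φ : Ren Δ Δ') (f : ∀ τ, V τ → W τ) (R : React S V Δ Γ τ) :
    (R.mapChan φ).mapVal f = (R.mapVal f).mapChan φ := by
  induction R with
  | ifte e R₁ R₂ h₁ h₂ => simp [React.mapVal, React.mapChan, h₁, h₂]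
  | bind R K h₁ h₂ => simp [React.mapVal, React.mapChan, h₁, h₂]
  | _ => rfl

theorem Expr.subst_rename (e : Expr S V Γ τ) {Γ' Γ'' : S.Ctx} (ρ : Ren Γ Γ') (θ : Sub S V Γ' Γ'') :
    (e.rename ρ).subst θ = e.subst fun τ x => θ τ (ρ τ x) := by
  induction e with
  | app f e h => simp [Expr.rename, Expr.subst, h]
  | pair e₁ e₂ h₁ h₂ => simp [Expr.rename, Expr.subst, h₁, h₂]
  | fst e h => simp [Expr.rename, Expr.subst, h]
  | snd e h => simp [Expr.rename, Expr.subst, h]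
  | _ => rfl

theorem Expr.subst_var (e : Expr S V Γ τ) : e.subst (fun _ x => .var x) = e := by
  induction e with
  | app f e h => simp [Expr.subst, h]
  | pair e₁ e₂ h₁ h₂ => simp [Expr.subst, h₁, h₂]
  | fst e h => simp [Expr.subst, h]
  | snd e h => simp [Expr.subst, h]
  | _ => rfl

theorem Sub.lift_rename {Γ'' : S.Ctx} {σ : S.Typ} (ρ : Ren Γ Γ') (θ : Sub S V Γ' Γ'') :
    (fun τ x => (θ.lift (σ := σ)) τ (ρ.lift τ x)) = Sub.lift (fun τ x => θ τ (ρ τ x)) := by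
  funext τ x; cases x <;> rfl

theorem Sub.lift_var {σ : S.Typ} :
    (Sub.lift (σ := σ) (fun _ x => .var x) : Sub S V (σ :: Γ) (σ :: Γ)) = fun _ x => .var x := by
  funext τ x; cases x <;> rfl

theorem React.subst_rename (R : React S V Δ Γ τ) :
    ∀ {Γ' Γ'' : S.Ctx} (ρ : Ren Γ Γ') (θ : Sub S V Γ' Γ''),
      (R.rename ρ).subst θ = R.subst fun τ x => θ τ (ρ τ x) := by
  induction R with
  | ret e => intros; simp [React.rename, React.subst, Expr.subst_rename]
  | samp d e => intros; simp [React.rename, React.subst, Expr.subst_rename]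
  | ifte e R₁ R₂ h₁ h₂ => intros; simp [React.rename, React.subst, h₁, h₂, Expr.subst_rename]
  | bind R K h₁ h₂ => intros; simp [React.rename, React.subst, h₁, h₂, Sub.lift_rename]
  | _ => intros; rfl

theorem React.subst_var (R : React S V Δ Γ τ) : R.subst (fun _ x => .var x) = R := by
  induction R with
  | ret e => simp [React.subst, Expr.subst_var]
  | samp d e => simp [React.subst, Expr.subst_var]
  | ifte e R₁ R₂ h₁ h₂ => simp [React.subst, h₁, h₂, Expr.subst_var]
  | bind R K h₁ h₂ => simp [React.subst, h₁, h₂, Sub.lift_var]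
  | _ => rfl

@[simp] theorem React.weaken_inst {σ : S.Typ} (R : React S V Δ Γ τ) (e : Expr S V Γ σ) :
    R.weaken.inst e = R := by
  rw [React.weaken, React.inst, React.subst_rename]
  exact R.subst_var

/-! ### The channels that are read -/

theorem React.ReadsIn.mono {R : React S V Δ Γ τ} {I J : Set (Chan Δ)} (h : R.ReadsIn I)
    (hIJ : I ⊆ J) : R.ReadsIn J := by
  induction R with
  | read c => exact hIJ h
  | ifte e R₁ R₂ h₁ h₂ => exact ⟨h₁ h.1, h₂ h.2⟩
  | bind R K h₁ h₂ => exact ⟨h₁ h.1, h₂ h.2⟩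
  | _ => trivial

theorem React.readsIn_subst (R : React S V Δ Γ τ) {I : Set (Chan Δ)} :
    ∀ {Γ' : S.Ctx} (θ : Sub S V Γ Γ'), (R.subst θ).ReadsIn I ↔ R.ReadsIn I := by
  induction R with
  | ifte e R₁ R₂ h₁ h₂ => intros; simp [React.subst, React.ReadsIn, h₁, h₂]
  | bind R K h₁ h₂ => intros; simp [React.subst, React.ReadsIn, h₁, h₂]
  | _ => intros; rfl

theorem React.readsIn_rename (R : React S V Δ Γ τ) {I : Set (Chan Δ)} :
    ∀ {Γ' : S.Ctx} (ρ : Ren Γ Γ'), (R.rename ρ).ReadsIn I ↔ R.ReadsIn I := by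
  induction R with
  | ifte e R₁ R₂ h₁ h₂ => intros; simp [React.rename, React.ReadsIn, h₁, h₂]
  | bind R K h₁ h₂ => intros; simp [React.rename, React.ReadsIn, h₁, h₂]
  | _ => intros; rfl

theorem React.readsIn_mapVal (f : ∀ τ, V τ → W τ) (R : React S V Δ Γ τ) {I : Set (Chan Δ)} :
    (R.mapVal f).ReadsIn I ↔ R.ReadsIn I := by
  induction R with
  | ifte e R₁ R₂ h₁ h₂ => simp [React.mapVal, React.ReadsIn, h₁, h₂]
  | bind R K h₁ h₂ => simp [React.mapVal, React.ReadsIn, h₁, h₂]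
  | _ => rfl

theorem React.ReadsIn.mapChan {R : React S V Δ Γ τ} {I : Set (Chan Δ)} (φ : Ren Δ Δ')
    (h : R.ReadsIn I) : (R.mapChan φ).ReadsIn (φ.image I) := by
  induction R with
  | read c => exact mem_image_of_mem φ h
  | ifte e R₁ R₂ h₁ h₂ => exact ⟨h₁ h.1, h₂ h.2⟩
  | bind R K h₁ h₂ => exact ⟨h₁ h.1, h₂ h.2⟩
  | _ => trivial

/-- A channel that has received its value is not read any more, so handing over the same values
twice has no further effect. `Test.par_eval` depends on this, through `Proto.Typed.assign`. -/
theorem React.ReadsIn.assign {R : React S V Δ Γ τ} {I : Set (Chan Δ)} (a : Asg V Δ)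
    (h : R.ReadsIn I) : (R.assign a).ReadsIn {c | c ∈ I ∧ a c.1 c.2 = none} := by
  induction R with
  | read c =>
    simp only [React.assign]
    split
    · trivial
    · exact ⟨h, by assumption⟩
  | ifte e R₁ R₂ h₁ h₂ => exact ⟨h₁ h.1, h₂ h.2⟩
  | bind R K h₁ h₂ => exact ⟨h₁ h.1, h₂ h.2⟩
  | _ => trivial

theorem React.ReadsIn.assign_eq {R : React S V Δ Γ τ} {I : Set (Chan Δ)} {a : Asg V Δ}
    (h : R.ReadsIn I) (ha : ∀ c ∈ I, a c.1 c.2 = none) : R.assign a = R := by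
  induction R with
  | read c =>
    have := ha _ h
    simp only at this
    simp [React.assign, this]
  | ifte e R₁ R₂ h₁ h₂ => simp [React.assign, h₁ h.1, h₂ h.2]
  | bind R K h₁ h₂ => simp [React.assign, h₁ h.1, h₂ h.2]
  | _ => rfl

theorem React.readsIn_univ (R : React S V Δ Γ τ) : R.ReadsIn Set.univ := by
  induction R with
  | ifte e R₁ R₂ h₁ h₂ => exact ⟨h₁, h₂⟩
  | bind R K h₁ h₂ => exact ⟨h₁, h₂⟩
  | _ => trivial

theorem React.assign_none (R : React S V Δ Γ τ) : R.assign Asg.none = R :=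
  R.readsIn_univ.assign_eq fun _ _ => rfl

end Terms

/-! ### Protocols -/

section Protocols

variable {S : Sig} {V W : S.Typ → Type}

theorem Proto.assign_or {Δ : S.Ctx} (P : Proto S V Δ) :
    ∀ a b : Asg V Δ, (P.assign a).assign b = P.assign (a.or b) := by
  induction P with
  | react o R => intro a b; simp [Proto.assign, React.assign_or]
  | par P Q h₁ h₂ => intro a b; simp [Proto.assign, h₁, h₂]
  | new τ P h => intro a b; simp [Proto.assign, h, Asg.lift_or]
  | _ => intros; rfl

theorem Proto.assign_none {Δ : S.Ctx} (P : Proto S V Δ) : P.assign Asg.none = P := by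
  induction P with
  | react o R => simp [Proto.assign, React.assign_none]
  | par P Q h₁ h₂ => simp [Proto.assign, h₁, h₂]
  | new τ P h => simp [Proto.assign, h, Asg.lift_none]
  | _ => rfl

theorem Proto.mapChan_assign {Δ : S.Ctx} (P : Proto S V Δ) :
    ∀ {Δ' : S.Ctx} (φ : Ren Δ Δ') (a : Asg V Δ'),
      (P.mapChan φ).assign a = (P.assign fun τ c => a τ (φ τ c)).mapChan φ := by
  induction P with
  | react o R => intro Δ' φ a; simp [Proto.assign, Proto.mapChan, React.mapChan_assign]
  | par P Q h₁ h₂ => intro Δ' φ a; simp [Proto.assign, Proto.mapChan, h₁, h₂]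
  | new τ P h => intro Δ' φ a; simp [Proto.assign, Proto.mapChan, h, Asg.lift_comp]
  | _ => intros; rfl

theorem Proto.mapChan_input {Δ Δ' : S.Ctx} {φ : Ren Δ Δ'} (hφ : ∀ a, Function.Injective (φ a))
    {σ : S.Typ} (P : Proto S V Δ) (o : Mem Δ σ) (v : V σ) :
    (P.mapChan φ).input (φ σ o) v = (P.input o v).mapChan φ := by
  rw [Proto.input, Proto.mapChan_assign, Asg.single_map hφ]

theorem Proto.mapChan_mapVal {Δ : S.Ctx} (f : ∀ τ, V τ → W τ) (P : Proto S V Δ) :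
    ∀ {Δ' : S.Ctx} (φ : Ren Δ Δ'), (P.mapChan φ).mapVal f = (P.mapVal f).mapChan φ := by
  induction P with
  | react o R => intros; simp [Proto.mapVal, Proto.mapChan, React.mapChan_mapVal]
  | par P Q h₁ h₂ => intros; simp [Proto.mapVal, Proto.mapChan, h₁, h₂]
  | new τ P h => intros; simp [Proto.mapVal, Proto.mapChan, h]
  | _ => intros; rfl

/-- The values that a protocol has put on its channels. -/
def Proto.vals {Δ : S.Ctx} (P : Proto S V Δ) : Asg V Δ := fun _ c => P.valueAt c

theorem Proto.vals_par {Δ : S.Ctx} (P Q : Proto S V Δ) : (Proto.par P Q).vals = P.vals.or Q.vals := by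
  funext τ c; simp [Proto.vals, Proto.valueAt]

/-- Assignments act on reads only, never on values already output. -/
theorem Proto.vals_assign {Δ : S.Ctx} (P : Proto S V Δ) :
    ∀ (a : Asg V Δ), (P.assign a).vals = P.vals := by
  induction P with
  | par P Q h₁ h₂ => intro a; simp only [Proto.assign, Proto.vals_par, h₁, h₂]
  | new τ P h =>
    intro a; funext σ c
    exact congrFun (congrFun (h a.lift) σ) c.succ
  | _ => intros; rfl

theorem Proto.vals_new {Δ : S.Ctx} {τ : S.Typ} (P : Proto S V (τ :: Δ)) :
    (Proto.new τ P).vals = fun σ c => P.vals σ c.succ := rfl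

theorem Proto.vals_mapChan {Δ : S.Ctx} (P : Proto S V Δ) : ∀ {Δ' : S.Ctx} {φ : Ren Δ Δ'}
    (_ : ∀ a, Function.Injective (φ a)) {τ : S.Typ} (c : Mem Δ τ),
    (P.mapChan φ).vals τ (φ τ c) = P.vals τ c := by
  induction P with
  | done o v => intro Δ' φ hφ τ c; exact congrFun (congrFun (Asg.single_map hφ o v) τ) c
  | par P Q h₁ h₂ =>
    intro Δ' φ hφ τ c
    simp only [Proto.mapChan, Proto.vals_par, Asg.or_apply, h₁ hφ, h₂ hφ]
  | new σ P h =>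
    intro Δ' φ hφ τ c
    exact h (Ren.lift_injective hφ) c.succ
  | _ => intros; rfl

theorem Proto.vals_mapChan_none {Δ : S.Ctx} (P : Proto S V Δ) : ∀ {Δ' : S.Ctx} {φ : Ren Δ Δ'}
    {τ : S.Typ} (c' : Mem Δ' τ) (_ : ∀ c : Mem Δ τ, φ τ c ≠ c'),
    (P.mapChan φ).vals τ c' = none := by
  induction P with
  | done o v =>
    intro Δ' φ τ c' hc
    refine Asg.single_ne fun h => ?_
    cases h
    exact hc _ rfl
  | par P Q h₁ h₂ =>
    intro Δ' φ τ c' hc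
    simp only [Proto.mapChan, Proto.vals_par, Asg.or_apply, h₁ c' hc, h₂ c' hc, Option.or_none]
  | new σ P h =>
    intro Δ' φ τ c' hc
    refine h c'.succ fun c hc' => ?_
    cases c with
    | zero => cases hc'
    | succ c =>
      simp only [Ren.lift, Mem.succ.injEq] at hc'
      exact hc c hc'
  | _ => intros; rfl

/-! ### Typing -/

theorem Proto.Typed.par_inv {Δ : S.Ctx} {I O : Set (Chan Δ)} {P Q : Proto S V Δ}
    (h : (Proto.par P Q).Typed I O) : ∃ O₁ O₂, O = O₁ ∪ O₂ ∧ P.Typed (I ∪ O₂) O₁ ∧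
      Q.Typed (I ∪ O₁) O₂ := by
  cases h with
  | par hP hQ => exact ⟨_, _, rfl, hP, hQ⟩

theorem Proto.Typed.react_inv {Δ : S.Ctx} {I O : Set (Chan Δ)} {τ : S.Typ} {o : Mem Δ τ}
    {R : React S V Δ [] τ} (h : (Proto.react o R).Typed I O) :
    O = {o.chan} ∧ o.chan ∉ I ∧ R.ReadsIn (I ∪ {o.chan}) := by
  cases h with
  | react ho hR => exact ⟨rfl, ho, hR⟩

theorem Proto.Typed.new_inv {Δ : S.Ctx} {I O : Set (Chan Δ)} {τ : S.Typ} {P : Proto S V (τ :: Δ)}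
    (h : (Proto.new τ P).Typed I O) : P.Typed (shift I) (shift O ∪ {Mem.zero.chan}) := by
  cases h with
  | new hP => exact hP

theorem Proto.Typed.disjoint {Δ : S.Ctx} {I O : Set (Chan Δ)} {P : Proto S V Δ}
    (h : P.Typed I O) : ∀ c ∈ O, c ∉ I := by
  induction h with
  | zero => simp
  | react ho hR => rintro c rfl; exact ho
  | done ho => rintro c rfl; exact ho
  | par hP hQ h₁ h₂ =>
    rintro c (hc | hc) hI
    · exact h₁ c hc (.inl hI)
    · exact h₂ c hc (.inl hI)
  | new hP ih =>
    rintro ⟨τ, c⟩ hc hI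
    exact ih c.succ.chan (.inl (succ_mem_shift.2 hc)) (succ_mem_shift.2 hI)

theorem Proto.Typed.mono {Δ : S.Ctx} {I O : Set (Chan Δ)} {P : Proto S V Δ} (h : P.Typed I O) :
    ∀ {J : Set (Chan Δ)}, I ⊆ J → (∀ c ∈ O, c ∉ J) → P.Typed J O := by
  induction h with
  | zero => intros; exact .zero
  | react ho hR =>
    intro J hJ hO
    exact .react (hO _ rfl) (hR.mono (Set.union_subset_union_left _ hJ))
  | done ho => intro J hJ hO; exact .done (hO _ rfl)
  | par hP hQ h₁ h₂ =>
    intro J hJ hO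
    refine .par (h₁ (Set.union_subset_union_left _ hJ) ?_) (h₂ (Set.union_subset_union_left _ hJ) ?_)
    · rintro c hc (h | h)
      · exact hO c (.inl hc) h
      · exact hP.disjoint c hc (.inr h)
    · rintro c hc (h | h)
      · exact hO c (.inr hc) h
      · exact hQ.disjoint c hc (.inr h)
  | new hP ih =>
    intro J hJ hO
    refine .new (ih (shift_mono hJ) ?_)
    rintro _ (⟨c, hc, rfl⟩ | rfl) hc'
    · exact hO _ hc (succ_mem_shift.1 hc')
    · exact zero_notMem_shift hc'

theorem Proto.Typed.assign {Δ : S.Ctx} {I O : Set (Chan Δ)} {P : Proto S V Δ} (h : P.Typed I O) :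
    ∀ a : Asg V Δ, (P.assign a).Typed {c | c ∈ I ∧ a c.1 c.2 = none} O := by
  induction h with
  | zero => intro a; exact .zero
  | react ho hR =>
    intro a
    refine .react (fun h => ho h.1) ((hR.assign a).mono ?_)
    rintro c ⟨hc | hc, hc'⟩
    · exact .inl ⟨hc, hc'⟩
    · exact .inr hc
  | done ho => intro a; exact .done (fun h => ho h.1)
  | @par _ _ O₁ O₂ _ _ hP hQ h₁ h₂ =>
    intro a
    refine .par ((h₁ a).mono ?_ ?_) ((h₂ a).mono ?_ ?_)
    · rintro c ⟨hc | hc, hc'⟩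
      · exact .inl ⟨hc, hc'⟩
      · exact .inr hc
    · rintro c hc (h | h)
      · exact hP.disjoint c hc (.inl h.1)
      · exact hP.disjoint c hc (.inr h)
    · rintro c ⟨hc | hc, hc'⟩
      · exact .inl ⟨hc, hc'⟩
      · exact .inr hc
    · rintro c hc (h | h)
      · exact hQ.disjoint c hc (.inl h.1)
      · exact hQ.disjoint c hc (.inr h)
  | new hP ih =>
    intro a
    refine .new ((ih a.lift).mono ?_ ?_)
    · rintro _ ⟨⟨c, hc, rfl⟩, hc'⟩
      exact ⟨c, ⟨hc, hc'⟩, rfl⟩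
    · rintro c hc ⟨d, hd, rfl⟩
      exact hP.disjoint _ hc ⟨d, hd.1, rfl⟩

theorem Proto.Typed.assign' {Δ : S.Ctx} {I O : Set (Chan Δ)} {P : Proto S V Δ} (h : P.Typed I O)
    (a : Asg V Δ) : (P.assign a).Typed I O :=
  (h.assign a).mono (fun _ h => h.1) h.disjoint

theorem Proto.Typed.assign_eq {Δ : S.Ctx} {I O : Set (Chan Δ)} {P : Proto S V Δ}
    (h : P.Typed I O) : ∀ {a : Asg V Δ}, (∀ c ∈ I, a c.1 c.2 = none) →
    (∀ c ∈ O, a c.1 c.2 = none) → P.assign a = P := by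
  induction h with
  | zero => intros; rfl
  | react ho hR =>
    intro a hI hO
    rw [Proto.assign, hR.assign_eq]
    rintro c (hc | hc)
    · exact hI c hc
    · exact hO c hc
  | done ho => intros; rfl
  | par hP hQ h₁ h₂ =>
    intro a hI hO
    rw [Proto.assign, h₁, h₂]
    · rintro c (hc | hc)
      · exact hI c hc
      · exact hO c (.inl hc)
    · exact fun c hc => hO c (.inr hc)
    · rintro c (hc | hc)
      · exact hI c hc
      · exact hO c (.inr hc)
    · exact fun c hc => hO c (.inl hc)
  | new hP ih =>
    intro a hI hO
    rw [Proto.assign, ih]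
    · rintro _ ⟨c, hc, rfl⟩
      exact hI c hc
    · rintro _ (⟨c, hc, rfl⟩ | rfl)
      · exact hO c hc
      · rfl

theorem Proto.Typed.vals_eq_none {Δ : S.Ctx} {I O : Set (Chan Δ)} {P : Proto S V Δ}
    (h : P.Typed I O) : ∀ {τ : S.Typ} {c : Mem Δ τ}, c.chan ∉ O → P.vals τ c = none := by
  induction h with
  | zero => intros; rfl
  | react ho hR => intros; rfl
  | done ho => intro τ c hc; exact Asg.single_ne (fun h => hc h.symm)
  | par hP hQ h₁ h₂ =>
    intro τ c hc
    rw [Proto.vals_par, Asg.or_apply, h₁ fun h => hc (.inl h), h₂ fun h => hc (.inr h)]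
    rfl
  | new hP ih =>
    intro τ c hc
    refine ih (c := c.succ) ?_
    rintro (h | h)
    · exact hc (succ_mem_shift.1 h)
    · exact succ_chan_ne_zero h

theorem Proto.Typed.mapChan {Δ : S.Ctx} {I O : Set (Chan Δ)} {P : Proto S V Δ} (h : P.Typed I O) :
    ∀ {Δ' : S.Ctx} {φ : Ren Δ Δ'} (_ : ∀ a, Function.Injective (φ a)),
      (P.mapChan φ).Typed (φ.image I) (φ.image O) := by
  induction h with
  | zero => intro Δ' φ hφ; rw [Ren.image, Ren.image, Set.image_empty]; exact .zero
  | react ho hR =>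
    intro Δ' φ hφ
    rw [image_singleton]
    refine .react (fun h => ho ((map_mem_image hφ).1 h)) ?_
    rw [← image_singleton, ← image_union]
    exact hR.mapChan φ
  | done ho =>
    intro Δ' φ hφ
    rw [image_singleton]
    exact .done (fun h => ho ((map_mem_image hφ).1 h))
  | par hP hQ h₁ h₂ =>
    intro Δ' φ hφ
    rw [image_union]
    exact .par (by rw [← image_union]; exact h₁ hφ) (by rw [← image_union]; exact h₂ hφ)
  | @new _ I O τ P hP ih =>
    intro Δ' φ hφ
    refine .new ?_
    have := ih (Ren.lift_injective (b := τ) hφ)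
    rwa [image_union, image_lift_shift, image_lift_shift, image_singleton] at this

theorem Proto.Typed.mapVal {Δ : S.Ctx} {I O : Set (Chan Δ)} {P : Proto S V Δ} (h : P.Typed I O)
    (f : ∀ τ, V τ → W τ) : (P.mapVal f).Typed I O := by
  induction h with
  | zero => exact .zero
  | react ho hR => exact .react ho ((React.readsIn_mapVal f _).2 hR)
  | done ho => exact .done ho
  | par hP hQ h₁ h₂ => exact .par h₁ h₂
  | new hP ih => exact .new ih

end Protocols

/-! ## Reduction -/

section Reduction

variable {S : Sig} {M : Interp S}

theorem React.value?_eq_some {V : S.Typ → Type} {Δ Γ : S.Ctx} {τ : S.Typ} {R : React S V Δ Γ τ}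
    {v : V τ} (h : R.value? = some v) : R = .val v := by
  cases R <;> simp [React.value?] at h
  rw [h]

theorem React.value?_mapChan {V : S.Typ → Type} {Δ Δ' Γ : S.Ctx} {τ : S.Typ} (φ : Ren Δ Δ')
    (R : React S V Δ Γ τ) : (R.mapChan φ).value? = R.value? := by
  cases R <;> rfl

theorem React.stepIn_bind_val {Δ Γ : S.Ctx} {σ τ : S.Typ} (γ : ∀ τ, Mem Γ τ → M.Lit τ)
    (v : M.Lit σ) (K : React S M.Lit Δ (σ :: Γ) τ) :
    (React.bind (.val v) K).stepIn γ = some (PMF.pure (K.inst (.val v))) := by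
  simp [React.stepIn, React.value?]

theorem React.stepIn_bind {Δ Γ : S.Ctx} {σ τ : S.Typ} (γ : ∀ τ, Mem Γ τ → M.Lit τ)
    {R : React S M.Lit Δ Γ σ} (hR : R.value? = none) (K : React S M.Lit Δ (σ :: Γ) τ) :
    (React.bind R K).stepIn γ = (R.stepIn γ).map fun η => η.map fun R' => .bind R' K := by
  simp [React.stepIn, hR]

/-- An assignment can release a waiting `read` but cannot block or change a step. The converse fails
for the same reason. -/
theorem React.stepIn_assign {Δ Γ : S.Ctx} {τ : S.Typ} (γ : ∀ τ, Mem Γ τ → M.Lit τ) (a : Asg M.Lit Δ)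
    (R : React S M.Lit Δ Γ τ) : ∀ {η : PMF (React S M.Lit Δ Γ τ)}, R.stepIn γ = some η →
    (R.assign a).stepIn γ = some (η.map (React.assign a)) := by
  induction R with
  | val v => intro η h; simp [React.stepIn] at h
  | ret e =>
    intro η h
    simp only [React.stepIn, Option.some.injEq] at h
    subst h
    simp [React.assign, React.stepIn, PMF.pure_map]
  | samp d e =>
    intro η h
    simp only [React.stepIn, Option.some.injEq] at h
    subst h
    simp only [React.assign, React.stepIn, PMF.map_comp]
    rfl
  | read c => intro η h; simp [React.stepIn] at h
  | ifte e R₁ R₂ h₁ h₂ =>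
    intro η h
    simp only [React.stepIn, React.assign] at h ⊢
    split at h <;>
    · simp only [Option.some.injEq] at h
      subst h
      simp_all [PMF.pure_map]
  | bind R K h₁ h₂ =>
    intro η h
    cases hv : R.value? with
    | some v =>
      rw [React.value?_eq_some hv] at h ⊢
      rw [React.stepIn_bind_val, Option.some.injEq] at h
      subst h
      simp only [React.assign, React.stepIn_bind_val, PMF.pure_map, React.inst, React.assign_subst]
    | none =>
      rw [React.stepIn_bind γ hv, Option.map_eq_some_iff] at h
      obtain ⟨η', h, rfl⟩ := h
      have hs := h₁ γ h
      have hv' : (R.assign a).value? = none := by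
        cases hw : (R.assign a).value? with
        | none => rfl
        | some w => rw [React.value?_eq_some hw] at hs; simp [React.stepIn] at hs
      simp only [React.assign]
      rw [React.stepIn_bind γ hv', hs]
      simp only [Option.map_some, PMF.map_comp]
      rfl

theorem React.stepIn_mapChan {Δ Δ' Γ : S.Ctx} {τ : S.Typ} (γ : ∀ τ, Mem Γ τ → M.Lit τ)
    (φ : Ren Δ Δ') (R : React S M.Lit Δ Γ τ) :
    (R.mapChan φ).stepIn γ = (R.stepIn γ).map fun η => η.map (React.mapChan φ) := by
  induction R with
  | ret e => simp [React.mapChan, React.stepIn, PMF.pure_map]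
  | samp d e => simp only [React.mapChan, React.stepIn, Option.map_some, PMF.map_comp]; rfl
  | ifte e R₁ R₂ h₁ h₂ =>
    simp only [React.mapChan, React.stepIn]
    split <;> simp [PMF.pure_map]
  | bind R K h₁ h₂ =>
    simp only [React.mapChan]
    cases hv : R.value? with
    | some v =>
      rw [React.value?_eq_some hv]
      simp only [React.mapChan, React.stepIn_bind_val, Option.map_some, PMF.pure_map, React.inst,
        React.mapChan_subst]
    | none =>
      rw [React.stepIn_bind γ hv, React.stepIn_bind γ (by rw [React.value?_mapChan, hv]), h₁]
      simp only [Option.map_map]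
      congr 1
      funext η
      simp only [Function.comp, PMF.map_comp]
      rfl
  | _ => rfl

theorem React.readsIn_stepIn {Δ Γ : S.Ctx} {τ : S.Typ} (γ : ∀ τ, Mem Γ τ → M.Lit τ)
    {I : Set (Chan Δ)} (R : React S M.Lit Δ Γ τ) : ∀ {η : PMF (React S M.Lit Δ Γ τ)},
    R.stepIn γ = some η → R.ReadsIn I → ∀ R' ∈ η.support, R'.ReadsIn I := by
  induction R with
  | val v => intro η h; simp [React.stepIn] at h
  | ret e =>
    intro η h
    simp only [React.stepIn, Option.some.injEq] at h
    subst h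
    simp [React.ReadsIn]
  | samp d e =>
    intro η h _ R' hR'
    simp only [React.stepIn, Option.some.injEq] at h
    subst h
    simp only [PMF.mem_support_map_iff] at hR'
    obtain ⟨v, _, rfl⟩ := hR'
    trivial
  | read c => intro η h; simp [React.stepIn] at h
  | ifte e R₁ R₂ h₁ h₂ =>
    intro η h hR
    simp only [React.stepIn] at h
    split at h <;>
    · simp only [Option.some.injEq] at h
      subst h
      simp [hR.1, hR.2]
  | bind R K h₁ h₂ =>
    intro η h hR
    cases hv : R.value? with
    | some v =>
      rw [React.value?_eq_some hv] at h
      rw [React.stepIn_bind_val, Option.some.injEq] at h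
      subst h
      simp only [PMF.support_pure, Set.mem_singleton_iff, forall_eq]
      exact (React.readsIn_subst _ _).2 hR.2
    | none =>
      rw [React.stepIn_bind γ hv, Option.map_eq_some_iff] at h
      obtain ⟨η', h, rfl⟩ := h
      intro R' hR'
      simp only [PMF.mem_support_map_iff] at hR'
      obtain ⟨R'', hR'', rfl⟩ := hR'
      exact ⟨h₁ γ h hR.1 _ hR'', hR.2⟩

/-- An internal step or an output step. -/
def Red {Δ : S.Ctx} (P : Proto S M.Lit Δ) (μ : PMF (Proto S M.Lit Δ)) : Prop :=
  Step P μ ∨ ∃ (σ : S.Typ) (o : Mem Δ σ) (v : M.Lit σ) (P' : Proto S M.Lit Δ),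
    OutStep P o v P' ∧ μ = PMF.pure P'

theorem Step.red {Δ : S.Ctx} {P : Proto S M.Lit Δ} {μ : PMF (Proto S M.Lit Δ)} (h : Step P μ) :
    Red P μ := .inl h

theorem OutStep.red {Δ : S.Ctx} {σ : S.Typ} {o : Mem Δ σ} {v : M.Lit σ} {P P' : Proto S M.Lit Δ}
    (h : OutStep P o v P') : Red P (PMF.pure P') := .inr ⟨_, _, _, _, h, rfl⟩

/-- No step is possible. -/
def Proto.Halted : ∀ {Δ : S.Ctx}, Proto S M.Lit Δ → Prop
  | _, .zero => True
  | _, .react _ R => R.value? = none ∧ R.step = none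
  | _, .done _ _ => True
  | _, .par P Q => P.Halted ∧ Q.Halted
  | _, .new _ P => P.Halted

theorem Red.react_iff {Δ : S.Ctx} {τ : S.Typ} {o : Mem Δ τ} {R : React S M.Lit Δ [] τ}
    {μ : PMF (Proto S M.Lit Δ)} : Red (.react o R) μ ↔
      (∃ η, R.step = some η ∧ μ = η.map (.react o)) ∨
      ∃ v, R = .val v ∧ μ = PMF.pure (.done o v) := by
  constructor
  · rintro (h | ⟨σ, o', v, P', h, rfl⟩)
    · cases h with
      | react o h => exact .inl ⟨_, h, rfl⟩
    · cases h with
      | react o v => exact .inr ⟨v, rfl, rfl⟩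
  · rintro (⟨η, h, rfl⟩ | ⟨v, rfl, rfl⟩)
    · exact (Step.react o h).red
    · exact (OutStep.react o v).red

/-- An output on the bound channel becomes an internal step and every other output remains an
output. Once the two kinds of steps are merged, the binder is transparent. -/
theorem Red.new_iff {Δ : S.Ctx} {τ : S.Typ} {P : Proto S M.Lit (τ :: Δ)}
    {μ : PMF (Proto S M.Lit Δ)} : Red (.new τ P) μ ↔ ∃ ν, Red P ν ∧ μ = ν.map (.new τ) := by
  constructor
  · rintro (h | ⟨σ, o', v, P', h, rfl⟩)
    · cases h with
      | new h => exact ⟨_, h.red, rfl⟩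
      | newOut h => exact ⟨_, h.red, by rw [PMF.pure_map]⟩
    · cases h with
      | new h => exact ⟨_, h.red, by rw [PMF.pure_map]⟩
  · rintro ⟨ν, (h | ⟨σ, o, v, P', h, rfl⟩), rfl⟩
    · exact h.new.red
    · rw [PMF.pure_map]
      cases o with
      | zero => exact (Step.newOut h).red
      | succ o => exact h.new.red

theorem Red.par_iff {Δ : S.Ctx} {P Q : Proto S M.Lit Δ} {μ : PMF (Proto S M.Lit Δ)} :
    Red (.par P Q) μ ↔
      (∃ ν, Step P ν ∧ μ = ν.map fun P' => .par P' Q) ∨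
      (∃ ν, Step Q ν ∧ μ = ν.map fun Q' => .par P Q') ∨
      (∃ (σ : S.Typ) (o : Mem Δ σ) (v : M.Lit σ) (P' : Proto S M.Lit Δ), OutStep P o v P' ∧
        μ = PMF.pure (.par P' (Q.input o v))) ∨
      ∃ (σ : S.Typ) (o : Mem Δ σ) (v : M.Lit σ) (Q' : Proto S M.Lit Δ), OutStep Q o v Q' ∧
        μ = PMF.pure (.par (P.input o v) Q') := by
  constructor
  · rintro (h | ⟨σ, o', v, P', h, rfl⟩)
    · cases h with
      | parLeft _ h => exact .inl ⟨_, h, rfl⟩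
      | parRight _ h => exact .inr (.inl ⟨_, h, rfl⟩)
    · cases h with
      | parLeft _ h => exact .inr (.inr (.inl ⟨_, _, _, _, h, rfl⟩))
      | parRight _ h => exact .inr (.inr (.inr ⟨_, _, _, _, h, rfl⟩))
  · rintro (⟨ν, h, rfl⟩ | ⟨ν, h, rfl⟩ | ⟨σ, o, v, P', h, rfl⟩ | ⟨σ, o, v, P', h, rfl⟩)
    · exact (h.parLeft Q).red
    · exact (h.parRight P).red
    · exact (h.parLeft Q).red
    · exact (h.parRight P).red

theorem Proto.Halted.not_red {Δ : S.Ctx} {P : Proto S M.Lit Δ} (h : P.Halted) :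
    ∀ μ, ¬ Red P μ := by
  induction P with
  | zero => rintro μ (h | ⟨_, _, _, _, h, -⟩) <;> cases h
  | react o R =>
    intro μ hμ
    rcases Red.react_iff.1 hμ with ⟨η, h', rfl⟩ | ⟨v, rfl, rfl⟩
    · rw [h.2] at h'; cases h'
    · cases h.1
  | done o v => rintro μ (h | ⟨_, _, _, _, h, -⟩) <;> cases h
  | par P Q h₁ h₂ =>
    intro μ hμ
    rcases Red.par_iff.1 hμ with ⟨ν, h', -⟩ | ⟨ν, h', -⟩ | ⟨_, _, _, _, h', -⟩ | ⟨_, _, _, _, h', -⟩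
    · exact h₁ h.1 _ h'.red
    · exact h₂ h.2 _ h'.red
    · exact h₁ h.1 _ h'.red
    · exact h₂ h.2 _ h'.red
  | new τ P ih =>
    intro μ hμ
    obtain ⟨ν, h', -⟩ := Red.new_iff.1 hμ
    exact ih h _ h'

theorem Proto.exists_red {Δ : S.Ctx} {P : Proto S M.Lit Δ} (h : ¬ P.Halted) : ∃ μ, Red P μ := by
  induction P with
  | zero => exact absurd trivial h
  | done o v => exact absurd trivial h
  | react o R =>
    cases hv : R.value? with
    | some v =>
      rw [React.value?_eq_some hv]
      exact ⟨_, (OutStep.react o v).red⟩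
    | none =>
      cases hs : R.step with
      | none => exact absurd ⟨hv, hs⟩ h
      | some η => exact ⟨_, (Step.react o hs).red⟩
  | par P Q h₁ h₂ =>
    by_cases hP : P.Halted
    · obtain ⟨μ, hμ | ⟨_, _, _, _, hμ, -⟩⟩ := h₂ fun hQ => h ⟨hP, hQ⟩
      · exact ⟨_, (hμ.parRight P).red⟩
      · exact ⟨_, (hμ.parRight P).red⟩
    · obtain ⟨μ, hμ | ⟨_, _, _, _, hμ, -⟩⟩ := h₁ hP
      · exact ⟨_, (hμ.parLeft Q).red⟩
      · exact ⟨_, (hμ.parLeft Q).red⟩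
  | new τ P ih =>
    obtain ⟨μ, hμ⟩ := ih h
    exact ⟨_, Red.new_iff.2 ⟨_, hμ, rfl⟩⟩

theorem Red.size {Δ : S.Ctx} {P : Proto S M.Lit Δ} {μ : PMF (Proto S M.Lit Δ)} (h : Red P μ) :
    ∀ Q ∈ μ.support, Q.size < P.size := by
  rcases h with h | ⟨_, _, _, _, h, rfl⟩
  · exact h.size
  · simpa using h.size

/-! ### Reduction and typing -/

theorem OutStep.mem {Δ : S.Ctx} {σ : S.Typ} {o : Mem Δ σ} {v : M.Lit σ} {P P' : Proto S M.Lit Δ}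
    (h : OutStep P o v P') : ∀ {I O : Set (Chan Δ)}, P.Typed I O → o.chan ∈ O := by
  induction h with
  | react o v => intro I O hP; rw [hP.react_inv.1]; rfl
  | parLeft Q h ih =>
    intro I O hP
    obtain ⟨O₁, O₂, rfl, h₁, h₂⟩ := hP.par_inv
    exact .inl (ih h₁)
  | parRight Q h ih =>
    intro I O hP
    obtain ⟨O₁, O₂, rfl, h₁, h₂⟩ := hP.par_inv
    exact .inr (ih h₂)
  | new h ih =>
    intro I O hP
    rcases ih hP.new_inv with h | h
    · exact succ_mem_shift.1 h
    · exact absurd h succ_chan_ne_zero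

theorem OutStep.typed {Δ : S.Ctx} {σ : S.Typ} {o : Mem Δ σ} {v : M.Lit σ} {P P' : Proto S M.Lit Δ}
    (h : OutStep P o v P') : ∀ {I O : Set (Chan Δ)}, P.Typed I O → P'.Typed I O := by
  induction h with
  | react o v =>
    intro I O hP
    obtain ⟨rfl, ho, -⟩ := hP.react_inv
    exact .done ho
  | parLeft Q h ih =>
    intro I O hP
    obtain ⟨O₁, O₂, rfl, h₁, h₂⟩ := hP.par_inv
    exact .par (ih h₁) (h₂.assign' _)
  | parRight Q h ih =>
    intro I O hP
    obtain ⟨O₁, O₂, rfl, h₁, h₂⟩ := hP.par_inv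
    exact .par (h₁.assign' _) (ih h₂)
  | new h ih =>
    intro I O hP
    exact .new (ih hP.new_inv)

theorem Step.typed {Δ : S.Ctx} {P : Proto S M.Lit Δ} {μ : PMF (Proto S M.Lit Δ)}
    (h : Step P μ) : ∀ {I O : Set (Chan Δ)}, P.Typed I O → ∀ Q ∈ μ.support, Q.Typed I O := by
  induction h with
  | react o h =>
    intro I O hP Q hQ
    simp only [PMF.mem_support_map_iff] at hQ
    obtain ⟨R', hR', rfl⟩ := hQ
    obtain ⟨rfl, ho, hR⟩ := hP.react_inv
    exact .react ho (React.readsIn_stepIn _ _ h hR _ hR')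
  | parLeft Q h ih =>
    intro I O hP X hX
    simp only [PMF.mem_support_map_iff] at hX
    obtain ⟨P', hP', rfl⟩ := hX
    obtain ⟨O₁, O₂, rfl, h₁, h₂⟩ := hP.par_inv
    exact .par (ih h₁ _ hP') h₂
  | parRight Q h ih =>
    intro I O hP X hX
    simp only [PMF.mem_support_map_iff] at hX
    obtain ⟨P', hP', rfl⟩ := hX
    obtain ⟨O₁, O₂, rfl, h₁, h₂⟩ := hP.par_inv
    exact .par h₁ (ih h₂ _ hP')
  | new h ih =>
    intro I O hP X hX
    simp only [PMF.mem_support_map_iff] at hX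
    obtain ⟨P', hP', rfl⟩ := hX
    exact .new (ih hP.new_inv _ hP')
  | newOut h =>
    intro I O hP X hX
    simp only [PMF.support_pure, Set.mem_singleton_iff] at hX
    subst hX
    exact .new (h.typed hP.new_inv)

theorem Red.typed {Δ : S.Ctx} {P : Proto S M.Lit Δ} {μ : PMF (Proto S M.Lit Δ)}
    (h : Red P μ) {I O : Set (Chan Δ)} (hP : P.Typed I O) : ∀ Q ∈ μ.support, Q.Typed I O := by
  rcases h with h | ⟨_, _, _, _, h, rfl⟩
  · exact h.typed hP
  · simpa using h.typed hP

theorem OutStep.vals {Δ : S.Ctx} {σ : S.Typ} {o : Mem Δ σ} {v : M.Lit σ} {P P' : Proto S M.Lit Δ}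
    (h : OutStep P o v P') : ∀ {I O : Set (Chan Δ)}, P.Typed I O →
    P'.vals = P.vals.or (Asg.single o v) := by
  induction h with
  | react o v => intro I O hP; rfl
  | @parLeft _ σ o v P P' Q h ih =>
    intro I O hP
    obtain ⟨O₁, O₂, rfl, h₁, h₂⟩ := hP.par_inv
    rw [Proto.vals_par, Proto.vals_par, Proto.vals_assign, ih h₁, Asg.or_assoc, Asg.or_assoc]
    congr 1
    -- The left bias of `Asg.or` is harmless: `o` is an output of `P`, so by typing `Q` carries no
    -- value there.
    refine Asg.or_comm fun τ c => ?_
    by_cases hc : o.chan = c.chan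
    · cases hc
      exact .inr (h₂.vals_eq_none fun h' => h₂.disjoint _ h' (.inr (h.mem h₁)))
    · exact .inl (Asg.single_ne hc)
  | @parRight _ σ o v P P' Q h ih =>
    intro I O hP
    obtain ⟨O₁, O₂, rfl, h₁, h₂⟩ := hP.par_inv
    rw [Proto.vals_par, Proto.vals_par, Proto.vals_assign, ih h₂, Asg.or_assoc]
  | new h ih =>
    intro I O hP
    rw [Proto.vals_new, ih hP.new_inv]
    rfl

theorem Step.vals {Δ : S.Ctx} {P : Proto S M.Lit Δ} {μ : PMF (Proto S M.Lit Δ)}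
    (h : Step P μ) : ∀ {I O : Set (Chan Δ)}, P.Typed I O → ∀ Q ∈ μ.support, Q.vals = P.vals := by
  induction h with
  | react o h =>
    intro I O hP Q hQ
    simp only [PMF.mem_support_map_iff] at hQ
    obtain ⟨R', hR', rfl⟩ := hQ
    rfl
  | parLeft Q h ih =>
    intro I O hP X hX
    simp only [PMF.mem_support_map_iff] at hX
    obtain ⟨P', hP', rfl⟩ := hX
    obtain ⟨O₁, O₂, rfl, h₁, h₂⟩ := hP.par_inv
    rw [Proto.vals_par, Proto.vals_par, ih h₁ _ hP']
  | parRight Q h ih =>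
    intro I O hP X hX
    simp only [PMF.mem_support_map_iff] at hX
    obtain ⟨P', hP', rfl⟩ := hX
    obtain ⟨O₁, O₂, rfl, h₁, h₂⟩ := hP.par_inv
    rw [Proto.vals_par, Proto.vals_par, ih h₂ _ hP']
  | new h ih =>
    intro I O hP X hX
    simp only [PMF.mem_support_map_iff] at hX
    obtain ⟨P', hP', rfl⟩ := hX
    rw [Proto.vals_new, Proto.vals_new, ih hP.new_inv _ hP']
  | newOut h =>
    intro I O hP X hX
    simp only [PMF.support_pure, Set.mem_singleton_iff] at hX
    subst hX
    rw [Proto.vals_new, Proto.vals_new, h.vals hP.new_inv]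
    -- The new value sits on the bound channel, which is not seen through `succ`.
    funext σ c
    simp [Asg.single]

/-! ### Reduction under assignments and renamings -/

theorem Proto.assign_comm {Δ : S.Ctx} (P : Proto S M.Lit Δ) {σ : S.Typ} {o : Mem Δ σ} {v : M.Lit σ}
    {a : Asg M.Lit Δ} (ha : a σ o = none) : (P.input o v).assign a = (P.assign a).input o v := by
  rw [Proto.assign_or, Proto.input, Proto.assign_or, Asg.or_comm]
  intro τ c
  by_cases hc : o.chan = c.chan
  · cases hc; exact .inr ha
  · exact .inl (Asg.single_ne hc)

/-- If `a` had a value for `o`, the readers of `o` would take it instead of `v`; without one, the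
two substitutions commute. -/
theorem OutStep.assign {Δ : S.Ctx} {σ : S.Typ} {o : Mem Δ σ} {v : M.Lit σ} {P P' : Proto S M.Lit Δ}
    (h : OutStep P o v P') : ∀ {a : Asg M.Lit Δ}, a σ o = none →
    OutStep (P.assign a) o v (P'.assign a) := by
  induction h with
  | react o v => intro a ha; exact .react o v
  | parLeft Q h ih =>
    intro a ha
    rw [Proto.assign, Proto.assign, Proto.assign_comm _ ha]
    exact (ih ha).parLeft _
  | parRight Q h ih =>
    intro a ha
    rw [Proto.assign, Proto.assign, Proto.assign_comm _ ha]
    exact (ih ha).parRight _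
  | new h ih =>
    intro a ha
    exact .new (ih ha)

theorem Step.assign {Δ : S.Ctx} {P : Proto S M.Lit Δ} {μ : PMF (Proto S M.Lit Δ)}
    (h : Step P μ) : ∀ (a : Asg M.Lit Δ), Step (P.assign a) (μ.map (Proto.assign a)) := by
  induction h with
  | react o h =>
    intro a
    have := Step.react o (React.stepIn_assign _ a _ h)
    rw [PMF.map_comp] at this ⊢
    exact this
  | parLeft Q h ih =>
    intro a
    have := (ih a).parLeft (Q.assign a)
    rw [PMF.map_comp] at this ⊢
    exact this
  | parRight Q h ih =>
    intro a
    have := (ih a).parRight (Q.assign a)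
    rw [PMF.map_comp] at this ⊢
    exact this
  | new h ih =>
    intro a
    have := (ih a.lift).new
    rw [PMF.map_comp] at this ⊢
    exact this
  | newOut h =>
    intro a
    rw [PMF.pure_map]
    -- `a.lift` gives no value to the bound channel by definition, which is why internal steps need
    -- no side condition on `a`.
    exact .newOut (h.assign (a := a.lift) rfl)

theorem OutStep.mapChan {Δ : S.Ctx} {σ : S.Typ} {o : Mem Δ σ} {v : M.Lit σ}
    {P P' : Proto S M.Lit Δ} (h : OutStep P o v P') : ∀ {Δ' : S.Ctx} {φ : Ren Δ Δ'}
    (_ : ∀ a, Function.Injective (φ a)), OutStep (P.mapChan φ) (φ σ o) v (P'.mapChan φ) := by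
  induction h with
  | react o v => intro Δ' φ hφ; exact .react _ v
  | parLeft Q h ih =>
    intro Δ' φ hφ
    rw [Proto.mapChan, Proto.mapChan, ← Proto.mapChan_input hφ]
    exact (ih hφ).parLeft _
  | parRight Q h ih =>
    intro Δ' φ hφ
    rw [Proto.mapChan, Proto.mapChan, ← Proto.mapChan_input hφ]
    exact (ih hφ).parRight _
  | new h ih =>
    intro Δ' φ hφ
    exact .new (ih (Ren.lift_injective hφ))

theorem Step.mapChan {Δ : S.Ctx} {P : Proto S M.Lit Δ} {μ : PMF (Proto S M.Lit Δ)}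
    (h : Step P μ) : ∀ {Δ' : S.Ctx} {φ : Ren Δ Δ'} (_ : ∀ a, Function.Injective (φ a)),
    Step (P.mapChan φ) (μ.map (Proto.mapChan φ)) := by
  induction h with
  | @react _ _ o R η h =>
    intro Δ' φ hφ
    have := Step.react (φ _ o) (R := R.mapChan φ) (η := η.map (React.mapChan φ)) (by
      rw [React.step, React.stepIn_mapChan]
      rw [React.step] at h
      rw [h]
      rfl)
    rw [PMF.map_comp] at this ⊢
    exact this
  | parLeft Q h ih =>
    intro Δ' φ hφ
    have := (ih hφ).parLeft (Q.mapChan φ)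
    rw [PMF.map_comp] at this ⊢
    exact this
  | parRight Q h ih =>
    intro Δ' φ hφ
    have := (ih hφ).parRight (Q.mapChan φ)
    rw [PMF.map_comp] at this ⊢
    exact this
  | new h ih =>
    intro Δ' φ hφ
    have := (ih (Ren.lift_injective hφ)).new
    rw [PMF.map_comp] at this ⊢
    exact this
  | newOut h =>
    intro Δ' φ hφ
    rw [PMF.pure_map]
    exact .newOut (h.mapChan (Ren.lift_injective hφ))

theorem Red.mapChan {Δ Δ' : S.Ctx} {P : Proto S M.Lit Δ} {μ : PMF (Proto S M.Lit Δ)}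
    (h : Red P μ) {φ : Ren Δ Δ'} (hφ : ∀ a, Function.Injective (φ a)) :
    Red (P.mapChan φ) (μ.map (Proto.mapChan φ)) := by
  rcases h with h | ⟨_, _, _, _, h, rfl⟩
  · exact (h.mapChan hφ).red
  · rw [PMF.pure_map]
    exact (h.mapChan hφ).red

theorem Proto.halted_mapChan {Δ : S.Ctx} {P : Proto S M.Lit Δ} : ∀ {Δ' : S.Ctx} {φ : Ren Δ Δ'},
    (P.mapChan φ).Halted ↔ P.Halted := by
  induction P with
  | react o R =>
    intro Δ' φ
    simp [Proto.mapChan, Proto.Halted, React.value?_mapChan, React.step, React.stepIn_mapChan]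
  | par P Q h₁ h₂ => intro Δ' φ; simp [Proto.mapChan, Proto.Halted, h₁, h₂]
  | new τ P h => intro Δ' φ; simp [Proto.mapChan, Proto.Halted, h]
  | _ => intros; rfl

/-! ### Confluence -/

/-- Typing gives every channel a single writer. -/
theorem OutStep.unique {Δ : S.Ctx} {σ : S.Typ} {o : Mem Δ σ} {v : M.Lit σ} {P P' : Proto S M.Lit Δ}
    (h : OutStep P o v P') : ∀ {I O : Set (Chan Δ)}, P.Typed I O → ∀ {v' : M.Lit σ}
    {P'' : Proto S M.Lit Δ}, OutStep P o v' P'' → v' = v ∧ P'' = P' := by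
  induction h with
  | react o v =>
    intro I O hP v' P'' h'
    cases h'
    exact ⟨rfl, rfl⟩
  | parLeft Q h ih =>
    intro I O hP v' P'' h'
    obtain ⟨O₁, O₂, rfl, h₁, h₂⟩ := hP.par_inv
    cases h' with
    | parLeft _ h' => obtain ⟨rfl, rfl⟩ := ih h₁ h'; exact ⟨rfl, rfl⟩
    | parRight _ h' => exact absurd (.inr (h'.mem h₂)) (h₁.disjoint _ (h.mem h₁))
  | parRight Q h ih =>
    intro I O hP v' P'' h'
    obtain ⟨O₁, O₂, rfl, h₁, h₂⟩ := hP.par_inv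
    cases h' with
    | parLeft _ h' => exact absurd (.inr (h'.mem h₁)) (h₂.disjoint _ (h.mem h₂))
    | parRight _ h' => obtain ⟨rfl, rfl⟩ := ih h₂ h'; exact ⟨rfl, rfl⟩
  | new h ih =>
    intro I O hP v' P'' h'
    cases h' with
    | new h' => obtain ⟨rfl, rfl⟩ := ih hP.new_inv h'; exact ⟨rfl, rfl⟩

theorem Proto.input_comm {Δ : S.Ctx} (P : Proto S M.Lit Δ) {σ σ' : S.Typ} {o : Mem Δ σ}
    {v : M.Lit σ} {o' : Mem Δ σ'} {v' : M.Lit σ'} (h : o.chan ≠ o'.chan) :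
    (P.input o v).input o' v' = (P.input o' v').input o v :=
  P.assign_comm (Asg.single_ne h.symm)

/-- Outputs on different channels commute. -/
theorem OutStep.diamond {Δ : S.Ctx} {σ : S.Typ} {o : Mem Δ σ} {v : M.Lit σ}
    {P P₁ : Proto S M.Lit Δ} (h : OutStep P o v P₁) : ∀ {σ' : S.Typ} {o' : Mem Δ σ'} {v' : M.Lit σ'}
    {P₂ : Proto S M.Lit Δ}, OutStep P o' v' P₂ → o.chan ≠ o'.chan →
    ∃ P₃, OutStep P₁ o' v' P₃ ∧ OutStep P₂ o v P₃ := by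
  induction h with
  | react o v => intro σ' o' v' P₂ h' hne; cases h'; exact absurd rfl hne
  | @parLeft _ σ o v P P' Q h ih =>
    intro σ' o' v' P₂ h' hne
    cases h' with
    | parLeft _ h' =>
      obtain ⟨P₃, h₁, h₂⟩ := ih h' hne
      refine ⟨_, h₁.parLeft _, ?_⟩
      rw [Proto.input_comm _ hne]
      exact h₂.parLeft _
    | parRight _ h' =>
      exact ⟨_, (h'.assign (Asg.single_ne hne)).parRight _,
        (h.assign (Asg.single_ne hne.symm)).parLeft _⟩
  | @parRight _ σ o v P P' Q h ih =>
    intro σ' o' v' P₂ h' hne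
    cases h' with
    | parLeft _ h' =>
      exact ⟨_, (h'.assign (Asg.single_ne hne)).parLeft _,
        (h.assign (Asg.single_ne hne.symm)).parRight _⟩
    | parRight _ h' =>
      obtain ⟨P₃, h₁, h₂⟩ := ih h' hne
      refine ⟨_, h₁.parRight _, ?_⟩
      rw [Proto.input_comm _ hne]
      exact h₂.parRight _
  | new h ih =>
    intro σ' o' v' P₂ h' hne
    cases h' with
    | new h' =>
      obtain ⟨P₃, h₁, h₂⟩ := ih h' (fun h => hne (succ_chan_inj.1 h))
      exact ⟨_, .new h₁, .new h₂⟩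

/-- Outputs commute with internal steps. -/
theorem OutStep.diamond_step {Δ : S.Ctx} {σ : S.Typ} {o : Mem Δ σ} {v : M.Lit σ}
    {P P₁ : Proto S M.Lit Δ} (h : OutStep P o v P₁) : ∀ {I O : Set (Chan Δ)}, P.Typed I O →
    ∀ {μ : PMF (Proto S M.Lit Δ)}, Step P μ →
    ∃ g : Proto S M.Lit Δ → Proto S M.Lit Δ, Step P₁ (μ.map g) ∧
      ∀ Q ∈ μ.support, OutStep Q o v (g Q) := by
  induction h with
  | react o v =>
    intro I O hP μ h'
    cases h' with
    | react _ h' => cases h'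
  | @parLeft _ σ o v P P' Q h ih =>
    intro I O hP μ h'
    obtain ⟨O₁, O₂, rfl, h₁, h₂⟩ := hP.par_inv
    cases h' with
    | @parLeft _ _ η _ h' =>
      obtain ⟨g, hg, hg'⟩ := ih h₁ h'
      have hinj : Function.Injective fun A : Proto S M.Lit _ => A.par Q := by
        intro A B hAB; cases hAB; rfl
      -- The outcomes of the step have the form `A.par Q`, but the matching function must be defined
      -- on all protocols. It is extended along the injection `A ↦ A.par Q`; its values off the
      -- range are irrelevant.
      refine ⟨Function.extend (fun A => A.par Q) (fun A => (g A).par (Q.input o v)) id, ?_, ?_⟩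
      · have := hg.parLeft (Q.input o v)
        rw [PMF.map_comp] at this ⊢
        convert this using 2
        funext A
        exact hinj.extend_apply _ _ A
      · intro X hX
        simp only [PMF.mem_support_map_iff] at hX
        obtain ⟨A, hA, rfl⟩ := hX
        rw [hinj.extend_apply]
        exact (hg' A hA).parLeft Q
    | @parRight _ _ η _ h' =>
      have hinj : Function.Injective fun A : Proto S M.Lit _ => P.par A := by
        intro A B hAB; cases hAB; rfl
      refine ⟨Function.extend (fun A => P.par A) (fun A => P'.par (A.input o v)) id, ?_, ?_⟩
      · have := (h'.assign (Asg.single o v)).parRight P'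
        rw [PMF.map_comp] at this ⊢
        convert this using 2
        funext A
        exact hinj.extend_apply _ _ A
      · intro X hX
        simp only [PMF.mem_support_map_iff] at hX
        obtain ⟨A, hA, rfl⟩ := hX
        rw [hinj.extend_apply]
        exact h.parLeft A
  | @parRight _ σ o v Q Q' P h ih =>
    intro I O hP μ h'
    obtain ⟨O₁, O₂, rfl, h₁, h₂⟩ := hP.par_inv
    cases h' with
    | @parLeft _ _ η _ h' =>
      have hinj : Function.Injective fun A : Proto S M.Lit _ => A.par Q := by
        intro A B hAB; cases hAB; rfl
      refine ⟨Function.extend (fun A => A.par Q) (fun A => (Proto.input A o v).par Q') id, ?_, ?_⟩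
      · have := (h'.assign (Asg.single o v)).parLeft Q'
        rw [PMF.map_comp] at this ⊢
        convert this using 2
        funext A
        exact hinj.extend_apply _ _ A
      · intro X hX
        simp only [PMF.mem_support_map_iff] at hX
        obtain ⟨A, hA, rfl⟩ := hX
        rw [hinj.extend_apply]
        exact h.parRight A
    | @parRight _ _ η _ h' =>
      obtain ⟨g, hg, hg'⟩ := ih h₂ h'
      have hinj : Function.Injective fun A : Proto S M.Lit _ => P.par A := by
        intro A B hAB; cases hAB; rfl
      refine ⟨Function.extend (fun A => P.par A) (fun A => (P.input o v).par (g A)) id, ?_, ?_⟩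
      · have := hg.parRight (P.input o v)
        rw [PMF.map_comp] at this ⊢
        convert this using 2
        funext A
        exact hinj.extend_apply _ _ A
      · intro X hX
        simp only [PMF.mem_support_map_iff] at hX
        obtain ⟨A, hA, rfl⟩ := hX
        rw [hinj.extend_apply]
        exact (hg' A hA).parRight P
  | @new Δ₀ σ τ o v P P' h ih =>
    intro I O hP μ h'
    have hinj : Function.Injective fun A : Proto S M.Lit (τ :: Δ₀) => A.new τ := by
      intro A B hAB; cases hAB; rfl
    cases h' with
    | new h' =>
      obtain ⟨g, hg, hg'⟩ := ih hP.new_inv h'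
      refine ⟨Function.extend (fun A => A.new τ) (fun A => (g A).new τ) id, ?_, ?_⟩
      · have := hg.new
        rw [PMF.map_comp] at this ⊢
        convert this using 2
        funext A
        exact hinj.extend_apply _ _ A
      · intro X hX
        simp only [PMF.mem_support_map_iff] at hX
        obtain ⟨A, hA, rfl⟩ := hX
        rw [hinj.extend_apply]
        exact (hg' A hA).new
    | newOut h' =>
      obtain ⟨P₃, h₁, h₂⟩ := h.diamond h' succ_chan_ne_zero
      -- The internal step is a hidden output and has a single outcome, so a constant function will
      -- do.
      refine ⟨fun _ => .new τ P₃, ?_, ?_⟩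
      · rw [PMF.pure_map]
        exact .newOut h₁
      · simpa using h₂.new

theorem PMF_bind_congr {X Y : Type} {μ : PMF X} {f g : X → PMF Y} (h : ∀ x ∈ μ.support, f x = g x) :
    μ.bind f = μ.bind g := by
  ext y
  rw [PMF.bind_apply, PMF.bind_apply]
  refine tsum_congr fun x => ?_
  by_cases hx : x ∈ μ.support
  · rw [h x hx]
  · rw [(PMF.apply_eq_zero_iff _ _).2 hx, zero_mul, zero_mul]

/-- The peak of a hidden output against an internal step of the body. The step still applies after
the output, and the output applies to each outcome of the step; both ways end in the same
distribution, and `ev` does not notice these additional steps. -/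
theorem OutStep.step_bind {Δ : S.Ctx} {τ : S.Typ} {P P₁ : Proto S M.Lit (τ :: Δ)}
    {v : M.Lit τ} (h : OutStep P Mem.zero v P₁) {I O : Set (Chan (τ :: Δ))} (hP : P.Typed I O)
    {μ : PMF (Proto S M.Lit (τ :: Δ))} (hμ : Step P μ) {X : Type} (ev : Proto S M.Lit Δ → PMF X)
    (h₁ : ∀ ν, Step (.new τ P₁) ν → ev (.new τ P₁) = ν.bind ev)
    (h₂ : ∀ Q ∈ (μ.map (.new τ)).support, ∀ ν, Step Q ν → ev Q = ν.bind ev) :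
    ev (.new τ P₁) = (μ.map (.new τ)).bind ev := by
  obtain ⟨g, hg, hg'⟩ := h.diamond_step hP hμ
  rw [h₁ _ hg.new, PMF.bind_map, PMF.bind_map, PMF.bind_map]
  refine PMF_bind_congr fun Q hQ => ?_
  have := h₂ (.new τ Q) ((PMF.mem_support_map_iff _ _ _).2 ⟨Q, hQ, rfl⟩) _ (Step.newOut (hg' Q hQ))
  rw [PMF.pure_bind] at this
  exact this.symm

/-- Local confluence, expressed by a function `ev` that is invariant under the steps of the
successors. This avoids reductions of distributions: a common reduct enters only through equations
for `ev`. Steps of different components commute because independent draws do (`PMF.bind_comm`). -/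
theorem Step.diamond {Δ : S.Ctx} {P : Proto S M.Lit Δ} {μ₁ : PMF (Proto S M.Lit Δ)}
    (h : Step P μ₁) : ∀ {I O : Set (Chan Δ)}, P.Typed I O → ∀ {μ₂ : PMF (Proto S M.Lit Δ)},
    Step P μ₂ → ∀ {X : Type} (ev : Proto S M.Lit Δ → PMF X),
    (∀ Q, Q ∈ μ₁.support ∨ Q ∈ μ₂.support → ∀ ν, Step Q ν → ev Q = ν.bind ev) →
    μ₁.bind ev = μ₂.bind ev := by
  induction h with
  | react o h =>
    intro I O hP μ₂ h₂ X ev hev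
    cases h₂ with
    | react _ h₂ => rw [h] at h₂; cases h₂; rfl
  | @parLeft _ P μ Q h ih =>
    intro I O hP μ₂ h₂ X ev hev
    obtain ⟨O₁, O₂, rfl, hP₁, hP₂⟩ := hP.par_inv
    cases h₂ with
    | @parLeft _ _ η _ h₂ =>
      rw [PMF.bind_map, PMF.bind_map]
      refine ih hP₁ h₂ _ fun A hA ν hν => ?_
      have := hev (A.par Q) (hA.imp (fun h => (PMF.mem_support_map_iff _ _ _).2 ⟨A, h, rfl⟩)
        fun h => (PMF.mem_support_map_iff _ _ _).2 ⟨A, h, rfl⟩) _ (hν.parLeft Q)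
      rw [PMF.bind_map] at this
      exact this
    | @parRight _ _ η _ h₂ =>
      rw [PMF.bind_map, PMF.bind_map]
      -- The common value, with both components having made their step.
      trans μ.bind fun A => η.bind fun B => ev (A.par B)
      · refine PMF_bind_congr fun A hA => ?_
        have := hev (A.par Q) (.inl ((PMF.mem_support_map_iff _ _ _).2 ⟨A, hA, rfl⟩)) _
          (h₂.parRight A)
        rw [PMF.bind_map] at this
        exact this
      · rw [PMF.bind_comm]
        refine PMF_bind_congr fun B hB => ?_
        have := hev (P.par B) (.inr ((PMF.mem_support_map_iff _ _ _).2 ⟨B, hB, rfl⟩)) _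
          (h.parLeft B)
        rw [PMF.bind_map] at this
        exact this.symm
  | @parRight _ Q μ P h ih =>
    intro I O hP μ₂ h₂ X ev hev
    obtain ⟨O₁, O₂, rfl, hP₁, hP₂⟩ := hP.par_inv
    cases h₂ with
    | @parLeft _ _ η _ h₂ =>
      rw [PMF.bind_map, PMF.bind_map]
      trans μ.bind fun B => η.bind fun A => ev (A.par B)
      · refine PMF_bind_congr fun B hB => ?_
        have := hev (P.par B) (.inl ((PMF.mem_support_map_iff _ _ _).2 ⟨B, hB, rfl⟩)) _
          (h₂.parLeft B)
        rw [PMF.bind_map] at this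
        exact this
      · rw [PMF.bind_comm]
        refine PMF_bind_congr fun A hA => ?_
        have := hev (A.par Q) (.inr ((PMF.mem_support_map_iff _ _ _).2 ⟨A, hA, rfl⟩)) _
          (h.parRight A)
        rw [PMF.bind_map] at this
        exact this.symm
    | @parRight _ _ η _ h₂ =>
      rw [PMF.bind_map, PMF.bind_map]
      refine ih hP₂ h₂ _ fun A hA ν hν => ?_
      have := hev (P.par A) (hA.imp (fun h => (PMF.mem_support_map_iff _ _ _).2 ⟨A, h, rfl⟩)
        fun h => (PMF.mem_support_map_iff _ _ _).2 ⟨A, h, rfl⟩) _ (hν.parRight P)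
      rw [PMF.bind_map] at this
      exact this
  | @new _ τ P μ h ih =>
    intro I O hP μ₂ h₂ X ev hev
    cases h₂ with
    | new h₂ =>
      rw [PMF.bind_map, PMF.bind_map]
      refine ih hP.new_inv h₂ _ fun A hA ν hν => ?_
      have := hev (A.new τ) (hA.imp (fun h => (PMF.mem_support_map_iff _ _ _).2 ⟨A, h, rfl⟩)
        fun h => (PMF.mem_support_map_iff _ _ _).2 ⟨A, h, rfl⟩) _ hν.new
      rw [PMF.bind_map] at this
      exact this
    | newOut h₂ =>
      rw [PMF.pure_bind]
      exact (h₂.step_bind hP.new_inv h ev (hev _ (.inr (by simp))) fun Q hQ => hev Q (.inl hQ)).symm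
  | @newOut _ τ P P' v h =>
    intro I O hP μ₂ h₂ X ev hev
    cases h₂ with
    | new h₂ =>
      rw [PMF.pure_bind]
      exact h.step_bind hP.new_inv h₂ ev (hev _ (.inl (by simp))) fun Q hQ => hev Q (.inr hQ)
    | newOut h₂ =>
      obtain ⟨rfl, rfl⟩ := h.unique hP.new_inv h₂
      rfl

/-- Output steps are added to `Step.diamond`: two outputs either coincide or commute, and an output
commutes with every internal step. -/
theorem Red.diamond {Δ : S.Ctx} {P : Proto S M.Lit Δ} {I O : Set (Chan Δ)} (hP : P.Typed I O)
    {μ₁ μ₂ : PMF (Proto S M.Lit Δ)} (h₁ : Red P μ₁) (h₂ : Red P μ₂) {X : Type}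
    (ev : Proto S M.Lit Δ → PMF X)
    (hev : ∀ Q, Q ∈ μ₁.support ∨ Q ∈ μ₂.support → ∀ ν, Red Q ν → ev Q = ν.bind ev) :
    μ₁.bind ev = μ₂.bind ev := by
  have key : ∀ {σ : S.Typ} {o : Mem Δ σ} {v : M.Lit σ} {P' : Proto S M.Lit Δ}
      {μ : PMF (Proto S M.Lit Δ)}, OutStep P o v P' → Step P μ →
      (∀ ν, Red P' ν → ev P' = ν.bind ev) → (∀ Q ∈ μ.support, ∀ ν, Red Q ν → ev Q = ν.bind ev) →
      ev P' = μ.bind ev := by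
    intro σ o v P' μ h hμ h₁ h₂
    obtain ⟨g, hg, hg'⟩ := h.diamond_step hP hμ
    rw [h₁ _ hg.red, PMF.bind_map]
    refine PMF_bind_congr fun Q hQ => ?_
    rw [h₂ Q hQ _ (hg' Q hQ).red, PMF.pure_bind]
    rfl
  rcases h₁ with h₁ | ⟨σ₁, o₁, v₁, P₁, h₁, rfl⟩ <;> rcases h₂ with h₂ | ⟨σ₂, o₂, v₂, P₂, h₂, rfl⟩
  · exact h₁.diamond hP h₂ ev fun Q hQ ν hν => hev Q hQ ν hν.red
  · rw [PMF.pure_bind]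
    exact (key h₂ h₁ (hev _ (.inr (by simp))) fun Q hQ => hev Q (.inl hQ)).symm
  · rw [PMF.pure_bind]
    exact key h₁ h₂ (hev _ (.inl (by simp))) fun Q hQ => hev Q (.inr hQ)
  · rw [PMF.pure_bind, PMF.pure_bind]
    by_cases ho : o₁.chan = o₂.chan
    · cases ho
      obtain ⟨rfl, rfl⟩ := h₁.unique hP h₂
      rfl
    · obtain ⟨P₃, h₃, h₄⟩ := h₁.diamond h₂ ho
      rw [hev P₁ (.inl (by simp)) _ h₃.red, hev P₂ (.inr (by simp)) _ h₄.red]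

/-! ### Evaluation -/

theorem BigStep.cases_red {Δ : S.Ctx} {P : Proto S M.Lit Δ} {η : PMF (Proto S M.Lit Δ)}
    (h : BigStep P η) : (P.Halted ∧ η = PMF.pure P) ∨ ∃ μ κ, Red P μ ∧
      (∀ Q ∈ μ.support, BigStep Q (κ Q)) ∧ η = μ.bind κ := by
  cases h with
  | halt hs ho =>
    refine .inl ⟨?_, rfl⟩
    by_contra h
    obtain ⟨μ, h | ⟨_, _, _, _, h, -⟩⟩ := Proto.exists_red h
    · exact hs _ h
    · exact ho _ _ _ _ h
  | @out _ _ _ _ P' _ h h' =>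
    exact .inr ⟨_, fun _ => η, h.red, by simpa using h', by rw [PMF.pure_bind]⟩
  | step h h' => exact .inr ⟨_, _, h.red, h', rfl⟩

theorem BigStep.red {Δ : S.Ctx} {P : Proto S M.Lit Δ} {μ : PMF (Proto S M.Lit Δ)}
    {κ : Proto S M.Lit Δ → PMF (Proto S M.Lit Δ)} (h : Red P μ)
    (hκ : ∀ Q ∈ μ.support, BigStep Q (κ Q)) : BigStep P (μ.bind κ) := by
  rcases h with h | ⟨_, _, _, P', h, rfl⟩
  · exact .step h hκ
  · rw [PMF.pure_bind]
    exact .out h (hκ _ (by simp))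

theorem Proto.bigStep_eval {Δ : S.Ctx} (P : Proto S M.Lit Δ) : BigStep P P.eval :=
  Classical.choose_spec (BigStep.exists P)

/-- Newman's argument by induction on the size. Local confluence is used with `ev := Proto.eval`,
and its invariance under the steps of the successors is the induction hypothesis. -/
theorem BigStep.eq_eval {Δ : S.Ctx} {P : Proto S M.Lit Δ} {I O : Set (Chan Δ)} (hP : P.Typed I O)
    {η : PMF (Proto S M.Lit Δ)} (h : BigStep P η) : η = P.eval := by
  induction hn : P.size using Nat.strong_induction_on generalizing P η with
  | _ n ih =>
    subst hn
    have key : ∀ {η₁ η₂ : PMF (Proto S M.Lit Δ)}, BigStep P η₁ → BigStep P η₂ → η₁ = η₂ := by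
      intro η₁ η₂ h₁ h₂
      rcases h₁.cases_red with ⟨hh, rfl⟩ | ⟨μ₁, κ₁, hr₁, hk₁, rfl⟩ <;>
        rcases h₂.cases_red with ⟨hh', rfl⟩ | ⟨μ₂, κ₂, hr₂, hk₂, rfl⟩
      · rfl
      · exact absurd hr₂ (hh.not_red _)
      · exact absurd hr₁ (hh'.not_red _)
      -- By induction both continuations may be replaced by `Proto.eval` on the successors.
      · rw [PMF_bind_congr fun Q hQ => ih _ (hr₁.size Q hQ) (hr₁.typed hP Q hQ) (hk₁ Q hQ) rfl,
          PMF_bind_congr fun Q hQ => ih _ (hr₂.size Q hQ) (hr₂.typed hP Q hQ) (hk₂ Q hQ) rfl]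
        refine Red.diamond hP hr₁ hr₂ _ fun Q hQ ν hν => ?_
        have hQs : Q.size < P.size ∧ Q.Typed I O := by
          rcases hQ with hQ | hQ
          · exact ⟨hr₁.size Q hQ, hr₁.typed hP Q hQ⟩
          · exact ⟨hr₂.size Q hQ, hr₂.typed hP Q hQ⟩
        exact (ih _ hQs.1 hQs.2 (BigStep.red hν fun Q' _ => Q'.bigStep_eval) rfl).symm
    exact key h P.bigStep_eval

/-- The form in which confluence is used: evaluation may begin with whichever step is convenient. -/
theorem Red.eval {Δ : S.Ctx} {P : Proto S M.Lit Δ} {I O : Set (Chan Δ)} (hP : P.Typed I O)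
    {μ : PMF (Proto S M.Lit Δ)} (h : Red P μ) : P.eval = μ.bind Proto.eval :=
  (BigStep.eq_eval hP (BigStep.red h fun Q _ => Q.bigStep_eval)).symm

theorem Proto.Halted.eval {Δ : S.Ctx} {P : Proto S M.Lit Δ} (h : P.Halted) :
    P.eval = PMF.pure P := by
  rcases P.bigStep_eval.cases_red with ⟨-, h'⟩ | ⟨μ, κ, hr, -, -⟩
  · exact h'
  · exact absurd hr (h.not_red _)

/-- Induction along the evaluation of a protocol. -/
theorem Proto.Typed.red_induction {Δ : S.Ctx} {I O : Set (Chan Δ)} {C : Proto S M.Lit Δ → Prop}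
    (halted : ∀ P, P.Typed I O → P.Halted → C P)
    (red : ∀ P μ, P.Typed I O → Red P μ → (∀ Q ∈ μ.support, Q.Typed I O → C Q) → C P)
    {P : Proto S M.Lit Δ} (hP : P.Typed I O) : C P := by
  induction hn : P.size using Nat.strong_induction_on generalizing P with
  | _ n ih =>
    subst hn
    by_cases hh : P.Halted
    · exact halted P hP hh
    · obtain ⟨μ, hμ⟩ := Proto.exists_red hh
      exact red P μ hP hμ fun Q hQ hQ' => ih _ (hμ.size Q hQ) hQ' rfl

/-- A property that is preserved by reductions holds for the results of an evaluation. -/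
theorem Proto.Typed.eval_support {Δ : S.Ctx} {I O : Set (Chan Δ)} {P : Proto S M.Lit Δ}
    (hP : P.Typed I O) (C : Proto S M.Lit Δ → Prop) (h : C P)
    (hC : ∀ P μ, P.Typed I O → C P → Red P μ → ∀ Q ∈ μ.support, C Q) :
    ∀ Q ∈ P.eval.support, C Q ∧ Q.Typed I O ∧ Q.Halted := by
  revert h
  refine Proto.Typed.red_induction (C := fun P => C P → ∀ Q ∈ P.eval.support,
    C Q ∧ Q.Typed I O ∧ Q.Halted) ?_ ?_ hP
  · intro P hP hh h Q hQ
    rw [hh.eval, PMF.support_pure, Set.mem_singleton_iff] at hQ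
    subst hQ
    exact ⟨h, hP, hh⟩
  · intro P μ hP hμ ih h Q hQ
    rw [hμ.eval hP, PMF.mem_support_bind_iff] at hQ
    obtain ⟨P', hP', hQ⟩ := hQ
    exact ih P' hP' (hμ.typed hP P' hP') (hC P μ hP h hμ P' hP') Q hQ

theorem Proto.Typed.eval_typed {Δ : S.Ctx} {I O : Set (Chan Δ)} {P : Proto S M.Lit Δ}
    (hP : P.Typed I O) : ∀ Q ∈ P.eval.support, Q.Typed I O :=
  fun Q hQ => (hP.eval_support (fun _ => True) trivial (fun _ _ _ _ _ _ _ => trivial) Q hQ).2.1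

theorem Proto.Typed.eval_halted {Δ : S.Ctx} {I O : Set (Chan Δ)} {P : Proto S M.Lit Δ}
    (hP : P.Typed I O) : ∀ Q ∈ P.eval.support, Q.Halted :=
  fun Q hQ => (hP.eval_support (fun _ => True) trivial (fun _ _ _ _ _ _ _ => trivial) Q hQ).2.2

theorem Proto.Typed.eval_new {Δ : S.Ctx} {τ : S.Typ} {I O : Set (Chan Δ)}
    {P : Proto S M.Lit (τ :: Δ)} (hP : (Proto.new τ P).Typed I O) :
    (Proto.new τ P).eval = P.eval.map (.new τ) := by
  replace hP := hP.new_inv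
  refine Proto.Typed.red_induction (C := fun P => (Proto.new τ P).eval = P.eval.map (.new τ))
    ?_ ?_ hP
  · intro P hP hh
    rw [hh.eval, PMF.pure_map]
    exact Proto.Halted.eval (P := .new τ P) hh
  · intro P μ hP hμ ih
    rw [hμ.eval hP, Red.eval (.new hP) (Red.new_iff.2 ⟨_, hμ, rfl⟩), PMF.bind_map, PMF.map_bind]
    exact PMF_bind_congr fun Q hQ => ih Q hQ (hμ.typed hP Q hQ)

theorem Proto.Typed.eval_mapChan {Δ Δ' : S.Ctx} {I O : Set (Chan Δ)} {P : Proto S M.Lit Δ}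
    (hP : P.Typed I O) {φ : Ren Δ Δ'} (hφ : ∀ a, Function.Injective (φ a)) :
    (P.mapChan φ).eval = P.eval.map (Proto.mapChan φ) := by
  refine Proto.Typed.red_induction (C := fun P => (P.mapChan φ).eval = P.eval.map (Proto.mapChan φ))
    ?_ ?_ hP
  · intro P hP hh
    rw [hh.eval, PMF.pure_map]
    exact Proto.Halted.eval (Proto.halted_mapChan.2 hh)
  · intro P μ hP hμ ih
    rw [hμ.eval hP, Red.eval (hP.mapChan hφ) (hμ.mapChan hφ), PMF.bind_map, PMF.map_bind]
    exact PMF_bind_congr fun Q hQ => ih Q hQ (hμ.typed hP Q hQ)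

theorem Red.assign {Δ : S.Ctx} {P : Proto S M.Lit Δ} {I O : Set (Chan Δ)} (hP : P.Typed I O)
    {μ : PMF (Proto S M.Lit Δ)} (h : Red P μ) {a : Asg M.Lit Δ} (ha : ∀ c ∈ O, a c.1 c.2 = none) :
    Red (P.assign a) (μ.map (Proto.assign a)) := by
  rcases h with h | ⟨_, _, _, _, h, rfl⟩
  · exact (h.assign a).red
  · rw [PMF.pure_map]
    exact (h.assign (ha _ (h.mem hP))).red

/-- The assignment can be delayed until `P` has come to rest, because every step of `P` survives it.
For output steps this needs `ha`. -/
theorem Proto.Typed.eval_assign {Δ : S.Ctx} {I O : Set (Chan Δ)} {P : Proto S M.Lit Δ}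
    (hP : P.Typed I O) {a : Asg M.Lit Δ} (ha : ∀ c ∈ O, a c.1 c.2 = none) :
    (P.assign a).eval = P.eval.bind fun P' => (P'.assign a).eval := by
  refine Proto.Typed.red_induction
    (C := fun P => (P.assign a).eval = P.eval.bind fun P' => (P'.assign a).eval) ?_ ?_ hP
  · intro P hP hh
    rw [hh.eval, PMF.pure_bind]
  · intro P μ hP hμ ih
    rw [hμ.eval hP, Red.eval (hP.assign' a) (hμ.assign hP ha), PMF.bind_map, PMF.bind_bind]
    exact PMF_bind_congr fun Q hQ => ih Q hQ (hμ.typed hP Q hQ)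

/-- In a parallel composition, the left component can be evaluated first. -/
theorem Proto.Typed.eval_par {Δ : S.Ctx} {I O₁ O₂ : Set (Chan Δ)} {P : Proto S M.Lit Δ}
    (hP : P.Typed (I ∪ O₂) O₁) {Q : Proto S M.Lit Δ} (hQ : Q.Typed (I ∪ O₁) O₂) :
    (Proto.par P (Q.assign P.vals)).eval =
      P.eval.bind fun P' => (Proto.par P' (Q.assign P'.vals)).eval := by
  refine Proto.Typed.red_induction (C := fun P => (Proto.par P (Q.assign P.vals)).eval =
      P.eval.bind fun P' => (Proto.par P' (Q.assign P'.vals)).eval) ?_ ?_ hP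
  · intro P hP hh
    rw [hh.eval, PMF.pure_bind]
  · intro P μ hP hμ ih
    rw [hμ.eval hP, PMF.bind_bind]
    rcases hμ with hμ | ⟨σ, o, v, P', hμ, rfl⟩
    · rw [Red.eval (.par hP (hQ.assign' _)) (hμ.parLeft _).red, PMF.bind_map]
      refine PMF_bind_congr fun P' hP' => ?_
      rw [← ih P' hP' (hμ.typed hP P' hP'), Function.comp, hμ.vals hP P' hP']
    -- The value that the output sends to `Q` is the one by which the values of the left component
    -- grow, so the form `Q.assign P.vals` is kept.
    · rw [Red.eval (.par hP (hQ.assign' _)) (hμ.parLeft _).red, PMF.pure_bind, PMF.pure_bind,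
        ← ih P' (by simp) (hμ.typed hP), hμ.vals hP, Proto.input, Proto.assign_or]

end Reduction

/-! ## Expectations -/

section Expectation

variable {X Y : Type}

/-- The expectation of a function with values in `[0, ∞]`. -/
noncomputable def expect (μ : PMF X) (f : X → ℝ≥0∞) : ℝ≥0∞ := ∑' x, μ x * f x

theorem expect_congr {μ : PMF X} {f g : X → ℝ≥0∞} (h : ∀ x ∈ μ.support, f x = g x) :
    expect μ f = expect μ g := by
  refine tsum_congr fun x => ?_
  by_cases hx : x ∈ μ.support
  · rw [h x hx]
  · rw [(PMF.apply_eq_zero_iff _ _).2 hx, zero_mul, zero_mul]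

theorem expect_const (μ : PMF X) (c : ℝ≥0∞) : expect μ (fun _ => c) = c := by
  rw [expect, ENNReal.tsum_mul_right, PMF.tsum_coe, one_mul]

@[simp] theorem expect_pure (x : X) (f : X → ℝ≥0∞) : expect (PMF.pure x) f = f x := by
  rw [expect_congr (g := fun _ => f x) (by simp), expect_const]

theorem expect_bind (μ : PMF X) (κ : X → PMF Y) (f : Y → ℝ≥0∞) :
    expect (μ.bind κ) f = expect μ fun x => expect (κ x) f := by
  simp only [expect, PMF.bind_apply, ← ENNReal.tsum_mul_right, ← ENNReal.tsum_mul_left]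
  rw [ENNReal.tsum_comm]
  simp only [mul_assoc]

theorem expect_map (μ : PMF X) (g : X → Y) (f : Y → ℝ≥0∞) :
    expect (μ.map g) f = expect μ fun x => f (g x) := by
  rw [PMF.map, expect_bind]
  simp

theorem expect_tsum {ι : Type} (μ : PMF X) (w : ι → ℝ≥0∞) (f : ι → X → ℝ≥0∞) :
    expect μ (fun x => ∑' i, w i * f i x) = ∑' i, w i * expect μ (f i) := by
  simp only [expect, ← ENNReal.tsum_mul_left]
  rw [ENNReal.tsum_comm]
  refine tsum_congr fun i => tsum_congr fun x => ?_
  rw [mul_left_comm]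

theorem bind_apply_eq_expect (μ : PMF X) (κ : X → PMF Y) (y : Y) :
    μ.bind κ y = expect μ fun x => κ x y := PMF.bind_apply ..

theorem expect_const_congr {μ : PMF X} {ν : PMF Y} {f : X → ℝ≥0∞} {g : Y → ℝ≥0∞}
    (h : ∀ x ∈ μ.support, ∀ y ∈ ν.support, f x = g y) : expect μ f = expect ν g := by
  obtain ⟨x₀, hx₀⟩ := μ.support_nonempty
  obtain ⟨y₀, hy₀⟩ := ν.support_nonempty
  rw [expect_congr (g := fun _ => g y₀) fun x hx => h x hx y₀ hy₀, expect_const,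
    expect_congr (f := g) (g := fun _ => g y₀) fun y hy => by
      rw [← h x₀ hx₀ y hy, h x₀ hx₀ y₀ hy₀], expect_const]

end Expectation

/-! ## Tests -/

section Tests

variable {S : Sig} {M : Interp S}

/-- The success probabilities, as functions of the protocol, of experiments with protocols
`Δ ⊢ I → O` that provide inputs, evaluate the protocol, and observe the values of the outputs. -/
inductive Test {Δ : S.Ctx} (I O : Set (Chan Δ)) : (Proto S M.Lit Δ → ℝ≥0∞) → Prop
  | one : Test I O fun _ => 1
  | sum {ι : Type} (w : ι → ℝ≥0∞) {f : ι → Proto S M.Lit Δ → ℝ≥0∞} (h : ∀ i, Test I O (f i)) :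
      Test I O fun P => ∑' i, w i * f i P
  | input {σ : S.Typ} {i : Mem Δ σ} (hi : i.chan ∈ I) (v : M.Lit σ)
      {f : Proto S M.Lit Δ → ℝ≥0∞} (h : Test I O f) : Test I O fun P => f (P.input i v)
  | eval {f : Proto S M.Lit Δ → ℝ≥0∞} (h : Test I O f) : Test I O fun P => expect P.eval f
  | obs {F : Asg M.Lit Δ → Proto S M.Lit Δ → ℝ≥0∞} (h : ∀ w, Test I O (F w)) :
      Test I O fun P => F P.vals P
  | congr {f g : Proto S M.Lit Δ → ℝ≥0∞} (h : Test I O f) (hfg : ∀ P, P.Typed I O → f P = g P) :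
      Test I O g

/-! ### Test equivalence, coinduction and simulations -/

variable {Δ Δ' : S.Ctx} {I O O₁ O₂ : Set (Chan Δ)}

theorem Test.expect {X : Type} {μ : PMF X} {f : X → Proto S M.Lit Δ → ℝ≥0∞}
    (h : ∀ x ∈ μ.support, Test I O (f x)) : Test I O fun P => IPDL.expect μ fun x => f x P := by
  classical
  refine .congr (.sum (fun x => μ x) (f := fun x => if x ∈ μ.support then f x else fun _ => 1)
    fun x => ?_) fun P _ => ?_
  · split_ifs with hx
    · exact h x hx
    · exact .one
  · refine expect_congr fun x hx => ?_
    rw [if_pos hx]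

theorem Test.const (c : ℝ≥0∞) : Test I O fun _ : Proto S M.Lit Δ => c :=
  .congr (.sum (ι := Unit) (fun _ => c) fun _ => .one) fun P _ => by simp

/-- Protocols `Δ ⊢ I → O` that pass the same tests. -/
structure TestEq (I O : Set (Chan Δ)) (P Q : Proto S M.Lit Δ) : Prop where
  left : P.Typed I O
  right : Q.Typed I O
  test : ∀ f, Test I O f → f P = f Q

theorem TestEq.refl {P : Proto S M.Lit Δ} (hP : P.Typed I O) : TestEq I O P P :=
  ⟨hP, hP, fun _ _ => rfl⟩

theorem TestEq.symm {P Q : Proto S M.Lit Δ} (h : TestEq I O P Q) : TestEq I O Q P :=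
  ⟨h.right, h.left, fun f hf => (h.test f hf).symm⟩

theorem TestEq.trans {P Q R : Proto S M.Lit Δ} (h : TestEq I O P Q) (h' : TestEq I O Q R) :
    TestEq I O P R :=
  ⟨h.left, h'.right, fun f hf => (h.test f hf).trans (h'.test f hf)⟩

/-- Coinduction: related protocols pass the same tests if this is so for their inputs and
evaluations, given that related protocols pass the same smaller tests. -/
theorem TestEq.coinduct (r : Proto S M.Lit Δ → Proto S M.Lit Δ → Prop)
    (typed : ∀ P Q, r P Q → P.Typed I O ∧ Q.Typed I O)
    (vals : ∀ P Q, r P Q → P.vals = Q.vals)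
    (input : ∀ P Q, r P Q → ∀ (σ : S.Typ) (i : Mem Δ σ) (v : M.Lit σ), i.chan ∈ I →
      ∀ f, Test I O f → (∀ P Q, r P Q → f P = f Q) → f (P.input i v) = f (Q.input i v))
    (eval : ∀ P Q, r P Q → ∀ f, Test I O f → (∀ P Q, r P Q → f P = f Q) →
      IPDL.expect P.eval f = IPDL.expect Q.eval f)
    {P Q : Proto S M.Lit Δ} (h : r P Q) : TestEq I O P Q := by
  refine ⟨(typed P Q h).1, (typed P Q h).2, fun f hf => ?_⟩
  -- The claim must be made for all related pairs before the induction, since an input or an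
  -- evaluation moves to another pair.
  suffices ∀ P Q, r P Q → f P = f Q from this P Q h
  clear h P Q
  induction hf with
  | one => intros; rfl
  | sum w hf ih => intro P Q h; exact tsum_congr fun i => by rw [ih i P Q h]
  | input hi v hf ih => intro P Q h; exact input P Q h _ _ v hi _ hf ih
  | eval hf ih => intro P Q h; exact eval P Q h _ hf ih
  | obs hf ih => intro P Q h; beta_reduce; rw [vals P Q h]; exact ih _ P Q h
  | congr hf hfg ih =>
    intro P Q h
    rw [← hfg P (typed P Q h).1, ← hfg Q (typed P Q h).2]
    exact ih P Q h

theorem Proto.Typed.input {P : Proto S M.Lit Δ} (hP : P.Typed I O) {σ : S.Typ} (i : Mem Δ σ)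
    (v : M.Lit σ) : (P.input i v).Typed I O := hP.assign' _

theorem Asg.single_eq_none_of_disjoint {I O : Set (Chan Δ)} {P : Proto S M.Lit Δ}
    (hP : P.Typed I O) {σ : S.Typ} {i : Mem Δ σ} (hi : i.chan ∈ I) (v : M.Lit σ) :
    ∀ c ∈ O, Asg.single i v c.1 c.2 = Option.none := by
  intro c hc
  refine Asg.single_ne fun h => hP.disjoint c hc ?_
  rw [← show i.chan = c from h]
  exact hi

/-- A partial evaluation that does not change the values of the outputs is not observable. -/
theorem Test.silent {f : Proto S M.Lit Δ → ℝ≥0∞} (hf : Test I O f) :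
    ∀ {P : Proto S M.Lit Δ} {μ : PMF (Proto S M.Lit Δ)}, P.Typed I O →
    P.eval = μ.bind Proto.eval → (∀ Q ∈ μ.support, Q.Typed I O ∧ Q.vals = P.vals) →
    f P = IPDL.expect μ f := by
  induction hf with
  | one => intro P μ hP he hμ; rw [expect_const]
  | sum w hf ih =>
    intro P μ hP he hμ
    rw [expect_tsum]
    exact tsum_congr fun i => by rw [ih i hP he hμ]
  | @input σ i hi v f hf ih =>
    intro P μ hP he hμ
    beta_reduce
    rw [ih (hP.input i v) (μ := μ.map fun Q => Q.input i v), expect_map]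
    · have hnone := Asg.single_eq_none_of_disjoint hP hi v
      -- Delaying the input until after the evaluation reduces the evaluations of the protocols with
      -- input to those without, which `he` compares.
      rw [hP.eval_assign hnone, he, PMF.bind_map, PMF.bind_bind]
      exact PMF_bind_congr fun Q hQ => ((hμ Q hQ).1.eval_assign hnone).symm
    · intro Q hQ
      simp only [PMF.mem_support_map_iff] at hQ
      obtain ⟨Q, hQ, rfl⟩ := hQ
      refine ⟨(hμ Q hQ).1.input i v, ?_⟩
      rw [Proto.vals_assign, Proto.vals_assign, (hμ Q hQ).2]
  | eval hf ih => intro P μ hP he hμ; beta_reduce; rw [he, expect_bind]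
  | @obs F hf ih =>
    intro P μ hP he hμ
    rw [expect_congr (g := fun Q => F P.vals Q) fun Q hQ => by rw [(hμ Q hQ).2]]
    exact ih _ hP he hμ
  | congr hf hfg ih =>
    intro P μ hP he hμ
    rw [← hfg P hP, ih hP he hμ]
    exact expect_congr fun Q hQ => hfg Q (hμ Q hQ).1

theorem TestEq.of_red {P Q : Proto S M.Lit Δ} (hP : P.Typed I O) (h : Red P (PMF.pure Q))
    (hv : Q.vals = P.vals) : TestEq I O P Q := by
  have hQ : Q.Typed I O := h.typed hP Q (by simp)
  refine ⟨hP, hQ, fun f hf => ?_⟩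
  rw [hf.silent hP (h.eval hP) (by simpa using ⟨hQ, hv⟩), expect_pure]

/-- An evaluation that does not produce any output is not observable. -/
theorem Test.expect_eval {f : Proto S M.Lit Δ → ℝ≥0∞} (hf : Test I O f) {P : Proto S M.Lit Δ}
    (hP : P.Typed I O) (h : ∀ Q ∈ P.eval.support, Q.vals = P.vals) :
    IPDL.expect P.eval f = f P := by
  refine (hf.silent hP ?_ fun Q hQ => ⟨hP.eval_typed Q hQ, h Q hQ⟩).symm
  -- Evaluation is idempotent, as its results have halted. So `P.eval` itself is a partial
  -- evaluation of `P`.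
  conv_lhs => rw [← PMF.bind_pure P.eval]
  exact PMF_bind_congr fun Q hQ => ((hP.eval_halted Q hQ).eval).symm

/-- Two distributions that are related by a coupling along `r`, in terms of expectations. -/
def Lift (r : Proto S M.Lit Δ → Proto S M.Lit Δ → Prop) (μ ν : PMF (Proto S M.Lit Δ)) : Prop :=
  ∀ F G : Proto S M.Lit Δ → ℝ≥0∞,
    (∀ P ∈ μ.support, ∀ Q ∈ ν.support, r P Q → F P = G Q) → IPDL.expect μ F = IPDL.expect ν G

theorem Lift.map {r : Proto S M.Lit Δ → Proto S M.Lit Δ → Prop} {X : Type} {μ : PMF X}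
    {a b : X → Proto S M.Lit Δ} (h : ∀ x ∈ μ.support, r (a x) (b x)) :
    Lift r (μ.map a) (μ.map b) := by
  intro F G hFG
  rw [expect_map, expect_map]
  exact expect_congr fun x hx => hFG _ ((PMF.mem_support_map_iff _ _ _).2 ⟨x, hx, rfl⟩) _
    ((PMF.mem_support_map_iff _ _ _).2 ⟨x, hx, rfl⟩) (h x hx)

theorem Lift.pure {r : Proto S M.Lit Δ → Proto S M.Lit Δ → Prop} {P Q : Proto S M.Lit Δ}
    (h : r P Q) : Lift r (PMF.pure P) (PMF.pure Q) := by
  intro F G hFG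
  rw [expect_pure, expect_pure]
  exact hFG _ (by simp) _ (by simp) h

theorem Lift.map_pure {r : Proto S M.Lit Δ → Proto S M.Lit Δ → Prop} {X : Type} {μ : PMF X}
    {a : X → Proto S M.Lit Δ} {Q : Proto S M.Lit Δ} (h : ∀ x ∈ μ.support, r (a x) Q) :
    Lift r (μ.map a) (PMF.pure Q) := by
  intro F G hFG
  rw [expect_map, expect_pure, expect_congr (g := fun _ => G Q), expect_const]
  exact fun x hx => hFG _ ((PMF.mem_support_map_iff _ _ _).2 ⟨x, hx, rfl⟩) _ (by simp) (h x hx)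

/-- Simulations up to test equivalence: some step of the left protocol is matched by a partial
evaluation of the right protocol, or the evaluations of the protocols coincide with those of test
equivalent protocols, or these evaluations do not produce outputs. -/
theorem TestEq.of_sim_upto (r : Proto S M.Lit Δ → Proto S M.Lit Δ → Prop)
    (typed : ∀ P Q, r P Q → P.Typed I O ∧ Q.Typed I O)
    (vals : ∀ P Q, r P Q → P.vals = Q.vals)
    (input : ∀ P Q, r P Q → ∀ (σ : S.Typ) (i : Mem Δ σ) (v : M.Lit σ), i.chan ∈ I →
      r (P.input i v) (Q.input i v))
    (step : ∀ P Q, r P Q →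
      (∃ μ ν, Red P μ ∧ Q.eval = ν.bind Proto.eval ∧ Lift r μ ν) ∨
      (∃ P' Q', P.eval = P'.eval ∧ Q.eval = Q'.eval ∧ TestEq I O P' Q') ∨
      ((∀ P' ∈ P.eval.support, P'.vals = P.vals) ∧ ∀ Q' ∈ Q.eval.support, Q'.vals = Q.vals))
    {P Q : Proto S M.Lit Δ} (h : r P Q) : TestEq I O P Q := by
  refine TestEq.coinduct r typed vals (fun P Q h σ i v hi f _ hf => hf _ _ (input P Q h σ i v hi))
    (fun P Q h f hf ihf => ?_) h
  -- The induction over the test is inside `TestEq.coinduct`. This one consumes the steps of the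
  -- left protocol, so the right protocol is allowed to make no progress at all.
  induction hn : P.size using Nat.strong_induction_on generalizing P Q with
  | _ n ih =>
    subst hn
    rcases step P Q h with ⟨μ, ν, hμ, hν, hl⟩ | ⟨P', Q', hP', hQ', ht⟩ | ⟨hP, hQ⟩
    · rw [hμ.eval (typed P Q h).1, hν, expect_bind, expect_bind]
      exact hl _ _ fun P' hP' Q' hQ' hr => ih _ (hμ.size P' hP') P' Q' hr rfl
    · rw [hP', hQ']
      exact ht.test _ hf.eval
    · rw [hf.expect_eval (typed P Q h).1 hP, hf.expect_eval (typed P Q h).2 hQ, ihf P Q h]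

theorem Proto.Halted.eval_vals {P : Proto S M.Lit Δ} (h : P.Halted) :
    ∀ P' ∈ P.eval.support, P'.vals = P.vals := by
  rw [h.eval]
  simp

/-- Simulations, for which some step of the left protocol is matched by a partial evaluation of
the right protocol, relate protocols that pass the same tests. -/
theorem TestEq.of_sim (r : Proto S M.Lit Δ → Proto S M.Lit Δ → Prop)
    (typed : ∀ P Q, r P Q → P.Typed I O ∧ Q.Typed I O)
    (vals : ∀ P Q, r P Q → P.vals = Q.vals)
    (input : ∀ P Q, r P Q → ∀ (σ : S.Typ) (i : Mem Δ σ) (v : M.Lit σ), i.chan ∈ I →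
      r (P.input i v) (Q.input i v))
    (halted : ∀ P Q, r P Q → P.Halted → Q.Halted)
    (red : ∀ P Q, r P Q → ∀ μ, Red P μ →
      ∃ μ ν, Red P μ ∧ Q.eval = ν.bind Proto.eval ∧ Lift r μ ν)
    {P Q : Proto S M.Lit Δ} (h : r P Q) : TestEq I O P Q := by
  refine TestEq.of_sim_upto r typed vals input (fun P Q h => ?_) h
  by_cases hh : P.Halted
  · exact .inr (.inr ⟨hh.eval_vals, (halted P Q h hh).eval_vals⟩)
  · obtain ⟨μ, hμ⟩ := Proto.exists_red hh
    exact .inl (red P Q h μ hμ)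

theorem Proto.eval_eq_pure_bind (P : Proto S M.Lit Δ) :
    P.eval = (PMF.pure P).bind Proto.eval := by rw [PMF.pure_bind]

/-! ### Tests in contexts -/

/-- An input outside `I` does nothing to a protocol with inputs `I` and outputs `O`: the channel is
neither read nor owned by it. This covers both the rule for unused inputs and adversaries that
assign further channels. -/
theorem Test.mono {I' : Set (Chan Δ)} {f : Proto S M.Lit Δ → ℝ≥0∞} (hf : Test I' O f)
    (hI : I ⊆ I') (hO : ∀ c ∈ O, c ∉ I') : Test I O f := by
  induction hf with
  | one => exact .one
  | sum w hf ih => exact .sum w ih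
  | @input σ i hi v f hf ih =>
    by_cases hi' : i.chan ∈ I
    · exact .input hi' v ih
    · refine .congr ih fun P hP => ?_
      rw [Proto.input, hP.assign_eq]
      · exact fun c hc => Asg.single_ne fun h => hi' (by rw [h]; exact hc)
      · exact fun c hc => Asg.single_ne fun h => hO c hc (by rw [← show i.chan = c from h]; exact hi)
  | eval hf ih => exact .eval ih
  | obs hf ih => exact .obs ih
  | congr hf hfg ih => exact .congr ih fun P hP => hfg P (hP.mono hI hO)

/-- Evaluation commutes with the binder, and an experiment with `new τ P` is an experiment with `P`
that ignores the bound channel. -/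
theorem Test.new {τ : S.Typ} {f : Proto S M.Lit Δ → ℝ≥0∞} (hf : Test I O f) :
    Test (shift I) (shift O ∪ {Mem.zero.chan}) fun P => f (.new τ P) := by
  induction hf with
  | one => exact .one
  | sum w hf ih => exact .sum w ih
  | @input σ i hi v f hf ih =>
    refine .congr (.input (succ_mem_shift.2 hi) v ih) fun P _ => ?_
    beta_reduce
    rw [Proto.input, ← Asg.lift_single]
    rfl
  | eval hf ih =>
    refine .congr (.eval ih) fun P hP => ?_
    beta_reduce
    rw [Proto.Typed.eval_new (.new hP), expect_map]
  | @obs F hf ih =>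
    exact .obs (F := fun w P => F (fun σ c => w σ c.succ) (.new τ P)) fun w => ih _
  | congr hf hfg ih => exact .congr ih fun P hP => hfg _ (.new hP)

open scoped Classical in
/-- The values on the image of a renaming. -/
noncomputable def Asg.push {V : S.Typ → Type} (φ : Ren Δ Δ') (a : Asg V Δ) : Asg V Δ' :=
  fun τ c' => if h : ∃ c, φ τ c = c' then a τ h.choose else Option.none

theorem Proto.vals_mapChan_eq_push {V : S.Typ → Type} {φ : Ren Δ Δ'}
    (hφ : ∀ a, Function.Injective (φ a)) (P : Proto S V Δ) :
    (P.mapChan φ).vals = P.vals.push φ := by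
  funext τ c'
  rw [Asg.push]
  split_ifs with h
  · rw [← P.vals_mapChan hφ, h.choose_spec]
  · exact P.vals_mapChan_none _ fun c hc => h ⟨c, hc⟩

/-- An injective renaming commutes with inputs and evaluation, and the values seen after it are a
function of those before it (`Asg.push`). -/
theorem Test.mapChan {φ : Ren Δ Δ'} (hφ : ∀ a, Function.Injective (φ a))
    {f : Proto S M.Lit Δ' → ℝ≥0∞} (hf : Test (φ.image I) (φ.image O) f) :
    Test I O fun P => f (P.mapChan φ) := by
  induction hf with
  | one => exact .one
  | sum w hf ih => exact .sum w ih
  | @input σ i hi v f hf ih =>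
    obtain ⟨⟨σ, j⟩, hj, h⟩ := hi
    cases h
    refine .congr (.input hj v ih) fun P _ => ?_
    exact congrArg f (Proto.mapChan_input hφ P j v).symm
  | eval hf ih =>
    refine .congr (.eval ih) fun P hP => ?_
    beta_reduce
    rw [hP.eval_mapChan hφ, expect_map]
  | @obs F hf ih =>
    refine .congr (.obs (F := fun w P => F (w.push φ) (P.mapChan φ)) fun w => ih _) fun P _ => ?_
    beta_reduce
    rw [Proto.vals_mapChan_eq_push hφ]
  | congr hf hfg ih => exact .congr ih fun P hP => hfg _ (hP.mapChan hφ)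

/-- The case of evaluation in `Test.par`. First `P` is evaluated and its values are handed to `Q`.
If `Q` is then halted, so is the composition. Otherwise one step of `Q` is simulated by the test: a
random choice becomes a weighted sum, an output of `Q` an input of `P`. After that `Q` is smaller
and the argument is repeated. -/
theorem Test.par_eval {f : Proto S M.Lit Δ → ℝ≥0∞}
    (ih : ∀ Q : Proto S M.Lit Δ, Q.Typed (I ∪ O₁) O₂ →
      Test (I ∪ O₂) O₁ fun P => f (.par P (Q.assign P.vals)))
    {Q : Proto S M.Lit Δ} (hQ : Q.Typed (I ∪ O₁) O₂) :
    Test (I ∪ O₂) O₁ fun P => IPDL.expect (Proto.par P (Q.assign P.vals)).eval f := by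
  induction hn : Q.size using Nat.strong_induction_on generalizing Q with
  | _ n ihn =>
    subst hn
    -- For each observation `w`, a test for the rest of the evaluation. It only has to be correct on
    -- halted protocols with these values.
    have key : ∀ w : Asg M.Lit Δ, ∃ g, Test (I ∪ O₂) O₁ g ∧
        ∀ P : Proto S M.Lit Δ, P.Typed (I ∪ O₂) O₁ → P.Halted → P.vals = w →
          IPDL.expect (Proto.par P (Q.assign P.vals)).eval f = g P := by
      intro w
      by_cases hh : (Q.assign w).Halted
      · refine ⟨_, ih Q hQ, ?_⟩
        rintro P hP hPh rfl
        rw [Proto.Halted.eval (P := .par P (Q.assign P.vals)) ⟨hPh, hh⟩, expect_pure]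
      -- A successor of `Q.assign w` reads no channel assigned by `w`, hence already has the shape
      -- `Q'.assign P.vals` required by the induction hypothesis.
      · have hfix : ∀ P : Proto S M.Lit Δ, P.Typed (I ∪ O₂) O₁ → P.vals = w →
            ∀ Q' : Proto S M.Lit Δ, Q'.Typed {c | c ∈ I ∪ O₁ ∧ w c.1 c.2 = none} O₂ →
            Q'.assign P.vals = Q' := by
          rintro P hP rfl Q' hQ'
          refine hQ'.assign_eq (fun c hc => hc.2) fun c hc => ?_
          exact hP.vals_eq_none fun h => hP.disjoint c h (.inr hc)
        obtain ⟨μ, hμ | ⟨σ, o, v, Q', hμ, rfl⟩⟩ := Proto.exists_red hh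
        · refine ⟨_, Test.expect (μ := μ)
            (f := fun Q' P => IPDL.expect (Proto.par P (Q'.assign P.vals)).eval f)
            fun Q' hQ' => ihn Q'.size ?_ (hμ.typed (hQ.assign' w) Q' hQ') rfl, ?_⟩
          · rw [← Q.size_assign w]
            exact hμ.size Q' hQ'
          · rintro P hP hPh hw
            conv_lhs => rw [hw]
            rw [Red.eval (.par hP (hQ.assign' _)) (hμ.parRight P).red, expect_bind, expect_map]
            refine expect_congr fun Q' hQ' => ?_
            rw [hfix P hP hw Q' (hμ.typed (hQ.assign w) Q' hQ')]
        · have ho := hμ.mem (hQ.assign' w)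
          -- Outputs of `Q` are inputs of `P`.
          refine ⟨_, .input (.inr ho) v (ihn Q'.size ?_ (hμ.typed (hQ.assign' w)) rfl), ?_⟩
          · rw [← Q.size_assign w]
            exact hμ.size
          · rintro P hP hPh hw
            conv_lhs => rw [hw]
            rw [Red.eval (.par hP (hQ.assign' _)) (hμ.parRight P).red, PMF.pure_bind,
              Proto.vals_assign, hfix P hP hw Q' (hμ.typed (hQ.assign w))]
    choose g hg hg' using key
    -- Evaluate `P`, observe its values `w`, and continue with the test `g w`.
    refine .congr (.eval (.obs hg)) fun P hP => ?_
    rw [hP.eval_par hQ, expect_bind]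
    exact expect_congr fun P' hP' =>
      (hg' _ P' (hP.eval_typed P' hP') (hP.eval_halted P' hP') rfl).symm

/-- The component is `Q.assign P.vals` and not `Q`, so that the family of experiments is closed
under evaluation: whatever `P` has output has already reached `Q`. -/
theorem Test.par {f : Proto S M.Lit Δ → ℝ≥0∞} (hf : Test I (O₁ ∪ O₂) f) :
    ∀ {Q : Proto S M.Lit Δ}, Q.Typed (I ∪ O₁) O₂ →
      Test (I ∪ O₂) O₁ fun P => f (.par P (Q.assign P.vals)) := by
  induction hf with
  | one => intros; exact .one
  | sum w hf ih => intro Q hQ; exact .sum w fun i => ih i hQ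
  | @input σ i hi v f hf ih =>
    intro Q hQ
    refine .congr (.input (.inl hi) v (ih (hQ.input i v))) fun P hP => ?_
    -- `P` does not own the input channel `i`, so the input and the values of `P` can be assigned to
    -- `Q` in either order.
    have : P.vals σ i = none := hP.vals_eq_none fun h => hP.disjoint _ h (.inl hi)
    rw [Proto.vals_assign, Q.assign_comm this]
    rfl
  | eval hf ih => intro Q hQ; exact Test.par_eval (fun Q hQ => ih hQ) hQ
  | @obs F hf ih =>
    intro Q hQ
    refine .congr (.obs (F := fun w P => F (w.or Q.vals) (.par P (Q.assign P.vals)))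
      fun w => ih _ hQ) fun P _ => ?_
    beta_reduce
    rw [Proto.vals_par, Proto.vals_assign]
  | congr hf hfg ih => intro Q hQ; exact .congr (ih hQ) fun P hP => hfg _ (.par hP (hQ.assign' _))

/-- Test equivalence is preserved by parallel composition with a protocol that does not read the
outputs that are already present. -/
theorem TestEq.par_of_vals {P P' Q : Proto S M.Lit Δ} (h : TestEq (I ∪ O₂) O₁ P P')
    (hQ : Q.Typed (I ∪ O₁) O₂) (hP : Q.assign P.vals = Q) (hP' : Q.assign P'.vals = Q) :
    TestEq I (O₁ ∪ O₂) (.par P Q) (.par P' Q) := by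
  refine ⟨.par h.left hQ, .par h.right hQ, fun f hf => ?_⟩
  have := h.test _ (hf.par hQ)
  rwa [hP, hP'] at this

theorem TestEq.new {τ : S.Typ} {P P' : Proto S M.Lit (τ :: Δ)}
    (h : TestEq (shift I) (shift O ∪ {Mem.zero.chan}) P P') :
    TestEq I O (.new τ P) (.new τ P') :=
  ⟨.new h.left, .new h.right, fun _ hf => h.test _ hf.new⟩

theorem TestEq.mapChan {φ : Ren Δ Δ'} (hφ : ∀ a, Function.Injective (φ a)) {P P' : Proto S M.Lit Δ}
    (h : TestEq I O P P') : TestEq (φ.image I) (φ.image O) (P.mapChan φ) (P'.mapChan φ) :=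
  ⟨h.left.mapChan hφ, h.right.mapChan hφ, fun _ hf => h.test _ (hf.mapChan hφ)⟩

theorem TestEq.mono {I' : Set (Chan Δ)} {P P' : Proto S M.Lit Δ} (h : TestEq I O P P')
    (hI : I ⊆ I') (hO : ∀ c ∈ O, c ∉ I') : TestEq I' O P P' :=
  ⟨h.left.mono hI hO, h.right.mono hI hO, fun _ hf => h.test _ (hf.mono hI hO)⟩

/-! ### Bisimulations -/

theorem mem_support_of_bind {X Y : Type} {ν : PMF X} {κ : X → PMF Y} {η : PMF Y}
    (h : ν.bind κ = η) {x : X} (hx : x ∈ ν.support) {y : Y} (hy : y ∈ (κ x).support) :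
    y ∈ η.support := by
  rw [← h, PMF.mem_support_bind_iff]
  exact ⟨x, hx, hy⟩

/-- The parts of a split are again related, so each of them can be split along the next channel. -/
theorem IsBisimulation.valuations {r : PMF (Proto S M.Lit Δ) → PMF (Proto S M.Lit Δ) → Prop}
    (hr : IsBisimulation M I O r) (l : List (Chan Δ)) (hl : ∀ c ∈ l, c ∈ O) :
    ∀ {η ε : PMF (Proto S M.Lit Δ)}, r η ε →
    ∃ ν : PMF (PMF (Proto S M.Lit Δ) × PMF (Proto S M.Lit Δ)),
      (ν.bind fun p => p.1) = η ∧ (ν.bind fun p => p.2) = ε ∧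
      ∀ p ∈ ν.support, r p.1 p.2 ∧ ∀ c ∈ l, ∃ v : Option (M.Lit c.1),
        (∀ P ∈ p.1.support, P.vals c.1 c.2 = v) ∧ (∀ P ∈ p.2.support, P.vals c.1 c.2 = v) := by
  induction l with
  | nil =>
    intro η ε h
    exact ⟨PMF.pure (η, ε), by rw [PMF.pure_bind], by rw [PMF.pure_bind], by simpa using h⟩
  | cons c l ih =>
    intro η ε h
    obtain ⟨ν, h₁, h₂, hν⟩ := hr.valuation h c.1 c.2 (hl c (by simp))
    have hκ : ∀ p : PMF (Proto S M.Lit Δ) × PMF (Proto S M.Lit Δ),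
        ∃ κ : PMF (PMF (Proto S M.Lit Δ) × PMF (Proto S M.Lit Δ)), p ∈ ν.support →
          (κ.bind fun p => p.1) = p.1 ∧ (κ.bind fun p => p.2) = p.2 ∧
          ∀ p ∈ κ.support, r p.1 p.2 ∧ ∀ c ∈ l, ∃ v : Option (M.Lit c.1),
            (∀ P ∈ p.1.support, P.vals c.1 c.2 = v) ∧
            (∀ P ∈ p.2.support, P.vals c.1 c.2 = v) := by
      intro p
      by_cases hp : p ∈ ν.support
      · obtain ⟨κ, hκ⟩ := ih (fun d hd => hl d (by simp [hd])) (hν p hp).1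
        exact ⟨κ, fun _ => hκ⟩
      · exact ⟨PMF.pure p, fun h => absurd h hp⟩
    choose κ hκ using hκ
    refine ⟨ν.bind κ, ?_, ?_, ?_⟩
    · rw [PMF.bind_bind, ← h₁]
      exact PMF_bind_congr fun p hp => (hκ p hp).1
    · rw [PMF.bind_bind, ← h₂]
      exact PMF_bind_congr fun p hp => (hκ p hp).2.1
    · intro q hq
      rw [PMF.mem_support_bind_iff] at hq
      obtain ⟨p, hp, hq⟩ := hq
      obtain ⟨e₁, e₂, hq'⟩ := hκ p hp
      refine ⟨(hq' q hq).1, ?_⟩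
      intro d hd
      rcases List.mem_cons.1 hd with rfl | hd
      · obtain ⟨v, hv₁, hv₂⟩ := (hν p hp).2
        -- A finer part is supported inside the coarser one, so the value fixed earlier persists.
        exact ⟨v, fun P hP => hv₁ P (mem_support_of_bind e₁ hq hP),
          fun P hP => hv₂ P (mem_support_of_bind e₂ hq hP)⟩
      · exact (hq' q hq).2 d hd

/-- Each constructor of tests has its clause. For observations the distributions are split along all
outputs, after which the observed assignment is constant and one fixed smaller test remains on each
part. -/
theorem IsBisimulation.test {r : PMF (Proto S M.Lit Δ) → PMF (Proto S M.Lit Δ) → Prop}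
    (hr : IsBisimulation M I O r) {f : Proto S M.Lit Δ → ℝ≥0∞} (hf : Test I O f) :
    ∀ {η ε : PMF (Proto S M.Lit Δ)}, r η ε → (∀ P ∈ η.support, P.Typed I O) →
      (∀ P ∈ ε.support, P.Typed I O) → IPDL.expect η f = IPDL.expect ε f := by
  induction hf with
  | one => intros; rw [expect_const, expect_const]
  | sum w hf ih =>
    intro η ε h hη hε
    rw [expect_tsum, expect_tsum]
    exact tsum_congr fun i => by rw [ih i h hη hε]
  | input hi v hf ih =>
    intro η ε h hη hε
    have := ih (hr.input h _ _ hi v) ?_ ?_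
    · rwa [expect_map, expect_map] at this
    · intro P hP
      simp only [PMF.mem_support_map_iff] at hP
      obtain ⟨P, hP, rfl⟩ := hP
      exact (hη P hP).input _ v
    · intro P hP
      simp only [PMF.mem_support_map_iff] at hP
      obtain ⟨P, hP, rfl⟩ := hP
      exact (hε P hP).input _ v
  | eval hf ih =>
    intro η ε h hη hε
    rw [← expect_bind, ← expect_bind]
    refine ih (hr.eval h) ?_ ?_
    · intro P hP
      obtain ⟨Q, hQ, hP⟩ := (PMF.mem_support_bind_iff _ _ _).1 hP
      exact (hη Q hQ).eval_typed P hP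
    · intro P hP
      obtain ⟨Q, hQ, hP⟩ := (PMF.mem_support_bind_iff _ _ _).1 hP
      exact (hε Q hQ).eval_typed P hP
  | @obs F hf ih =>
    intro η ε h hη hε
    have hfin : O.Finite := Set.toFinite O
    obtain ⟨ν, h₁, h₂, hν⟩ := hr.valuations hfin.toFinset.toList (fun c hc => by simpa using hc) h
    rw [← h₁, ← h₂, expect_bind, expect_bind]
    refine expect_congr fun p hp => ?_
    have hη' : ∀ P ∈ p.1.support, P.Typed I O := fun P hP => hη P (mem_support_of_bind h₁ hp hP)
    have hε' : ∀ P ∈ p.2.support, P.Typed I O := fun P hP => hε P (mem_support_of_bind h₂ hp hP)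
    obtain ⟨P₀, hP₀⟩ := p.1.support_nonempty
    -- The split fixes the values on `O`; off `O` there are none, by typing.
    have hv₁ : ∀ P ∈ p.1.support, P.vals = P₀.vals := by
      intro P hP
      funext τ c
      by_cases hc : c.chan ∈ O
      · obtain ⟨v, hv, -⟩ := (hν p hp).2 c.chan (by simpa using hc)
        rw [show P.vals τ c = v from hv P hP, show P₀.vals τ c = v from hv P₀ hP₀]
      · rw [(hη' P hP).vals_eq_none hc, (hη' P₀ hP₀).vals_eq_none hc]
    have hv₂ : ∀ P ∈ p.2.support, P.vals = P₀.vals := by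
      intro P hP
      funext τ c
      by_cases hc : c.chan ∈ O
      · obtain ⟨v, hv, hv'⟩ := (hν p hp).2 c.chan (by simpa using hc)
        rw [show P.vals τ c = v from hv' P hP, show P₀.vals τ c = v from hv P₀ hP₀]
      · rw [(hε' P hP).vals_eq_none hc, (hη' P₀ hP₀).vals_eq_none hc]
    rw [expect_congr (g := F P₀.vals) fun P hP => by rw [hv₁ P hP],
      expect_congr (μ := p.2) (g := F P₀.vals) fun P hP => by rw [hv₂ P hP]]
    exact ih _ (hν p hp).1 hη' hε'
  | congr hf hfg ih =>
    intro η ε h hη hε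
    rw [← expect_congr fun P hP => hfg P (hη P hP), ← expect_congr fun P hP => hfg P (hε P hP)]
    exact ih h hη hε

theorem Interp.SoundEq.testEq {P Q : Proto S (NoVal S) Δ} (h : M.SoundEq I O P Q)
    (hP : P.Typed I O) (hQ : Q.Typed I O) : TestEq (M := M) I O P.lit Q.lit := by
  obtain ⟨r, hr, h⟩ := h
  refine ⟨hP.mapVal _, hQ.mapVal _, fun f hf => ?_⟩
  have := hr.test hf h (by simpa using hP.mapVal _) (by simpa using hQ.mapVal _)
  simpa using this

/-! ### Adversaries -/

/-- A round evaluates the protocol, averages over the draw of the transition function, and then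
gives an input, observes an output, or does nothing. Each of these is a constructor of tests, and
the state of the adversary is a parameter. -/
theorem Adversary.test_play (A : Adversary M Δ I O) (n : ℕ) : ∀ s : ↥A.St,
    Test A.O' (A.φ.toRen.image O) fun P => A.play n (s, P) (some true) := by
  induction n with
  | zero => intro s; exact Test.const (PMF.pure (some (A.dec s)) (some true))
  | succ n ih =>
    intro s
    have hupd : ∀ (q : Option ↥(A.I' ∪ A.O')) (s' : ↥A.St), Test A.O' (A.φ.toRen.image O)
        fun P => A.play n (A.update q s' P) (some true) := by
      intro q s'
      rcases q with _ | c
      · exact ih s'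
      · by_cases hi : c.1 ∈ A.O'
        · cases hv : A.out ⟨c.1, hi⟩ s' with
          | none => simpa [Adversary.update, hi, hv] using ih s'
          | some v =>
            simpa [Adversary.update, hi, hv] using Test.input hi v (ih s')
        -- A query branches on the observed value of the queried channel.
        · refine .congr (.obs (F := fun w P => match w c.1.1 c.1.2 with
            | some v => A.play n (A.inp ⟨c.1, c.2.resolve_right hi⟩ s' v, P) (some true)
            | none => A.play n (s', P) (some true)) fun w => ?_) fun P _ => ?_
          · cases w c.1.1 c.1.2 with
            | none => exact ih _
            | some v => exact ih _
          · simp only [Adversary.update, hi, dite_false, Proto.vals]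
            cases P.valueAt c.1.2 <;> rfl
    have hround : Test A.O' (A.φ.toRen.image O) fun P' =>
        IPDL.expect (A.trans s) fun y => (match y with
          | none => 0
          | some y => A.play n (A.update y.1 y.2 P') (some true)) := by
      refine Test.expect fun y _ => ?_
      rcases y with _ | ⟨q, s'⟩
      · exact Test.const 0
      · exact hupd q s'
    refine .congr (.eval hround) fun P _ => ?_
    simp only [Adversary.play, Adversary.round]
    rw [bind_apply_eq_expect, expect_bind]
    refine expect_congr fun P' _ => ?_
    rw [expect_map]
    refine expect_congr fun y _ => ?_
    rcases y with _ | ⟨q, s'⟩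
    · simp
    · rfl

theorem TestEq.probOne_eq (A : Adversary M Δ I O) {P Q : Proto S (NoVal S) Δ}
    (h : TestEq (M := M) I O P.lit Q.lit) : A.probOne P = A.probOne Q := by
  -- The inputs are cut down from `O'` to the image of `I`, then the test is pulled back along the
  -- embedding.
  have hf := ((A.test_play A.rounds A.start).mono A.image_I_subset
    fun c hc => Set.disjoint_left.1 A.disjoint hc).mapChan A.φ.inj
  rw [Adversary.probOne, Adversary.probOne]
  exact congrArg ENNReal.toReal (h.test _ hf)

end Tests

/-! ## Denotations of reactions -/

/-! ### Distributions on computations that may fail -/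

section OptionBind

variable {X Y Z : Type}

/-- Sequential composition of computations that may fail. -/
noncomputable def obind (p : PMF (Option X)) (k : X → PMF (Option Y)) : PMF (Option Y) :=
  p.bind fun x => x.elim (PMF.pure none) k

@[simp] theorem obind_none (k : X → PMF (Option Y)) :
    obind (PMF.pure none) k = PMF.pure none := by
  simp [obind, PMF.pure_bind]

@[simp] theorem obind_some (x : X) (k : X → PMF (Option Y)) : obind (PMF.pure (some x)) k = k x := by
  simp [obind, PMF.pure_bind]

theorem obind_pure (p : PMF (Option X)) : obind p (fun x => PMF.pure (some x)) = p := by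
  conv_rhs => rw [← PMF.bind_pure p]
  refine PMF_bind_congr fun x _ => ?_
  cases x <;> rfl

theorem bind_obind (p : PMF X) (k : X → PMF (Option Y)) (l : Y → PMF (Option Z)) :
    obind (p.bind k) l = p.bind fun x => obind (k x) l := PMF.bind_bind ..

theorem obind_assoc (p : PMF (Option X)) (k : X → PMF (Option Y)) (l : Y → PMF (Option Z)) :
    obind (obind p k) l = obind p fun x => obind (k x) l := by
  refine (bind_obind p _ l).trans (PMF_bind_congr fun x _ => ?_)
  cases x <;> simp

theorem obind_map_some (p : PMF X) (k : X → PMF (Option Y)) :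
    obind (p.map some) k = p.bind k := by
  rw [obind, PMF.bind_map]
  rfl

/-- Both sides draw from `p` and `q` and fail if either draw fails. Skipping the second draw after a
failure makes no difference, since its total mass is 1. -/
theorem obind_comm (p : PMF (Option X)) (q : PMF (Option Y)) (k : X → Y → PMF (Option Z)) :
    (obind p fun x => obind q (k x)) = obind q fun y => obind p fun x => k x y := by
  have h₁ : (obind p fun x => obind q (k x)) = p.bind fun x => q.bind fun y =>
      x.elim (PMF.pure none) fun x => y.elim (PMF.pure none) (k x) := by
    refine PMF_bind_congr fun x _ => ?_
    cases x with
    | none => simp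
    | some x => rfl
  have h₂ : (obind q fun y => obind p fun x => k x y) = q.bind fun y => p.bind fun x =>
      x.elim (PMF.pure none) fun x => y.elim (PMF.pure none) (k x) := by
    refine PMF_bind_congr fun y _ => ?_
    cases y with
    | none =>
      simp only [Option.elim_none]
      rw [PMF_bind_congr (g := fun _ => PMF.pure none) fun x _ => by cases x <;> rfl, PMF.bind_const]
    | some y => rfl
  rw [h₁, h₂, PMF.bind_comm]

theorem obind_apply_some (p : PMF (Option X)) (k : X → PMF (Option Y)) (y : Y) :
    obind p k (some y) = ∑' x, p (some x) * k x (some y) := by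
  rw [obind, PMF.bind_apply]
  refine ((Option.some_injective X).tsum_eq fun x hx => ?_).symm
  cases x with
  | none => simp [PMF.pure_apply] at hx
  | some x => exact ⟨x, rfl⟩

theorem eq_pure_of_apply_eq_one {p : PMF X} {x : X} (h : p x = 1) : p = PMF.pure x := by
  have hs := (PMF.apply_eq_one_iff p x).1 h
  ext y
  by_cases hy : y = x
  · rw [hy, h, PMF.pure_apply_self]
  · rw [PMF.pure_apply_of_ne _ _ hy, PMF.apply_eq_zero_iff, hs]
    exact hy

end OptionBind

/-! ### The denotation of a reaction relative to channel values -/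

section Denotation

variable {S : Sig} {M : Interp S}

/-- Environments: values for the variables of a context. -/
abbrev Env (M : Interp S) (Γ : S.Ctx) : Type := ∀ τ, Mem Γ τ → M.Lit τ

def Env.cons {Γ : S.Ctx} {σ : S.Typ} (v : M.Lit σ) (γ : Env M Γ) : Env M (σ :: Γ)
  | _, Mem.zero => v
  | _, Mem.succ x => γ _ x

def Env.nil : Env M [] := fun _ x => nomatch x

theorem Env.eq_nil (γ : Env M []) : γ = Env.nil := by
  funext τ x; cases x

theorem Env.cons_lift {Γ Γ' : S.Ctx} {σ : S.Typ} (ρ : Ren Γ Γ') (v : M.Lit σ) (γ : Env M Γ') :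
    (fun τ x => Env.cons v γ τ (ρ.lift τ x)) = Env.cons v fun τ x => γ τ (ρ τ x) := by
  funext τ x; cases x <;> rfl

theorem Expr.eval_rename {Γ Γ' : S.Ctx} {τ : S.Typ} (ρ : Ren Γ Γ') (e : Expr S M.Lit Γ τ)
    (γ : Env M Γ') : (e.rename ρ).eval γ = e.eval fun τ x => γ τ (ρ τ x) := by
  induction e with
  | app f e h => simp [Expr.rename, Expr.eval, h]
  | pair e₁ e₂ h₁ h₂ => exact congrArg₂ Prod.mk h₁ h₂
  | fst e h => simp [Expr.rename, Expr.eval, h]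
  | snd e h => simp [Expr.rename, Expr.eval, h]
  | _ => rfl

theorem Expr.eval_subst {Γ Γ' : S.Ctx} {τ : S.Typ} (θ : Sub S M.Lit Γ Γ') (e : Expr S M.Lit Γ τ)
    (γ : Env M Γ') : (e.subst θ).eval γ = e.eval fun τ x => (θ τ x).eval γ := by
  induction e with
  | app f e h => simp [Expr.subst, Expr.eval, h]
  | pair e₁ e₂ h₁ h₂ => exact congrArg₂ Prod.mk h₁ h₂
  | fst e h => simp [Expr.subst, Expr.eval, h]
  | snd e h => simp [Expr.subst, Expr.eval, h]
  | _ => rfl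

theorem Env.cons_sub_lift {Γ Γ' : S.Ctx} {σ : S.Typ} (θ : Sub S M.Lit Γ Γ') (v : M.Lit σ)
    (γ : Env M Γ') : (fun τ x => ((θ.lift (σ := σ)) τ x).eval (Env.cons v γ)) =
      Env.cons v fun τ x => (θ τ x).eval γ := by
  funext τ x
  cases x with
  | zero => rfl
  | succ x => exact Expr.eval_rename _ _ _

theorem Env.sub_single {Γ : S.Ctx} {σ : S.Typ} (e : Expr S M.Lit Γ σ) (γ : Env M Γ) :
    (fun τ x => (Sub.single e τ x).eval γ) = Env.cons (e.eval γ) γ := by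
  funext τ x; cases x <;> rfl

/-- The distribution of the result of a reaction, if the channels have the values `a`; `none` means
that the reaction waits for a channel without a value. -/
noncomputable def React.den {Δ : S.Ctx} (a : Asg M.Lit Δ) : ∀ {Γ : S.Ctx} {τ : S.Typ},
    React S M.Lit Δ Γ τ → Env M Γ → PMF (Option (M.Lit τ))
  | _, _, .val v, _ => PMF.pure (some v)
  | _, _, .ret e, γ => PMF.pure (some (e.eval γ))
  | _, _, .samp d e, γ => (M.dist d (e.eval γ)).map some
  | _, _, .read c, _ => PMF.pure (a _ c)
  | _, _, .ifte e R₁ R₂, γ =>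
    match e.eval γ with
    | true => R₁.den a γ
    | false => R₂.den a γ
  | _, _, .bind R K, γ => obind (R.den a γ) fun v => K.den a (Env.cons v γ)

variable {Δ Δ' Γ : S.Ctx} {τ : S.Typ}

theorem React.den_assign (R : React S M.Lit Δ Γ τ) (a b : Asg M.Lit Δ) : ∀ γ : Env M Γ,
    (R.assign a).den b γ = R.den (a.or b) γ := by
  induction R with
  | read c =>
    intro γ
    simp only [React.assign, React.den, Asg.or_apply]
    cases h : a _ c <;> simp [React.den]
  | ifte e R₁ R₂ h₁ h₂ => intro γ; simp [React.assign, React.den, h₁, h₂]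
  | bind R K h₁ h₂ => intro γ; simp [React.assign, React.den, h₁, h₂]
  | _ => intros; rfl

theorem React.den_mapChan (φ : Ren Δ Δ') (R : React S M.Lit Δ Γ τ) (a : Asg M.Lit Δ') :
    ∀ γ : Env M Γ, (R.mapChan φ).den a γ = R.den (fun τ c => a τ (φ τ c)) γ := by
  induction R with
  | ifte e R₁ R₂ h₁ h₂ => intro γ; simp [React.mapChan, React.den, h₁, h₂]
  | bind R K h₁ h₂ => intro γ; simp [React.mapChan, React.den, h₁, h₂]
  | _ => intros; rfl

theorem React.den_rename (R : React S M.Lit Δ Γ τ) (a : Asg M.Lit Δ) :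
    ∀ {Γ' : S.Ctx} (ρ : Ren Γ Γ') (γ : Env M Γ'),
      (R.rename ρ).den a γ = R.den a fun τ x => γ τ (ρ τ x) := by
  induction R with
  | ret e => intros; simp [React.rename, React.den, Expr.eval_rename]
  | samp d e => intros; simp [React.rename, React.den, Expr.eval_rename]
  | ifte e R₁ R₂ h₁ h₂ => intros; simp [React.rename, React.den, h₁, h₂, Expr.eval_rename]
  | bind R K h₁ h₂ => intros; simp [React.rename, React.den, h₁, h₂, Env.cons_lift]
  | _ => intros; rfl

theorem React.den_subst (R : React S M.Lit Δ Γ τ) (a : Asg M.Lit Δ) :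
    ∀ {Γ' : S.Ctx} (θ : Sub S M.Lit Γ Γ') (γ : Env M Γ'),
      (R.subst θ).den a γ = R.den a fun τ x => (θ τ x).eval γ := by
  induction R with
  | ret e => intros; simp [React.subst, React.den, Expr.eval_subst]
  | samp d e => intros; simp [React.subst, React.den, Expr.eval_subst]
  | ifte e R₁ R₂ h₁ h₂ => intros; simp [React.subst, React.den, h₁, h₂, Expr.eval_subst]
  | bind R K h₁ h₂ => intros; simp [React.subst, React.den, h₁, h₂, Env.cons_sub_lift]
  | _ => intros; rfl

theorem React.den_inst {σ : S.Typ} (K : React S M.Lit Δ (σ :: Γ) τ) (e : Expr S M.Lit Γ σ)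
    (a : Asg M.Lit Δ) (γ : Env M Γ) : (K.inst e).den a γ = K.den a (Env.cons (e.eval γ) γ) := by
  rw [React.inst, React.den_subst, Env.sub_single]

theorem React.den_weaken {σ : S.Typ} (R : React S M.Lit Δ Γ τ) (v : M.Lit σ) (a : Asg M.Lit Δ)
    (γ : Env M Γ) : (R.weaken (σ := σ)).den a (Env.cons v γ) = R.den a γ := by
  rw [React.weaken, React.den_rename]
  rfl

theorem React.den_stepIn (γ : Env M Γ) (a : Asg M.Lit Δ) (R : React S M.Lit Δ Γ τ) :
    ∀ {η : PMF (React S M.Lit Δ Γ τ)}, R.stepIn γ = some η →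
    R.den a γ = η.bind fun R' => R'.den a γ := by
  induction R with
  | val v => intro η h; simp [React.stepIn] at h
  | ret e =>
    intro η h
    simp only [React.stepIn, Option.some.injEq] at h
    subst h
    rw [PMF.pure_bind]
    rfl
  | samp d e =>
    intro η h
    simp only [React.stepIn, Option.some.injEq] at h
    subst h
    rw [PMF.bind_map]
    rfl
  | read c => intro η h; simp [React.stepIn] at h
  | ifte e R₁ R₂ h₁ h₂ =>
    intro η h
    simp only [React.stepIn] at h
    split at h <;>
    · simp only [Option.some.injEq] at h
      subst h
      rw [PMF.pure_bind, React.den]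
      simp_all only
  | bind R K h₁ h₂ =>
    intro η h
    cases hv : R.value? with
    | some v =>
      rw [React.value?_eq_some hv] at h ⊢
      rw [React.stepIn_bind_val, Option.some.injEq] at h
      subst h
      rw [PMF.pure_bind, React.den_inst, React.den, React.den, obind_some]
      rfl
    | none =>
      rw [React.stepIn_bind γ hv, Option.map_eq_some_iff] at h
      obtain ⟨η', h, rfl⟩ := h
      rw [React.den, h₁ γ h, PMF.bind_map, bind_obind]
      rfl

/-- A stuck reaction is a `read` below left-nested binds, and the empty assignment has no value for
it. -/
theorem React.den_of_stuck (γ : Env M Γ) (R : React S M.Lit Δ Γ τ) (hv : R.value? = none)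
    (hs : R.stepIn γ = none) : R.den Asg.none γ = PMF.pure none := by
  induction R with
  | val v => simp [React.value?] at hv
  | ret e => simp [React.stepIn] at hs
  | samp d e => simp [React.stepIn] at hs
  | read c => rfl
  | ifte e R₁ R₂ h₁ h₂ =>
    simp only [React.stepIn] at hs
    split at hs <;> cases hs
  | bind R K h₁ h₂ =>
    cases hv : R.value? with
    | some v =>
      rw [React.value?_eq_some hv, React.stepIn_bind_val] at hs
      cases hs
    | none =>
      rw [React.stepIn_bind γ hv, Option.map_eq_none_iff] at hs
      rw [React.den, h₁ γ hv hs, obind_none]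

/-- More channel values release more reads, which moves mass from `none` to results and takes none
away. -/
theorem React.den_mono (R : React S M.Lit Δ Γ τ) (a b : Asg M.Lit Δ) : ∀ (γ : Env M Γ)
    (v : M.Lit τ), R.den a γ (some v) ≤ R.den (a.or b) γ (some v) := by
  induction R with
  | read c =>
    intro γ v
    simp only [React.den, Asg.or_apply]
    cases h : a _ c with
    | none => simp [PMF.pure_apply]
    | some w => simp
  | ifte e R₁ R₂ h₁ h₂ =>
    intro γ v
    simp only [React.den]
    split
    · exact h₁ γ v
    · exact h₂ γ v
  | bind R K h₁ h₂ =>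
    intro γ v
    simp only [React.den, obind_apply_some]
    exact ENNReal.tsum_le_tsum fun w => mul_le_mul' (h₁ γ w) (h₂ _ v)
  | _ => intros; exact le_rfl

/-- A result that has probability 1 cannot gain, and by monotonicity cannot lose. -/
theorem React.den_eq_pure_mono {R : React S M.Lit Δ Γ τ} {a : Asg M.Lit Δ} {γ : Env M Γ}
    {v : M.Lit τ} (h : R.den a γ = PMF.pure (some v)) (b : Asg M.Lit Δ) :
    R.den (a.or b) γ = PMF.pure (some v) := by
  refine eq_pure_of_apply_eq_one (le_antisymm (PMF.coe_le_one _ _) ?_)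
  have := R.den_mono a b γ v
  rwa [h, PMF.pure_apply_self] at this

theorem React.den_exch {σ₁ σ₂ : S.Typ} (R₁ : React S M.Lit Δ Γ σ₁) (R₂ : React S M.Lit Δ Γ σ₂)
    (K : React S M.Lit Δ (σ₂ :: σ₁ :: Γ) τ) (a : Asg M.Lit Δ) (γ : Env M Γ) :
    (React.bind R₁ (.bind R₂.weaken K)).den a γ =
      (React.bind R₂ (.bind R₁.weaken (K.rename Ren.swap))).den a γ := by
  have h : ∀ (v : M.Lit σ₁) (w : M.Lit σ₂), (K.rename Ren.swap).den a (Env.cons v (Env.cons w γ)) =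
      K.den a (Env.cons w (Env.cons v γ)) := by
    intro v w
    rw [React.den_rename]
    congr 1
    funext ρ x
    rcases x with _ | (_ | x) <;> rfl
  simp only [React.den, React.den_weaken, h]
  exact obind_comm _ _ _

/-! ### Soundness of the equality of reactions -/

theorem Expr.mapVal_rename {V W : S.Typ → Type} (f : ∀ τ, V τ → W τ) {Γ' : S.Ctx} (ρ : Ren Γ Γ')
    (e : Expr S V Γ τ) : (e.rename ρ).mapVal f = (e.mapVal f).rename ρ := by
  induction e with
  | app f e h => simp [Expr.rename, Expr.mapVal, h]
  | pair e₁ e₂ h₁ h₂ => simp [Expr.rename, Expr.mapVal, h₁, h₂]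
  | fst e h => simp [Expr.rename, Expr.mapVal, h]
  | snd e h => simp [Expr.rename, Expr.mapVal, h]
  | _ => rfl

theorem Expr.mapVal_subst {V W : S.Typ → Type} (f : ∀ τ, V τ → W τ) {Γ' : S.Ctx}
    (θ : Sub S V Γ Γ') (e : Expr S V Γ τ) :
    (e.subst θ).mapVal f = (e.mapVal f).subst fun τ x => (θ τ x).mapVal f := by
  induction e with
  | app f e h => simp [Expr.subst, Expr.mapVal, h]
  | pair e₁ e₂ h₁ h₂ => simp [Expr.subst, Expr.mapVal, h₁, h₂]
  | fst e h => simp [Expr.subst, Expr.mapVal, h]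
  | snd e h => simp [Expr.subst, Expr.mapVal, h]
  | _ => rfl

theorem Sub.mapVal_lift {V W : S.Typ → Type} (f : ∀ τ, V τ → W τ) {Γ' : S.Ctx} {σ : S.Typ}
    (θ : Sub S V Γ Γ') : (fun τ x => ((θ.lift (σ := σ)) τ x).mapVal f) =
      Sub.lift fun τ x => (θ τ x).mapVal f := by
  funext τ x
  cases x with
  | zero => rfl
  | succ x => exact Expr.mapVal_rename f _ _

theorem Sub.mapVal_single {V W : S.Typ → Type} (f : ∀ τ, V τ → W τ) {σ : S.Typ}
    (e : Expr S V Γ σ) : (fun τ x => (Sub.single e τ x).mapVal f) = Sub.single (e.mapVal f) := by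
  funext τ x; cases x <;> rfl

theorem React.mapVal_rename {V W : S.Typ → Type} (f : ∀ τ, V τ → W τ) (R : React S V Δ Γ τ) :
    ∀ {Γ' : S.Ctx} (ρ : Ren Γ Γ'), (R.rename ρ).mapVal f = (R.mapVal f).rename ρ := by
  induction R with
  | ret e => intros; simp [React.rename, React.mapVal, Expr.mapVal_rename]
  | samp d e => intros; simp [React.rename, React.mapVal, Expr.mapVal_rename]
  | ifte e R₁ R₂ h₁ h₂ => intros; simp [React.rename, React.mapVal, Expr.mapVal_rename, h₁, h₂]
  | bind R K h₁ h₂ => intros; simp [React.rename, React.mapVal, h₁, h₂]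
  | _ => intros; rfl

theorem React.mapVal_subst {V W : S.Typ → Type} (f : ∀ τ, V τ → W τ) (R : React S V Δ Γ τ) :
    ∀ {Γ' : S.Ctx} (θ : Sub S V Γ Γ'),
      (R.subst θ).mapVal f = (R.mapVal f).subst fun τ x => (θ τ x).mapVal f := by
  induction R with
  | ret e => intros; simp [React.subst, React.mapVal, Expr.mapVal_subst]
  | samp d e => intros; simp [React.subst, React.mapVal, Expr.mapVal_subst]
  | ifte e R₁ R₂ h₁ h₂ => intros; simp [React.subst, React.mapVal, Expr.mapVal_subst, h₁, h₂]
  | bind R K h₁ h₂ => intros; simp [React.subst, React.mapVal, h₁, h₂, Sub.mapVal_lift]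
  | _ => intros; rfl

theorem React.mapVal_inst {V W : S.Typ → Type} (f : ∀ τ, V τ → W τ) {σ : S.Typ}
    (K : React S V Δ (σ :: Γ) τ) (e : Expr S V Γ σ) :
    (K.inst e).mapVal f = (K.mapVal f).inst (e.mapVal f) := by
  rw [React.inst, React.mapVal_subst, Sub.mapVal_single]

/-- An expression without literals, seen in the augmented syntax. -/
abbrev Expr.lit (e : Expr S (NoVal S) Γ τ) : Expr S M.Lit Γ τ := e.mapVal fun _ v => v.elim

/-- A reaction without literals, seen in the augmented syntax. -/
abbrev React.lit (R : React S (NoVal S) Δ Γ τ) : React S M.Lit Δ Γ τ :=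
  R.mapVal fun _ v => v.elim

theorem ExprEq.eval {e e' : Expr S (NoVal S) Γ τ} (h : ExprEq e e') : ∀ γ : Env M Γ,
    (e.lit (M := M)).eval γ = (e'.lit (M := M)).eval γ := by
  induction h with
  | refl e => intro γ; rfl
  | symm h ih => intro γ; exact (ih γ).symm
  | trans h h' ih ih' => intro γ; exact (ih γ).trans (ih' γ)
  | subst θ h ih =>
    intro γ
    rw [Expr.lit, Expr.lit, Expr.mapVal_subst, Expr.mapVal_subst, Expr.eval_subst, Expr.eval_subst]
    exact ih _
  | congApp f h ih => intro γ; exact congrArg (M.fn f) (ih γ)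
  | congPair h h' ih ih' => intro γ; exact congrArg₂ Prod.mk (ih γ) (ih' γ)
  | congFst h ih => intro γ; exact congrArg Prod.fst (ih γ)
  | congSnd h ih => intro γ; exact congrArg Prod.snd (ih γ)
  | unitExt e => intro γ; rfl
  | fstPair e₁ e₂ => intro γ; rfl
  | sndPair e₁ e₂ => intro γ; rfl
  | pairExt e => intro γ; rfl

/-- Every rule is an identity between distributions on `Option`. Exchange is `obind_comm`, an unused
sampling may be discarded because sampling never fails, and repeated reads agree because the channel
values are fixed. -/
theorem ReactEq.den {I : Set (Chan Δ)} {R R' : React S (NoVal S) Δ Γ τ} (h : ReactEq I R R') :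
    ∀ (a : Asg M.Lit Δ) (γ : Env M Γ), (R.lit (M := M)).den a γ = (R'.lit (M := M)).den a γ := by
  induction h with
  | refl hR => intro a γ; rfl
  | symm h ih => intro a γ; exact (ih a γ).symm
  | trans h h' ih ih' => intro a γ; exact (ih a γ).trans (ih' a γ)
  | inputUnused c hc h ih => exact ih
  | subst θ h ih =>
    intro a γ
    rw [React.lit, React.lit, React.mapVal_subst, React.mapVal_subst, React.den_subst,
      React.den_subst]
    exact ih a _
  | embed φ h ih =>
    intro a γ
    rw [React.lit, React.lit, React.mapChan_mapVal, React.mapChan_mapVal, React.den_mapChan,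
      React.den_mapChan]
    exact ih _ γ
  | congRet h => intro a γ; exact congrArg (fun v => PMF.pure (some v)) (h.eval γ)
  | congSamp d h => intro a γ; exact congrArg (fun v => (M.dist d v).map some) (h.eval γ)
  | congIf h h₁ h₂ ih₁ ih₂ =>
    intro a γ
    simp only [React.lit, React.mapVal, React.den]
    have he := h.eval (M := M) γ
    simp only [Expr.lit] at he
    rw [he, ih₁, ih₂]
  | congBind h h' ih ih' =>
    intro a γ
    simp only [React.lit, React.mapVal, React.den]
    rw [ih]
    congr 1
    funext v
    exact ih' a _
  | retBind e hK =>
    intro a γ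
    rw [React.lit, React.lit, React.mapVal_inst, React.den_inst]
    simp [React.mapVal, React.den]
  | bindRet hR => intro a γ; exact obind_pure _
  | bindBind h₁ h₂ hK =>
    intro a γ
    simp only [React.lit, React.mapVal, React.den, obind_assoc, React.mapVal_rename,
      React.den_rename, Env.cons_lift]
    rfl
  | exch h₁ h₂ hK =>
    intro a γ
    simp only [React.lit, React.weaken, React.mapVal, React.mapVal_rename]
    exact React.den_exch _ _ _ a γ
  | sampPure d e hR =>
    intro a γ
    simp only [React.lit, React.weaken, React.mapVal, React.mapVal_rename, React.den,
      obind_map_some]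
    exact (PMF_bind_congr fun v _ => React.den_weaken _ v a γ).trans (PMF.bind_const _ _)
  | @readDet _ _ _ _ _ c K hc hK =>
    intro a γ
    simp only [React.lit, React.mapVal, React.mapVal_inst, React.den]
    cases h : a _ c with
    | none => simp
    | some v =>
      simp only [obind_some]
      rw [React.den_inst]
      rfl
  | ifLeft h₁ h₂ => intro a γ; simp [React.lit, React.mapVal, React.den, Expr.mapVal, Expr.eval]
  | ifRight h₁ h₂ => intro a γ; simp [React.lit, React.mapVal, React.den, Expr.mapVal, Expr.eval]
  | @ifExt _ _ _ _ e K hK =>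
    intro a γ
    rw [React.lit, React.lit, React.mapVal, React.mapVal_inst, React.mapVal_inst,
      React.mapVal_inst, React.den, React.den_inst, React.den_inst, React.den_inst]
    cases h : (e.mapVal (W := M.Lit) fun _ v => v.elim).eval γ <;> simp [Expr.mapVal, Expr.eval]

end Denotation

/-! ## Protocols with one output -/

section OneOutput

variable {S : Sig} {M : Interp S} {Δ : S.Ctx} {I O : Set (Chan Δ)} {τ : S.Typ}

theorem Red.vals_of_some {P : Proto S M.Lit Δ} {μ : PMF (Proto S M.Lit Δ)} (hP : P.Typed I O)
    (h : Red P μ) {o : Mem Δ τ} {v : M.Lit τ} (hv : P.vals τ o = some v) :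
    ∀ Q ∈ μ.support, Q.vals τ o = some v := by
  rcases h with h | ⟨_, _, _, _, h, rfl⟩
  · intro Q hQ
    rw [h.vals hP Q hQ, hv]
  · simp [h.vals hP, hv]

theorem Proto.Typed.eval_vals_of_some {P : Proto S M.Lit Δ} (hP : P.Typed I O) {o : Mem Δ τ}
    {v : M.Lit τ} (hv : P.vals τ o = some v) : ∀ Q ∈ P.eval.support, Q.vals τ o = some v :=
  fun Q hQ => (hP.eval_support (fun P => P.vals τ o = some v) hv
    (fun _ _ hP hv h => h.vals_of_some hP hv) Q hQ).1

theorem Proto.Typed.vals_ext {o : Mem Δ τ} {P Q : Proto S M.Lit Δ} (hP : P.Typed I {o.chan})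
    (hQ : Q.Typed I {o.chan}) (h : P.vals τ o = Q.vals τ o) : P.vals = Q.vals := by
  funext σ c
  by_cases hc : c.chan = o.chan
  · cases hc; exact h
  · rw [hP.vals_eq_none hc, hQ.vals_eq_none hc]

/-- Once the only output is there it never changes, so nothing is left to observe. -/
theorem TestEq.of_finished {o : Mem Δ τ} {v : M.Lit τ} {P Q : Proto S M.Lit Δ}
    (hP : P.Typed I {o.chan}) (hQ : Q.Typed I {o.chan}) (hPv : P.vals τ o = some v)
    (hQv : Q.vals τ o = some v) : TestEq I {o.chan} P Q := by
  refine TestEq.coinduct (fun P Q => P.Typed I {o.chan} ∧ Q.Typed I {o.chan} ∧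
    P.vals τ o = some v ∧ Q.vals τ o = some v) ?_ ?_ ?_ ?_ ⟨hP, hQ, hPv, hQv⟩
  · rintro P Q ⟨hP, hQ, -, -⟩
    exact ⟨hP, hQ⟩
  · rintro P Q ⟨hP, hQ, hPv, hQv⟩
    exact hP.vals_ext hQ (hPv.trans hQv.symm)
  · rintro P Q ⟨hP, hQ, hPv, hQv⟩ σ i w hi f hf ih
    exact ih _ _ ⟨hP.input i w, hQ.input i w, by rw [Proto.vals_assign, hPv],
      by rw [Proto.vals_assign, hQv]⟩
  · rintro P Q ⟨hP, hQ, hPv, hQv⟩ f hf ih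
    exact expect_const_congr fun P' hP' Q' hQ' => ih _ _ ⟨hP.eval_typed P' hP', hQ.eval_typed Q' hQ',
      hP.eval_vals_of_some hPv P' hP', hQ.eval_vals_of_some hQv Q' hQ'⟩

open scoped Classical in
/-- The probability that a protocol puts the value `v` on the channel `o`. -/
noncomputable def Proto.outProb (P : Proto S M.Lit Δ) (o : Mem Δ τ) (v : M.Lit τ) : ℝ≥0∞ :=
  expect P.eval fun P' => if P'.vals τ o = some v then 1 else 0

open scoped Classical in
theorem Proto.outProb_of_some {P : Proto S M.Lit Δ} (hP : P.Typed I O) {o : Mem Δ τ} {v w : M.Lit τ}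
    (hv : P.vals τ o = some v) : P.outProb o w = if v = w then 1 else 0 := by
  rw [Proto.outProb, expect_congr (g := fun _ => if v = w then 1 else 0), expect_const]
  intro Q hQ
  rw [hP.eval_vals_of_some hv Q hQ]
  simp

/-- A weighted family of protocols that have not produced an output yet. -/
structure Pending (I O : Set (Chan Δ)) {ι : Type} (η : ι → ℝ≥0∞) (p : ι → Proto S M.Lit Δ) :
    Prop where
  finite : ∑' i, η i ≠ ⊤
  typed : ∀ i, η i ≠ 0 → (p i).Typed I O
  vals : ∀ i, η i ≠ 0 → (p i).vals = Asg.none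

theorem tsum_weight_congr {ι : Type} {η : ι → ℝ≥0∞} {f g : ι → ℝ≥0∞}
    (h : ∀ i, η i ≠ 0 → f i = g i) : ∑' i, η i * f i = ∑' i, η i * g i := by
  refine tsum_congr fun i => ?_
  by_cases hi : η i = 0
  · rw [hi, zero_mul, zero_mul]
  · rw [h i hi]

open scoped Classical in
/-- The weights of the protocols without an output after an evaluation. -/
noncomputable def evalWeight {ι : Type} (o : Mem Δ τ) (η : ι → ℝ≥0∞) (p : ι → Proto S M.Lit Δ)
    (x : ι × Proto S M.Lit Δ) : ℝ≥0∞ :=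
  if x.2.vals τ o = none then η x.1 * (p x.1).eval x.2 else 0

open scoped Classical in
-- The runs are split according to whether the evaluation has produced the output. On the finished
-- ones `f` depends only on the value, so they enter only through the output probabilities.
theorem Pending.tsum_expect {o : Mem Δ τ} {ι : Type} {η : ι → ℝ≥0∞} {p : ι → Proto S M.Lit Δ}
    (h : Pending I {o.chan} η p) {f : Proto S M.Lit Δ → ℝ≥0∞} {ψ : M.Lit τ → ℝ≥0∞}
    (hf : ∀ P : Proto S M.Lit Δ, P.Typed I {o.chan} → ∀ v, P.vals τ o = some v → f P = ψ v) :
    ∑' i, η i * expect (p i).eval f =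
      (∑' x, evalWeight o η p x * f x.2) + ∑' v, ψ v * ∑' i, η i * (p i).outProb o v := by
  have h₁ : ∀ i, η i ≠ 0 → expect (p i).eval f =
      (∑' P, (if P.vals τ o = none then (p i).eval P else 0) * f P) +
        ∑' v, ψ v * (p i).outProb o v := by
    intro i hi
    simp only [Proto.outProb]
    rw [← expect_tsum, expect, expect, ← ENNReal.tsum_add]
    refine tsum_congr fun P => ?_
    by_cases hP : P ∈ (p i).eval.support
    · cases hv : P.vals τ o with
      | none => simp
      | some v =>
        rw [hf P ((h.typed i hi).eval_typed P hP) v hv, tsum_eq_single v]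
        · simp
        · intro w hw
          simp [Ne.symm hw]
    · simp [(PMF.apply_eq_zero_iff _ _).2 hP]
  rw [tsum_weight_congr h₁]
  simp only [mul_add]
  rw [ENNReal.tsum_add, ENNReal.tsum_prod']
  congr 1
  · refine tsum_congr fun i => ?_
    rw [← ENNReal.tsum_mul_left]
    refine tsum_congr fun P => ?_
    rw [evalWeight]
    split_ifs <;> simp [mul_assoc]
  · simp only [← ENNReal.tsum_mul_left]
    rw [ENNReal.tsum_comm]
    refine tsum_congr fun v => tsum_congr fun i => ?_
    rw [mul_left_comm]

theorem Proto.outProb_assign_eq {o : Mem Δ τ} {P : Proto S M.Lit Δ} (hP : P.Typed I {o.chan})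
    {a : Asg M.Lit Δ} (ha : a τ o = none) (v : M.Lit τ) :
    (P.assign a).outProb o v = expect P.eval fun P' => (P'.assign a).outProb o v := by
  rw [Proto.outProb, hP.eval_assign (by rintro c rfl; exact ha), expect_bind]
  rfl

theorem Pending.evalWeight {o : Mem Δ τ} {ι : Type} {η : ι → ℝ≥0∞} {p : ι → Proto S M.Lit Δ}
    (h : Pending I {o.chan} η p) : Pending I {o.chan} (evalWeight o η p) Prod.snd := by
  have hne : ∀ x, IPDL.evalWeight o η p x ≠ 0 → x.2.vals τ o = none ∧ x.2.Typed I {o.chan} := by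
    intro x hx
    rw [IPDL.evalWeight] at hx
    split_ifs at hx with hv
    · refine ⟨hv, (h.typed x.1 (left_ne_zero_of_mul hx)).eval_typed _ ?_⟩
      exact (PMF.mem_support_iff _ _).2 (right_ne_zero_of_mul hx)
    · exact absurd rfl hx
  refine ⟨?_, fun x hx => (hne x hx).2, fun x hx => ?_⟩
  -- For `f = 1` the decomposition bounds the remaining weight by the old one.
  · have := h.tsum_expect (f := fun _ => 1) (ψ := fun _ => 1) fun _ _ _ _ => rfl
    simp only [expect_const, mul_one, one_mul] at this
    refine ne_top_of_le_ne_top h.finite ?_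
    rw [this]
    exact le_self_add
  · funext σ c
    by_cases hc : c.chan = o.chan
    · cases hc; exact (hne x hx).1
    · exact (hne x hx).2.vals_eq_none hc

theorem Pending.sum_eval {o : Mem Δ τ} {ι κ : Type} {η : ι → ℝ≥0∞} {p : ι → Proto S M.Lit Δ}
    {ε : κ → ℝ≥0∞} {q : κ → Proto S M.Lit Δ} (hη : Pending I {o.chan} η p)
    (hε : Pending I {o.chan} ε q)
    (hout : ∀ v, ∑' i, η i * (p i).outProb o v = ∑' j, ε j * (q j).outProb o v)
    {f : Proto S M.Lit Δ → ℝ≥0∞} {ψ : M.Lit τ → ℝ≥0∞}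
    (hf : ∀ P : Proto S M.Lit Δ, P.Typed I {o.chan} → ∀ v, P.vals τ o = some v → f P = ψ v) :
    (∑' x, IPDL.evalWeight o η p x * f x.2 = ∑' x, IPDL.evalWeight o ε q x * f x.2) →
    ∑' i, η i * expect (p i).eval f = ∑' j, ε j * expect (q j).eval f := by
  intro h
  rw [hη.tsum_expect hf, hε.tsum_expect hf, h]
  simp only [hout]

/-- The converse of `Pending.sum_eval`: the shares of the finished runs agree by `hout` and are
cancelled. The bound on `f` and the finite total weight make them finite. -/
theorem Pending.sum_evalWeight {o : Mem Δ τ} {ι κ : Type} {η : ι → ℝ≥0∞}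
    {p : ι → Proto S M.Lit Δ} {ε : κ → ℝ≥0∞} {q : κ → Proto S M.Lit Δ}
    (hη : Pending I {o.chan} η p) (hε : Pending I {o.chan} ε q)
    (hout : ∀ v, ∑' i, η i * (p i).outProb o v = ∑' j, ε j * (q j).outProb o v)
    {f : Proto S M.Lit Δ → ℝ≥0∞} (hfb : ∀ P, f P ≤ 1) {ψ : M.Lit τ → ℝ≥0∞}
    (hf : ∀ P : Proto S M.Lit Δ, P.Typed I {o.chan} → ∀ v, P.vals τ o = some v → f P = ψ v)
    (h : ∑' i, η i * expect (p i).eval f = ∑' j, ε j * expect (q j).eval f) :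
    ∑' x, IPDL.evalWeight o η p x * f x.2 = ∑' x, IPDL.evalWeight o ε q x * f x.2 := by
  have hle : ∑' i, η i * expect (p i).eval f ≤ ∑' i, η i := by
    refine ENNReal.tsum_le_tsum fun i => ?_
    calc η i * expect (p i).eval f ≤ η i * expect (p i).eval fun _ => 1 :=
          mul_le_mul_right (ENNReal.tsum_le_tsum fun P => mul_le_mul_right (hfb P) _) _
      _ = η i := by rw [expect_const, mul_one]
  have hfin := ne_top_of_le_ne_top hη.finite hle
  rw [hη.tsum_expect hf] at hfin h
  rw [hε.tsum_expect hf] at h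
  simp only [← hout] at h
  exact (ENNReal.add_left_inj (ne_top_of_le_ne_top hfin le_add_self)).1 h

/-- For protocols with one output, the distributions of the output for all inputs determine the
results of all tests. -/
theorem Test.sum_eq_of_outProb {o : Mem Δ τ} {f : Proto S M.Lit Δ → ℝ≥0∞}
    (hf : Test I {o.chan} f) : ∀ {ι κ : Type} {η : ι → ℝ≥0∞} {p : ι → Proto S M.Lit Δ}
    {ε : κ → ℝ≥0∞} {q : κ → Proto S M.Lit Δ}, Pending I {o.chan} η p → Pending I {o.chan} ε q →
    (∑' i, η i = ∑' j, ε j) →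
    (∀ a : Asg M.Lit Δ, a τ o = none → ∀ v, ∑' i, η i * ((p i).assign a).outProb o v =
      ∑' j, ε j * ((q j).assign a).outProb o v) →
    ∑' i, η i * f (p i) = ∑' j, ε j * f (q j) := by
  induction hf with
  | one => intro ι κ η p ε q hη hε ht hout; simpa using ht
  | sum w hf ih =>
    intro ι κ η p ε q hη hε ht hout
    simp only [← ENNReal.tsum_mul_left]
    rw [ENNReal.tsum_comm]
    conv_rhs => rw [ENNReal.tsum_comm]
    refine tsum_congr fun k => ?_
    simp only [mul_left_comm _ (w k)]
    rw [ENNReal.tsum_mul_left, ENNReal.tsum_mul_left, ih k hη hε ht hout]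
  | @input σ i hi v f hf ih =>
    intro ι κ η p ε q hη hε ht hout
    refine ih (p := fun k => (p k).input i v) (q := fun k => (q k).input i v)
      ⟨hη.finite, fun k hk => (hη.typed k hk).input i v,
        fun k hk => by rw [Proto.vals_assign, hη.vals k hk]⟩
      ⟨hε.finite, fun k hk => (hε.typed k hk).input i v,
        fun k hk => by rw [Proto.vals_assign, hε.vals k hk]⟩ ht fun a ha w => ?_
    -- An input on the output channel contradicts the typing of any member, so in that case all
    -- weights vanish.
    by_cases hio : i.chan = o.chan
    · have h₀ : ∀ k, η k = 0 := fun k => by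
        by_contra hk
        exact (hη.typed k hk).disjoint o.chan rfl (hio ▸ hi)
      have h₀' : ∀ k, ε k = 0 := fun k => by
        by_contra hk
        exact (hε.typed k hk).disjoint o.chan rfl (hio ▸ hi)
      simp [h₀, h₀']
    · simp only [Proto.assign_or]
      exact hout _ (by simp [ha, Asg.single_ne hio]) w
  | @eval f hf ih =>
    intro ι κ η p ε q hη hε ht hout
    -- All finished protocols with the value `v` pass the same tests as `done o v`, which provides
    -- `ψ`.
    have hψ : ∀ P : Proto S M.Lit Δ, P.Typed I {o.chan} → ∀ v, P.vals τ o = some v →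
        f P = f (.done o v) := fun P hP v hv =>
      (TestEq.of_finished hP (.done (hP.disjoint _ rfl)) hv
        (show (Proto.done o v).vals τ o = some v from Asg.single_self o v)).test f hf
    have hout₀ : ∀ v, ∑' i, η i * (p i).outProb o v = ∑' j, ε j * (q j).outProb o v := by
      intro v
      simpa only [Proto.assign_none] using hout Asg.none rfl v
    refine hη.sum_eval hε hout₀ hψ (ih hη.evalWeight hε.evalWeight ?_ fun a ha v => ?_)
    · have := hη.sum_evalWeight hε hout₀ (f := fun _ => 1) (fun _ => le_rfl) (ψ := fun _ => 1)
        (fun _ _ _ _ => rfl) (by simpa only [expect_const, mul_one] using ht)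
      simpa only [mul_one] using this
    · classical
      -- The output probabilities under `a` can be computed with an evaluation before the
      -- assignment. Runs finished by then contribute equally on both sides; subtracting them leaves
      -- the hypothesis for the families that are still pending.
      refine hη.sum_evalWeight hε hout₀ (f := fun P => (P.assign a).outProb o v) (fun P => ?_)
        (ψ := fun w => if w = v then 1 else 0) (fun P hP w hw => ?_) ?_
      · refine le_trans ?_ (expect_const (P.assign a).eval 1).le
        refine ENNReal.tsum_le_tsum fun P' => mul_le_mul_right ?_ _
        beta_reduce
        split_ifs <;> simp
      · rw [Proto.outProb_of_some (hP.assign' a) (v := w) (by rw [Proto.vals_assign, hw])]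
      · rw [← tsum_weight_congr fun i hi => Proto.outProb_assign_eq (hη.typed i hi) ha v,
          ← tsum_weight_congr fun i hi => Proto.outProb_assign_eq (hε.typed i hi) ha v]
        exact hout a ha v
  | @obs F hf ih =>
    intro ι κ η p ε q hη hε ht hout
    rw [tsum_weight_congr (g := fun i => F Asg.none (p i)) fun i hi => by
      beta_reduce; rw [hη.vals i hi],
      tsum_weight_congr (η := ε) (g := fun i => F Asg.none (q i)) fun i hi => by
      beta_reduce; rw [hε.vals i hi]]
    exact ih _ hη hε ht hout
  | congr hf hfg ih =>
    intro ι κ η p ε q hη hε ht hout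
    rw [← tsum_weight_congr fun i hi => hfg _ (hη.typed i hi),
      ← tsum_weight_congr fun i hi => hfg _ (hε.typed i hi)]
    exact ih hη hε ht hout

theorem TestEq.of_outProb {o : Mem Δ τ} {P Q : Proto S M.Lit Δ} (hP : P.Typed I {o.chan})
    (hQ : Q.Typed I {o.chan}) (hPv : P.vals = Asg.none) (hQv : Q.vals = Asg.none)
    (h : ∀ a : Asg M.Lit Δ, a τ o = none → ∀ v,
      (P.assign a).outProb o v = (Q.assign a).outProb o v) : TestEq I {o.chan} P Q := by
  refine ⟨hP, hQ, fun f hf => ?_⟩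
  have := hf.sum_eq_of_outProb (ι := Unit) (κ := Unit) (η := fun _ => 1) (ε := fun _ => 1)
    (p := fun _ => P) (q := fun _ => Q) ⟨by simp, fun _ _ => hP, fun _ _ => hPv⟩
    ⟨by simp, fun _ _ => hQ, fun _ _ => hQv⟩ rfl (by simpa using h)
  simpa using this

/-- The denotation is invariant under steps and is `none` on stuck reactions. The empty assignment
is the right one, as received inputs have already been substituted into `R`, and its own channel has
no value while it runs. -/
theorem React.outProb {I : Set (Chan Δ)} {o : Mem Δ τ} (ho : o.chan ∉ I) (v : M.Lit τ)
    {R : React S M.Lit Δ [] τ} (hR : R.ReadsIn (I ∪ {o.chan})) :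
    (Proto.react o R).outProb o v = R.den Asg.none Env.nil (some v) := by
  induction hn : R.size using Nat.strong_induction_on generalizing R with
  | _ n ih =>
    subst hn
    have hstep : R.step = R.stepIn Env.nil := congrArg (React.stepIn · R) (Env.eq_nil _)
    cases hv : R.value? with
    | some w =>
      classical
      rw [React.value?_eq_some hv, Proto.outProb, Red.eval (.react (I := I) (R := .val w) ho trivial)
        (OutStep.react o w).red, PMF.pure_bind, Proto.Halted.eval (P := .done o w) trivial,
        expect_pure]
      rw [show (Proto.done o w).vals τ o = some w from Asg.single_self o w]
      simp [React.den, PMF.pure_apply, eq_comm]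
    | none =>
      cases hs : R.step with
      | none =>
        rw [React.den_of_stuck _ R hv (hstep ▸ hs), Proto.outProb,
          Proto.Halted.eval (P := .react o R) ⟨hv, hs⟩, expect_pure]
        rw [show (Proto.react o R).vals τ o = none from rfl]
        simp
      | some η =>
        rw [React.den_stepIn _ Asg.none R (hstep ▸ hs), Proto.outProb, Red.eval (.react (I := I) ho hR)
          (Step.react o hs).red, expect_bind, expect_map, bind_apply_eq_expect]
        exact expect_congr fun R' hR' => ih R'.size (R.size_stepIn _ _ hs R' hR')
          (React.readsIn_stepIn _ R hs hR R' hR') rfl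

/-- Reactions with the same denotation give rise to assignments that pass the same tests. -/
theorem TestEq.react {I : Set (Chan Δ)} {o : Mem Δ τ} (ho : o.chan ∉ I)
    {R R' : React S M.Lit Δ [] τ} (hR : R.ReadsIn (I ∪ {o.chan})) (hR' : R'.ReadsIn (I ∪ {o.chan}))
    (h : ∀ a : Asg M.Lit Δ, a τ o = none → R.den a Env.nil = R'.den a Env.nil) :
    TestEq I {o.chan} (.react o R) (.react o R') := by
  refine TestEq.of_outProb (.react ho hR) (.react ho hR') rfl rfl fun a ha v => ?_
  have hsub : {c | c ∈ I ∪ {o.chan} ∧ a c.1 c.2 = none} ⊆ I ∪ {o.chan} := fun c hc => hc.1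
  rw [Proto.assign, Proto.assign, React.outProb ho v ((hR.assign a).mono hsub),
    React.outProb ho v ((hR'.assign a).mono hsub), React.den_assign, React.den_assign,
    Asg.or_none, h a ha]

end OneOutput

/-! ## Structural rules -/

section Structural

variable {S : Sig} {M : Interp S} {Δ : S.Ctx} {I O O₁ O₂ O₃ : Set (Chan Δ)}

theorem Proto.Typed.vals_or_comm {P Q : Proto S M.Lit Δ} (hP : P.Typed (I ∪ O₂) O₁)
    (hQ : Q.Typed (I ∪ O₁) O₂) : P.vals.or Q.vals = Q.vals.or P.vals := by
  refine Asg.or_comm fun τ c => ?_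
  by_cases hc : c.chan ∈ O₁
  · exact .inr (hQ.vals_eq_none fun h => hP.disjoint _ hc (.inr h))
  · exact .inl (hP.vals_eq_none hc)

/-- Each step is matched by its mirror image. The next rules follow the same pattern, with the
evident syntactic relation as simulation. -/
theorem TestEq.par_comm {P Q : Proto S M.Lit Δ} (hP : P.Typed (I ∪ O₂) O₁)
    (hQ : Q.Typed (I ∪ O₁) O₂) : TestEq I (O₁ ∪ O₂) (.par P Q) (.par Q P) := by
  let r : Proto S M.Lit Δ → Proto S M.Lit Δ → Prop := fun X Y => ∃ A B,
    A.Typed (I ∪ O₂) O₁ ∧ B.Typed (I ∪ O₁) O₂ ∧ X = .par A B ∧ Y = .par B A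
  have htyped : ∀ X Y, r X Y → X.Typed I (O₁ ∪ O₂) ∧ Y.Typed I (O₁ ∪ O₂) := by
    rintro _ _ ⟨A, B, hA, hB, rfl, rfl⟩
    exact ⟨.par hA hB, by rw [Set.union_comm]; exact .par hB hA⟩
  refine TestEq.of_sim r htyped ?_ ?_ ?_ ?_ ⟨P, Q, hP, hQ, rfl, rfl⟩
  · rintro _ _ ⟨A, B, hA, hB, rfl, rfl⟩
    rw [Proto.vals_par, Proto.vals_par, hA.vals_or_comm hB]
  · rintro _ _ ⟨A, B, hA, hB, rfl, rfl⟩ σ i v hi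
    exact ⟨_, _, hA.input i v, hB.input i v, rfl, rfl⟩
  · rintro _ _ ⟨A, B, hA, hB, rfl, rfl⟩ hh
    exact ⟨hh.2, hh.1⟩
  · intro _ _ h μ hμ
    have ht := (htyped _ _ h).2
    obtain ⟨A, B, hA, hB, rfl, rfl⟩ := h
    rcases Red.par_iff.1 hμ with ⟨ν, h', rfl⟩ | ⟨ν, h', rfl⟩ | ⟨σ, o, v, A', h', rfl⟩ |
      ⟨σ, o, v, B', h', rfl⟩
    · exact ⟨_, _, hμ, (h'.parRight B).red.eval ht, .map fun A' hA' =>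
        ⟨A', B, h'.typed hA _ hA', hB, rfl, rfl⟩⟩
    · exact ⟨_, _, hμ, (h'.parLeft A).red.eval ht, .map fun B' hB' =>
        ⟨A, B', hA, h'.typed hB _ hB', rfl, rfl⟩⟩
    · exact ⟨_, _, hμ, (h'.parRight B).red.eval ht, .pure
        ⟨A', _, h'.typed hA, hB.input o v, rfl, rfl⟩⟩
    · exact ⟨_, _, hμ, (h'.parLeft A).red.eval ht, .pure
        ⟨_, B', hA.input o v, h'.typed hB, rfl, rfl⟩⟩

theorem TestEq.par_right {P P' Q : Proto S M.Lit Δ} (h : TestEq (I ∪ O₂) O₁ P P')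
    (hQ : Q.Typed (I ∪ O₁) O₂) (hP : Q.assign P.vals = Q) (hP' : Q.assign P'.vals = Q) :
    TestEq I (O₁ ∪ O₂) (.par Q P) (.par Q P') :=
  ((TestEq.par_comm h.left hQ).symm.trans (h.par_of_vals hQ hP hP')).trans
    (TestEq.par_comm h.right hQ)

theorem TestEq.par_assoc {P Q R : Proto S M.Lit Δ} (hP : P.Typed (I ∪ O₂ ∪ O₃) O₁)
    (hQ : Q.Typed (I ∪ O₁ ∪ O₃) O₂) (hR : R.Typed (I ∪ O₁ ∪ O₂) O₃) :
    TestEq I (O₁ ∪ O₂ ∪ O₃) (.par (.par P Q) R) (.par P (.par Q R)) := by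
  let r : Proto S M.Lit Δ → Proto S M.Lit Δ → Prop := fun X Y => ∃ A B C,
    A.Typed (I ∪ O₂ ∪ O₃) O₁ ∧ B.Typed (I ∪ O₁ ∪ O₃) O₂ ∧ C.Typed (I ∪ O₁ ∪ O₂) O₃ ∧
    X = .par (.par A B) C ∧ Y = .par A (.par B C)
  have htyped : ∀ X Y, r X Y → X.Typed I (O₁ ∪ O₂ ∪ O₃) ∧ Y.Typed I (O₁ ∪ O₂ ∪ O₃) := by
    rintro _ _ ⟨A, B, C, hA, hB, hC, rfl, rfl⟩
    refine ⟨.par (.par ?_ ?_) ?_, ?_⟩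
    · rwa [Set.union_right_comm]
    · rwa [Set.union_right_comm]
    · rwa [← Set.union_assoc]
    · rw [Set.union_assoc]
      exact .par (by rwa [← Set.union_assoc]) (.par hB hC)
  refine TestEq.of_sim r htyped ?_ ?_ ?_ ?_ ⟨P, Q, R, hP, hQ, hR, rfl, rfl⟩
  · rintro _ _ ⟨A, B, C, hA, hB, hC, rfl, rfl⟩
    simp only [Proto.vals_par, Asg.or_assoc]
  · rintro _ _ ⟨A, B, C, hA, hB, hC, rfl, rfl⟩ σ i v hi
    exact ⟨_, _, _, hA.input i v, hB.input i v, hC.input i v, rfl, rfl⟩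
  · rintro _ _ ⟨A, B, C, hA, hB, hC, rfl, rfl⟩ hh
    exact ⟨hh.1.1, hh.1.2, hh.2⟩
  · intro _ _ h μ hμ
    have ht := (htyped _ _ h).2
    obtain ⟨A, B, C, hA, hB, hC, rfl, rfl⟩ := h
    rcases Red.par_iff.1 hμ with ⟨ν, h', rfl⟩ | ⟨ν, h', rfl⟩ | ⟨σ, o, v, A', h', rfl⟩ |
      ⟨σ, o, v, B', h', rfl⟩
    · cases h' with
      | @parLeft _ _ η _ h' =>
        refine ⟨_, _, hμ, (h'.parLeft _).red.eval ht, ?_⟩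
        rw [PMF.map_comp]
        exact .map fun A' hA' => ⟨A', B, C, h'.typed hA _ hA', hB, hC, rfl, rfl⟩
      | @parRight _ _ η _ h' =>
        refine ⟨_, _, hμ, ((h'.parLeft C).parRight A).red.eval ht, ?_⟩
        rw [PMF.map_comp, PMF.map_comp]
        exact .map fun B' hB' => ⟨A, B', C, hA, h'.typed hB _ hB', hC, rfl, rfl⟩
    · refine ⟨_, _, hμ, ((h'.parRight B).parRight A).red.eval ht, ?_⟩
      rw [PMF.map_comp]
      exact .map fun C' hC' => ⟨A, B, C', hA, hB, h'.typed hC _ hC', rfl, rfl⟩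
    · cases h' with
      | parLeft _ h' =>
        exact ⟨_, _, hμ, (h'.parLeft _).red.eval ht, .pure
          ⟨_, _, _, h'.typed hA, hB.input o v, hC.input o v, rfl, rfl⟩⟩
      | parRight _ h' =>
        exact ⟨_, _, hμ, ((h'.parLeft C).parRight A).red.eval ht, .pure
          ⟨_, _, _, hA.input o v, h'.typed hB, hC.input o v, rfl, rfl⟩⟩
    · exact ⟨_, _, hμ, ((h'.parRight B).parRight A).red.eval ht, .pure
        ⟨_, _, _, hA.input o v, hB.input o v, h'.typed hC, rfl, rfl⟩⟩

theorem TestEq.absorb {P Q : Proto S M.Lit Δ} (hP : P.Typed I O) (hQ : Q.Typed (I ∪ O) ∅) :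
    TestEq I O (.par P Q) P := by
  let r : Proto S M.Lit Δ → Proto S M.Lit Δ → Prop := fun X Y => ∃ A B,
    A.Typed I O ∧ B.Typed (I ∪ O) ∅ ∧ X = .par A B ∧ A = Y
  have htyped : ∀ X Y, r X Y → X.Typed I O ∧ Y.Typed I O := by
    rintro _ _ ⟨A, B, hA, hB, rfl, rfl⟩
    refine ⟨?_, hA⟩
    rw [← Set.union_empty O]
    exact .par (by rwa [Set.union_empty]) hB
  refine TestEq.of_sim r htyped ?_ ?_ ?_ ?_ ⟨P, Q, hP, hQ, rfl, rfl⟩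
  · rintro _ _ ⟨A, B, hA, hB, rfl, rfl⟩
    rw [Proto.vals_par]
    funext τ c
    rw [Asg.or_apply, hB.vals_eq_none (Set.notMem_empty _), Option.or_none]
  · rintro _ _ ⟨A, B, hA, hB, rfl, rfl⟩ σ i v hi
    exact ⟨_, _, hA.input i v, hB.input i v, rfl, rfl⟩
  · rintro _ _ ⟨A, B, hA, hB, rfl, rfl⟩ hh
    exact hh.1
  · rintro _ _ ⟨A, B, hA, hB, rfl, rfl⟩ μ hμ
    rcases Red.par_iff.1 hμ with ⟨ν, h', rfl⟩ | ⟨ν, h', rfl⟩ | ⟨σ, o, v, A', h', rfl⟩ |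
      ⟨σ, o, v, B', h', rfl⟩
    · refine ⟨_, ν.map id, hμ, by rw [PMF.map_id]; exact h'.red.eval hA, .map fun A' hA' => ?_⟩
      exact ⟨A', B, h'.typed hA _ hA', hB, rfl, rfl⟩
    -- An internal step of the absorbed component is matched by no step at all.
    · exact ⟨_, _, hμ, Proto.eval_eq_pure_bind _, .map_pure fun B' hB' =>
        ⟨A, B', hA, h'.typed hB _ hB', rfl, rfl⟩⟩
    · exact ⟨_, _, hμ, h'.red.eval hA, .pure ⟨A', _, h'.typed hA, hB.input o v, rfl, rfl⟩⟩
    · exact absurd (h'.mem hB) (Set.notMem_empty _)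

/-! ### Rules for new channels -/

theorem Asg.lift_lift_swap {V : S.Typ → Type} {σ τ : S.Typ} (a : Asg V Δ) :
    (fun ρ c => (a.lift.lift : Asg V (τ :: σ :: Δ)) ρ (Ren.swap ρ c)) =
      (a.lift.lift : Asg V (σ :: τ :: Δ)) := by
  funext ρ c
  rcases c with _ | (_ | c) <;> rfl

theorem TestEq.new_exch {σ τ : S.Typ} {P : Proto S M.Lit (τ :: σ :: Δ)}
    (hP : P.Typed (shift (shift I)) (shift (shift O ∪ {Mem.zero.chan}) ∪ {Mem.zero.chan})) :
    TestEq I O (.new σ (.new τ P)) (.new τ (.new σ (P.mapChan Ren.swap))) := by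
  let r : Proto S M.Lit Δ → Proto S M.Lit Δ → Prop := fun X Y => ∃ A : Proto S M.Lit (τ :: σ :: Δ),
    A.Typed (shift (shift I)) (shift (shift O ∪ {Mem.zero.chan}) ∪ {Mem.zero.chan}) ∧
    X = .new σ (.new τ A) ∧ Y = .new τ (.new σ (A.mapChan Ren.swap))
  have hI : ∀ J : Set (Chan Δ),
      (Ren.swap (a := τ) (b := σ)).image (shift (shift J)) = shift (shift J) := by
    intro J
    simp only [shift, Ren.image, Set.image_image]
    rfl
  -- The swap permutes the two bound channels and fixes the others, so the set of outputs in the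
  -- body is invariant.
  have hO : (Ren.swap (a := τ) (b := σ)).image
      (shift (shift O ∪ {Mem.zero.chan}) ∪ {Mem.zero.chan}) =
      shift (shift O ∪ {Mem.zero.chan}) ∪ {Mem.zero.chan} := by
    simp only [shift] at hI ⊢
    rw [image_union, image_union, image_union, image_union, hI, Set.union_assoc, Set.union_assoc]
    congr 1
    rw [image_singleton, image_singleton, image_singleton, image_singleton, Set.union_comm]
    rfl
  have htyped : ∀ X Y, r X Y → X.Typed I O ∧ Y.Typed I O := by
    rintro _ _ ⟨A, hA, rfl, rfl⟩
    refine ⟨.new (.new hA), .new (.new ?_)⟩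
    have := hA.mapChan (φ := Ren.swap) Ren.swap_injective
    rwa [hI, hO] at this
  refine TestEq.of_sim r htyped ?_ ?_ ?_ ?_ ⟨P, hP, rfl, rfl⟩
  · rintro _ _ ⟨A, hA, rfl, rfl⟩
    funext ρ c
    exact (A.vals_mapChan (φ := Ren.swap) Ren.swap_injective c.succ.succ).symm
  · rintro _ _ ⟨A, hA, rfl, rfl⟩ ρ i v hi
    refine ⟨A.assign (Asg.single i v).lift.lift, hA.assign' _, rfl, ?_⟩
    simp only [Proto.assign, Proto.mapChan_assign, Asg.lift_lift_swap]
  · rintro _ _ ⟨A, hA, rfl, rfl⟩ hh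
    exact Proto.halted_mapChan.2 hh
  · intro _ _ h μ hμ
    have ht := (htyped _ _ h).2
    obtain ⟨A, hA, rfl, rfl⟩ := h
    obtain ⟨_, h', rfl⟩ := Red.new_iff.1 hμ
    obtain ⟨ν, hν, rfl⟩ := Red.new_iff.1 h'
    refine ⟨_, _, hμ, Red.eval ht (Red.new_iff.2 ⟨_, Red.new_iff.2
      ⟨_, hν.mapChan Ren.swap_injective, rfl⟩, rfl⟩), ?_⟩
    rw [PMF.map_comp, PMF.map_comp, PMF.map_comp]
    exact .map fun A' hA' => ⟨A', hν.typed hA _ hA', rfl, rfl⟩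

theorem Proto.mapChan_weaken_input_zero {σ : S.Typ} (P : Proto S M.Lit Δ) (v : M.Lit σ) :
    (P.mapChan (Ren.weaken (b := σ))).input Mem.zero v = P.mapChan Ren.weaken := by
  rw [Proto.input, Proto.mapChan_assign]
  exact congrArg _ P.assign_none

theorem Proto.Typed.weaken {τ : S.Typ} {P : Proto S M.Lit Δ} (hP : P.Typed I O) :
    (P.mapChan (Ren.weaken (b := τ))).Typed (shift I) (shift O) :=
  hP.mapChan Ren.weaken_injective

theorem TestEq.par_new {τ : S.Typ} {P : Proto S M.Lit Δ} {Q : Proto S M.Lit (τ :: Δ)}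
    (hP : P.Typed (I ∪ O₂) O₁) (hQ : Q.Typed (shift (I ∪ O₁)) (shift O₂ ∪ {Mem.zero.chan})) :
    TestEq I (O₁ ∪ O₂) (.par P (.new τ Q)) (.new τ (.par (P.mapChan Ren.weaken) Q)) := by
  let r : Proto S M.Lit Δ → Proto S M.Lit Δ → Prop := fun X Y => ∃ A B,
    A.Typed (I ∪ O₂) O₁ ∧ B.Typed (shift (I ∪ O₁)) (shift O₂ ∪ {Mem.zero.chan}) ∧
    X = .par A (.new τ B) ∧ Y = .new τ (.par (A.mapChan Ren.weaken) B)
  have hw := Ren.weaken_injective (b := τ) (l := Δ)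
  have htyped : ∀ X Y, r X Y → X.Typed I (O₁ ∪ O₂) ∧ Y.Typed I (O₁ ∪ O₂) := by
    rintro _ _ ⟨A, B, hA, hB, rfl, rfl⟩
    refine ⟨.par hA (.new hB), .new ?_⟩
    have hO : (shift (O₁ ∪ O₂) : Set (Chan (τ :: Δ))) = shift O₁ ∪ shift O₂ := image_union
    rw [hO, Set.union_assoc]
    refine .par ((hA.weaken (τ := τ)).mono ?_ ?_) (by rw [← image_union]; exact hB)
    · have hI : (shift (I ∪ O₂) : Set (Chan (τ :: Δ))) = shift I ∪ shift O₂ := image_union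
      rw [hI, ← Set.union_assoc]
      exact Set.subset_union_left
    · rintro _ ⟨c, hc, rfl⟩ (h | h | h)
      · exact hA.disjoint c hc (.inl (succ_mem_shift.1 h))
      · exact hA.disjoint c hc (.inr (succ_mem_shift.1 h))
      · exact succ_chan_ne_zero h
  refine TestEq.of_sim r htyped ?_ ?_ ?_ ?_ ⟨P, Q, hP, hQ, rfl, rfl⟩
  · rintro _ _ ⟨A, B, hA, hB, rfl, rfl⟩
    rw [Proto.vals_par, Proto.vals_new, Proto.vals_new]
    funext ρ c
    rw [Proto.vals_par, Asg.or_apply, Asg.or_apply]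
    exact congrArg₂ _ (A.vals_mapChan hw c).symm rfl
  · rintro _ _ ⟨A, B, hA, hB, rfl, rfl⟩ σ i v hi
    refine ⟨A.input i v, B.assign (Asg.single i v).lift, hA.input i v, hB.assign' _, rfl, ?_⟩
    simp only [Proto.assign]
    rw [Asg.lift_single]
    exact congrArg (fun Z => Proto.new τ (.par Z _)) (Proto.mapChan_input hw A i v)
  · rintro _ _ ⟨A, B, hA, hB, rfl, rfl⟩ hh
    exact ⟨Proto.halted_mapChan.2 hh.1, hh.2⟩
  · intro _ _ h μ hμ
    have ht := (htyped _ _ h).2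
    obtain ⟨A, B, hA, hB, rfl, rfl⟩ := h
    rcases Red.par_iff.1 hμ with ⟨ν, h', rfl⟩ | ⟨ν, h', rfl⟩ | ⟨σ, o, v, A', h', rfl⟩ |
      ⟨σ, o, v, B', h', rfl⟩
    · refine ⟨_, _, hμ, ((h'.mapChan hw).parLeft B).new.red.eval ht, ?_⟩
      rw [PMF.map_comp, PMF.map_comp]
      exact .map fun A' hA' => ⟨A', B, h'.typed hA _ hA', hB, rfl, rfl⟩
    · cases h' with
      | new h' =>
        refine ⟨_, _, hμ, (h'.parRight _).new.red.eval ht, ?_⟩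
        rw [PMF.map_comp, PMF.map_comp]
        exact .map fun B' hB' => ⟨A, B', hA, h'.typed hB _ hB', rfl, rfl⟩
      | @newOut _ _ _ B' v h' =>
        refine ⟨_, _, hμ, (Step.newOut (h'.parRight _)).red.eval ht, ?_⟩
        -- The hidden output is also offered to the weakened left component, which does not read it.
        rw [PMF.pure_map, Proto.mapChan_weaken_input_zero]
        exact .pure ⟨A, B', hA, h'.typed hB, rfl, rfl⟩
    · refine ⟨_, _, hμ, ((h'.mapChan hw).parLeft B).new.red.eval ht, .pure ?_⟩
      refine ⟨A', B.assign (Asg.single o v).lift, h'.typed hA, hB.assign' _, rfl, ?_⟩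
      rw [Asg.lift_single]
      rfl
    · cases h' with
      | @new _ _ _ _ _ _ B' h' =>
        refine ⟨_, _, hμ, (h'.parRight _).new.red.eval ht, .pure ?_⟩
        exact ⟨A.input o v, B', hA.input o v, h'.typed hB, rfl,
          congrArg (fun Z => Proto.new τ (.par Z _)) (Proto.mapChan_input hw A o v)⟩

end Structural

/-! ## Rules for pairs of assignments -/

section Pairs

variable {S : Sig} {M : Interp S} {Δ : S.Ctx} {I O : Set (Chan Δ)} {σ τ : S.Typ}

theorem React.step_eq {R : React S M.Lit Δ [] τ} : R.step = R.stepIn Env.nil :=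
  congrArg (React.stepIn · R) (Env.eq_nil _)

theorem Proto.outProb_red {P : Proto S M.Lit Δ} (hP : P.Typed I O) {μ : PMF (Proto S M.Lit Δ)}
    (h : Red P μ) (o : Mem Δ τ) (v : M.Lit τ) :
    P.outProb o v = expect μ fun Q => Q.outProb o v := by
  rw [Proto.outProb, h.eval hP, expect_bind]
  rfl

open scoped Classical in
theorem Proto.Halted.outProb {P : Proto S M.Lit Δ} (h : P.Halted) (o : Mem Δ τ) (v : M.Lit τ) :
    P.outProb o v = if P.vals τ o = some v then 1 else 0 := by
  rw [Proto.outProb, h.eval, expect_pure]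

theorem Proto.outProb_new {P : Proto S M.Lit (σ :: Δ)} (hP : (Proto.new σ P).Typed I O)
    (o : Mem Δ τ) (v : M.Lit τ) : (Proto.new σ P).outProb o v = P.outProb o.succ v := by
  rw [Proto.outProb, hP.eval_new, expect_map]
  rfl

/-- The assignment of an optional value to a channel. -/
def Asg.opt (c : Mem Δ σ) (u : Option (M.Lit σ)) : Asg M.Lit Δ := u.elim Asg.none (Asg.single c)

variable {c : Mem Δ σ} {o : Mem Δ τ}

theorem Proto.typed_pair {P Q : Proto S M.Lit Δ}
    (hP : P.Typed (I ∪ {c.chan}) {o.chan}) (hQ : Q.Typed (I ∪ {o.chan}) {c.chan}) :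
    (Proto.par P Q).Typed I {o.chan, c.chan} := by
  rw [Set.insert_eq]
  exact .par hP hQ

theorem Proto.typed_react_pair (hne : o.chan ≠ c.chan) (ho : o.chan ∉ I) (hc : c.chan ∉ I)
    {X : React S M.Lit Δ [] τ} {Y : React S M.Lit Δ [] σ} (hX : X.ReadsIn (I ∪ {o.chan, c.chan}))
    (hY : Y.ReadsIn (I ∪ {o.chan, c.chan})) :
    (Proto.par (.react o X) (.react c Y)).Typed I {o.chan, c.chan} := by
  refine Proto.typed_pair (.react (by simp [ho, hne]) (hX.mono ?_))
    (.react (by simp [hc, hne.symm]) (hY.mono ?_))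
  · rintro d (h | h | h) <;> simp_all
  · rintro d (h | h | h) <;> simp_all

theorem Proto.outProb_react_done (hne : o.chan ≠ c.chan) (u : M.Lit σ) (v : M.Lit τ)
    {X : React S M.Lit Δ [] τ} (hP : (Proto.par (.react o X) (.done c u)).Typed I O) :
    (Proto.par (.react o X) (.done c u)).outProb o v = X.den Asg.none Env.nil (some v) := by
  induction hn : X.size using Nat.strong_induction_on generalizing X with
  | _ n ih =>
    subst hn
    cases hv : X.value? with
    | some w =>
      classical
      cases React.value?_eq_some hv
      rw [Proto.outProb_red hP (OutStep.parLeft _ (.react o w)).red, expect_pure,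
        Proto.outProb_of_some (I := I) (O := O) ((OutStep.parLeft _ (.react o w)).typed hP) (v := w)]
      · simp [React.den, PMF.pure_apply, eq_comm]
      · simp [Proto.vals, Proto.valueAt]
    | none =>
      cases hs : X.step with
      | none =>
        rw [React.den_of_stuck _ X hv (React.step_eq ▸ hs), 
          Proto.Halted.outProb (P := .par (.react o X) (.done c u)) ⟨⟨hv, hs⟩, trivial⟩]
        simp [Proto.vals, Proto.valueAt, Asg.single_ne hne.symm]
      | some η =>
        have hstep := Step.parLeft (.done c u) (Step.react o hs)
        rw [React.den_stepIn _ Asg.none X (React.step_eq ▸ hs), Proto.outProb_red hP hstep.red,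
          PMF.map_comp, expect_map, bind_apply_eq_expect]
        refine expect_congr fun X' hX' => ih X'.size (X.size_stepIn _ _ hs X' hX') ?_ rfl
        refine hstep.typed hP _ ?_
        rw [PMF.map_comp]
        exact (PMF.mem_support_map_iff _ _ _).2 ⟨X', hX', rfl⟩

/-- Run `X` until it finishes or waits, then run `Y`, then continue `X` with the value of `c`. If
`Y` gets stuck, `c` remains without a value, which is the case `u = none`. -/
theorem Proto.outProb_react_react (hne : o.chan ≠ c.chan) (v : M.Lit τ)
    {X : React S M.Lit Δ [] τ} {Y : React S M.Lit Δ [] σ}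
    (hP : (Proto.par (.react o X) (.react c Y)).Typed I O) :
    (Proto.par (.react o X) (.react c Y)).outProb o v =
      (Y.den Asg.none Env.nil).bind (fun u => X.den (Asg.opt c u) Env.nil) (some v) := by
  induction hn : X.size + Y.size using Nat.strong_induction_on generalizing X Y with
  | _ n ih =>
    subst hn
    cases hv : X.value? with
    | some w =>
      classical
      cases React.value?_eq_some hv
      rw [Proto.outProb_red hP (OutStep.parLeft _ (.react o w)).red, expect_pure,
        Proto.outProb_of_some (I := I) (O := O) ((OutStep.parLeft _ (.react o w)).typed hP) (v := w)]
      -- `X` has finished, so the outcome of `Y` is irrelevant, whether or not it fails.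
      · simp [React.den, PMF.bind_const, PMF.pure_apply, eq_comm]
      · simp [Proto.vals, Proto.valueAt]
    | none =>
      cases hs : X.step with
      | some η =>
        have hstep := Step.parLeft (.react c Y) (Step.react o hs)
        have hden : ∀ u : Option (M.Lit σ), X.den (Asg.opt c u) Env.nil =
            η.bind fun X' => X'.den (Asg.opt c u) Env.nil := fun u =>
          React.den_stepIn _ _ X (React.step_eq ▸ hs)
        simp only [hden]
        -- A step of `X` is independent of the outcome of `Y`, so it may be drawn first.
        rw [PMF.bind_comm, Proto.outProb_red hP hstep.red,
          PMF.map_comp, expect_map, bind_apply_eq_expect]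
        refine expect_congr fun X' hX' => ih _ ?_ ?_ rfl
        · have := X.size_stepIn _ _ hs X' hX'
          omega
        refine hstep.typed hP _ ?_
        rw [PMF.map_comp]
        exact (PMF.mem_support_map_iff _ _ _).2 ⟨X', hX', rfl⟩
      | none =>
        cases hv' : Y.value? with
        | some u =>
          cases React.value?_eq_some hv'
          have hout := OutStep.parRight (.react o X) (.react c u)
          rw [Proto.outProb_red hP hout.red, expect_pure]
          refine (Proto.outProb_react_done hne u v (hout.typed hP)).trans ?_
          rw [React.den_assign, React.den, PMF.pure_bind, Asg.or_none]
          rfl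
        | none =>
          cases hs' : Y.step with
          | none =>
            rw [React.den_of_stuck _ Y hv' (React.step_eq ▸ hs'), PMF.pure_bind]
            refine Eq.trans ?_ (congrArg (· (some v))
              (React.den_of_stuck _ X hv (React.step_eq ▸ hs)).symm)
            rw [Proto.Halted.outProb (P := .par (.react o X) (.react c Y)) ⟨⟨hv, hs⟩, hv', hs'⟩]
            simp [Proto.vals, Proto.valueAt]
          | some η =>
            have hstep := Step.parRight (.react o X) (Step.react c hs')
            rw [React.den_stepIn _ _ Y (React.step_eq ▸ hs'), PMF.bind_bind,
              Proto.outProb_red hP hstep.red, PMF.map_comp, expect_map, bind_apply_eq_expect]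
            refine expect_congr fun Y' hY' => ih _ ?_ ?_ rfl
            · have := Y.size_stepIn _ _ hs' Y' hY'
              omega
            refine hstep.typed hP _ ?_
            rw [PMF.map_comp]
            exact (PMF.mem_support_map_iff _ _ _).2 ⟨Y', hY', rfl⟩

/-- A new channel that is assigned a reaction can be replaced by this reaction, if the denotation of
the result is the average over the values of the channel. -/
theorem TestEq.fold (ho : o.chan ∉ I) {X : React S M.Lit (σ :: Δ) [] τ} {Y : React S M.Lit Δ [] σ}
    {R : React S M.Lit Δ [] τ} (hX : X.ReadsIn (shift (I ∪ {o.chan}) ∪ {Mem.zero.chan}))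
    (hY : Y.ReadsIn (I ∪ {o.chan})) (hR : R.ReadsIn (I ∪ {o.chan}))
    (h : ∀ a : Asg M.Lit Δ, (Y.den a Env.nil).bind
      (fun u => X.den (Asg.or a.lift (Asg.opt Mem.zero u)) Env.nil) = R.den a Env.nil) :
    TestEq I {o.chan}
      (.new σ (.par (.react o.succ X) (.react Mem.zero (Y.mapChan Ren.weaken)))) (.react o R) := by
  have hs : (shift (I ∪ {o.chan}) : Set (Chan (σ :: Δ))) = shift I ∪ {o.succ.chan} := by
    refine image_union.trans ?_
    rw [image_singleton]
    rfl
  have htyped : (Proto.new σ (.par (.react o.succ X)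
      (.react Mem.zero (Y.mapChan Ren.weaken)))).Typed I {o.chan} := by
    refine .new ?_
    rw [show (shift {o.chan} : Set (Chan (σ :: Δ))) = {o.succ.chan} from image_singleton,
      ← Set.insert_eq]
    refine Proto.typed_react_pair succ_chan_ne_zero (by simpa using ho) zero_notMem_shift
      (hX.mono ?_) ((hY.mapChan _).mono ?_)
    · rw [hs, Set.union_assoc, Set.insert_eq]
    · rw [show (Ren.weaken.image (I ∪ {o.chan}) : Set (Chan (σ :: Δ))) = _ from hs]
      exact Set.union_subset_union_right _ (by simp)
  refine TestEq.of_outProb htyped (.react ho hR) ?_ rfl fun a ha v => ?_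
  · funext ρ d
    rfl
  · have ht := htyped.assign' a
    rw [Proto.assign] at ht ⊢
    rw [Proto.outProb_new ht]
    refine (Proto.outProb_react_react succ_chan_ne_zero v ht.new_inv).trans ?_
    rw [Proto.assign, React.outProb ho v ((hR.assign a).mono fun c hc => hc.1), React.den_assign,
      React.den_assign, React.den_mapChan, Asg.or_none, Asg.or_none, ← h a]
    simp only [React.den_assign]
    rfl

end Pairs

/-! ### Folding and divergence -/

section Fold

variable {S : Sig} {M : Interp S} {Δ : S.Ctx} {I : Set (Chan Δ)} {σ τ : S.Typ} {o : Mem Δ τ}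

theorem Asg.lift_or_opt_zero (a : Asg M.Lit Δ) (u : Option (M.Lit σ)) :
    (a.lift.or (Asg.opt Mem.zero u)) σ Mem.zero = u := by
  cases u <;> rfl

theorem Asg.lift_or_opt_weaken (a : Asg M.Lit Δ) (u : Option (M.Lit σ)) :
    (fun ρ c => (a.lift.or (Asg.opt Mem.zero u)) ρ (Ren.weaken ρ c)) = a := by
  funext ρ c
  cases u <;> exact Option.or_none

theorem TestEq.foldBind {R : React S M.Lit Δ [] σ} {K : React S M.Lit Δ [σ] τ} (ho : o.chan ∉ I)
    (hR : R.ReadsIn (I ∪ {o.chan})) (hK : K.ReadsIn (I ∪ {o.chan})) :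
    TestEq I {o.chan}
      (.new σ (.par (.react o.succ (.bind (.read Mem.zero) (K.mapChan Ren.weaken)))
        (.react Mem.zero (R.mapChan Ren.weaken))))
      (.react o (.bind R K)) := by
  refine TestEq.fold ho ⟨.inr rfl, (hK.mapChan _).mono Set.subset_union_left⟩ hR ⟨hR, hK⟩
    fun a => ?_
  simp only [React.den, React.den_mapChan, Asg.lift_or_opt_weaken, Asg.lift_or_opt_zero, obind,
    PMF.pure_bind]

theorem TestEq.foldIfLeft {R : React S M.Lit Δ [] Ty.bool} {R₁ R₂ : React S M.Lit Δ [] τ}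
    (ho : o.chan ∉ I) (hR : R.ReadsIn (I ∪ {o.chan})) (h₁ : R₁.ReadsIn (I ∪ {o.chan}))
    (h₂ : R₂.ReadsIn (I ∪ {o.chan})) :
    TestEq I {o.chan}
      (.new τ (.par (.react o.succ (.bind (R.mapChan Ren.weaken)
          (.ifte (.var Mem.zero) (.read Mem.zero) (R₂.weaken.mapChan Ren.weaken))))
        (.react Mem.zero (R₁.mapChan Ren.weaken))))
      (.react o (.bind R (.ifte (.var Mem.zero) R₁.weaken R₂.weaken))) := by
  have hw : ∀ {R : React S M.Lit Δ [] τ}, R.ReadsIn (I ∪ {o.chan}) →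
      (R.weaken (σ := Ty.bool)).ReadsIn (I ∪ {o.chan}) := fun h => (React.readsIn_rename _ _).2 h
  refine TestEq.fold ho ⟨(hR.mapChan _).mono Set.subset_union_left, .inr rfl,
    ((hw h₂).mapChan _).mono Set.subset_union_left⟩ h₁ ⟨hR, hw h₁, hw h₂⟩ fun a => ?_
  simp only [React.den, React.den_mapChan, Asg.lift_or_opt_weaken, Asg.lift_or_opt_zero, obind]
  -- `TestEq.fold` averages over the new channel first; the exchange brings the guard to the front.
  rw [PMF.bind_comm]
  refine PMF_bind_congr fun b _ => ?_
  simp only [Expr.eval, Env.cons, React.den_weaken]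
  rcases b with _ | _ | _
  -- Guard `none` and guard `false`: the channel is not read, and averaging over its value,
  -- including `none`, changes nothing. Only for guard `true` is its distribution the result.
  · exact PMF.bind_const _ _
  · exact PMF.bind_const _ _
  · exact PMF.bind_pure _

theorem TestEq.foldIfRight {R : React S M.Lit Δ [] Ty.bool} {R₁ R₂ : React S M.Lit Δ [] τ}
    (ho : o.chan ∉ I) (hR : R.ReadsIn (I ∪ {o.chan})) (h₁ : R₁.ReadsIn (I ∪ {o.chan}))
    (h₂ : R₂.ReadsIn (I ∪ {o.chan})) :
    TestEq I {o.chan}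
      (.new τ (.par (.react o.succ (.bind (R.mapChan Ren.weaken)
          (.ifte (.var Mem.zero) (R₁.weaken.mapChan Ren.weaken) (.read Mem.zero))))
        (.react Mem.zero (R₂.mapChan Ren.weaken))))
      (.react o (.bind R (.ifte (.var Mem.zero) R₁.weaken R₂.weaken))) := by
  have hw : ∀ {R : React S M.Lit Δ [] τ}, R.ReadsIn (I ∪ {o.chan}) →
      (R.weaken (σ := Ty.bool)).ReadsIn (I ∪ {o.chan}) := fun h => (React.readsIn_rename _ _).2 h
  refine TestEq.fold ho ⟨(hR.mapChan _).mono Set.subset_union_left,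
    ((hw h₁).mapChan _).mono Set.subset_union_left, .inr rfl⟩ h₂ ⟨hR, hw h₁, hw h₂⟩ fun a => ?_
  simp only [React.den, React.den_mapChan, Asg.lift_or_opt_weaken, Asg.lift_or_opt_zero, obind]
  rw [PMF.bind_comm]
  refine PMF_bind_congr fun b _ => ?_
  simp only [Expr.eval, Env.cons, React.den_weaken]
  rcases b with _ | _ | _
  · exact PMF.bind_const _ _
  · exact PMF.bind_pure _
  · exact PMF.bind_const _ _

/-- The channel `o` has no value while its own reaction runs, so both sides denote failure. -/
theorem TestEq.diverge {R : React S M.Lit Δ [τ] τ} (ho : o.chan ∉ I)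
    (hR : R.ReadsIn (I ∪ {o.chan})) :
    TestEq I {o.chan} (.react o (.bind (.read o) R)) (.react o (.read o)) := by
  refine TestEq.react ho ⟨.inr rfl, hR⟩ (.inr rfl) fun a ha => ?_
  simp only [React.den, ha, obind_none]

end Fold

/-! ### Subsumption, substitution and dropping -/

section TwoOutputs

variable {S : Sig} {M : Interp S} {Δ : S.Ctx} {I O : Set (Chan Δ)} {σ τ₁ τ₂ : S.Typ}
  {o₁ : Mem Δ τ₁} {o₂ : Mem Δ τ₂}

theorem eq_pure_of_support {X : Type} {p : PMF X} {x : X} (h : ∀ y ∈ p.support, y = x) :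
    p = PMF.pure x :=
  eq_pure_of_apply_eq_one ((PMF.apply_eq_one_iff p x).2
    (p.support_nonempty.subset_singleton_iff.1 h))

/-- A mixture is a point mass only if all its components are that point mass. -/
theorem eq_pure_of_bind_eq_pure {X Y : Type} {p : PMF X} {f : X → PMF Y} {y : Y}
    (h : p.bind f = PMF.pure y) {x : X} (hx : x ∈ p.support) : f x = PMF.pure y :=
  eq_pure_of_support fun z hz => by simpa using mem_support_of_bind h hx hz

theorem bind_eq_of_forall {X Y : Type} {p : PMF X} {f : X → PMF Y} {q : PMF Y}
    (h : ∀ x ∈ p.support, f x = q) : p.bind f = q :=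
  (PMF_bind_congr h).trans (PMF.bind_const _ _)

/-- By confluence `R` can be run to its end first, and since its denotation is a point mass, every
branch arrives at the output of `v`. -/
theorem Proto.eval_par_of_den {R : React S M.Lit Δ [] τ₁} {v : M.Lit τ₁} {Q : Proto S M.Lit Δ}
    (hR : R.den Asg.none Env.nil = PMF.pure (some v)) (hP : (Proto.par (.react o₁ R) Q).Typed I O) :
    (Proto.par (.react o₁ R) Q).eval = (Proto.par (.done o₁ v) (Q.input o₁ v)).eval := by
  induction hn : R.size using Nat.strong_induction_on generalizing R with
  | _ n ih =>
    subst hn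
    cases hv : R.value? with
    | some w =>
      cases React.value?_eq_some hv
      have hw : v = w := by
        have := congrArg PMF.support hR
        rw [React.den, PMF.support_pure, PMF.support_pure, Set.singleton_eq_singleton_iff,
          Option.some_inj] at this
        exact this.symm
      rw [Red.eval hP (OutStep.parLeft Q (.react o₁ w)).red, PMF.pure_bind, hw]
    | none =>
      cases hs : R.step with
      | none =>
        rw [React.den_of_stuck _ R hv (React.step_eq ▸ hs)] at hR
        have := congrArg PMF.support hR
        simp at this
      | some η =>
        rw [React.den_stepIn _ _ R (React.step_eq ▸ hs)] at hR
        have hstep := Step.parLeft Q (Step.react o₁ hs)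
        rw [hstep.red.eval hP, PMF.map_comp, PMF.bind_map]
        refine bind_eq_of_forall fun R' hR' => ih _ (R.size_stepIn _ _ hs R' hR')
          (eq_pure_of_bind_eq_pure hR hR') (hstep.typed hP _ ?_) rfl
        rw [PMF.map_comp]
        exact (PMF.mem_support_map_iff _ _ _).2 ⟨R', hR', rfl⟩

theorem React.den_step_pure {R : React S M.Lit Δ [] σ} {x : Option (M.Lit σ)}
    (hR : R.den Asg.none Env.nil = PMF.pure x) {η : PMF (React S M.Lit Δ [] σ)}
    (hs : R.step = some η) : ∀ R' ∈ η.support, R'.den Asg.none Env.nil = PMF.pure x := by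
  rw [React.den_stepIn _ _ R (React.step_eq ▸ hs)] at hR
  exact fun R' hR' => eq_pure_of_bind_eq_pure hR hR'

theorem React.den_val_ne {v : M.Lit σ} :
    (React.val v : React S M.Lit Δ [] σ).den Asg.none Env.nil ≠ PMF.pure none := by
  intro h
  have := congrArg PMF.support h
  simp [React.den] at this

/-- Steps preserve the denotation `none`, and a value does not have it. So neither reaction ever
outputs, and neither can release the other. -/
theorem Proto.Typed.eval_vals_of_den {A : React S M.Lit Δ [] τ₁} {B : React S M.Lit Δ [] τ₂}
    (hP : (Proto.par (.react o₁ A) (.react o₂ B)).Typed I O)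
    (hA : A.den Asg.none Env.nil = PMF.pure none) (hB : B.den Asg.none Env.nil = PMF.pure none) :
    ∀ Q ∈ (Proto.par (.react o₁ A) (.react o₂ B)).eval.support,
      Q.vals = (Proto.par (.react o₁ A) (.react o₂ B)).vals := by
  let C : Proto S M.Lit Δ → Prop := fun Q => ∃ A B, Q = Proto.par (.react o₁ A) (.react o₂ B) ∧
    A.den Asg.none Env.nil = PMF.pure none ∧ B.den Asg.none Env.nil = PMF.pure none
  suffices hC : ∀ P μ, P.Typed I O → C P → Red P μ → ∀ Q ∈ μ.support, C Q by
    intro Q hQ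
    obtain ⟨⟨A', B', rfl, -, -⟩, -⟩ := hP.eval_support C ⟨A, B, rfl, hA, hB⟩ hC Q hQ
    rfl
  clear hP hA hB A B
  rintro _ μ - ⟨A, B, rfl, hA, hB⟩ hμ Q hQ
  rcases Red.par_iff.1 hμ with ⟨ν, h', rfl⟩ | ⟨ν, h', rfl⟩ | ⟨σ, o, v, A', h', rfl⟩ |
    ⟨σ, o, v, B', h', rfl⟩
  · cases h' with
    | react _ hs =>
      rw [PMF.map_comp] at hQ
      obtain ⟨A', hA', rfl⟩ := (PMF.mem_support_map_iff _ _ _).1 hQ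
      exact ⟨A', B, rfl, React.den_step_pure hA hs A' hA', hB⟩
  · cases h' with
    | react _ hs =>
      rw [PMF.map_comp] at hQ
      obtain ⟨B', hB', rfl⟩ := (PMF.mem_support_map_iff _ _ _).1 hQ
      exact ⟨A, B', rfl, hA, React.den_step_pure hB hs B' hB'⟩
  · cases h'
    exact absurd hA React.den_val_ne
  · cases h'
    exact absurd hB React.den_val_ne

theorem Asg.single_of_mem {i : Mem Δ σ} (hi : i.chan ∈ I) {o : Mem Δ τ₁} (ho : o.chan ∉ I)
    (v : M.Lit σ) : Asg.single i v τ₁ o = Option.none :=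
  Asg.single_ne fun h => ho (h ▸ hi)

/-- Until `c` receives a value both sides are halted. When it does, the two sides differ only by a
leading `x₀ ← val v` in the second reaction, which disappears in one internal step that no test
sees. -/
theorem TestEq.subsume {c : Mem Δ σ} {R₁ : React S M.Lit Δ [σ] τ₁} {R₂ : React S M.Lit Δ [τ₁] τ₂}
    (hne : o₁.chan ≠ o₂.chan) (ho₁ : o₁.chan ∉ I) (ho₂ : o₂.chan ∉ I) (hc : c.chan ∈ I)
    (h₁ : R₁.ReadsIn (I ∪ {o₁.chan, o₂.chan})) (h₂ : R₂.ReadsIn (I ∪ {o₁.chan, o₂.chan})) :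
    TestEq I {o₁.chan, o₂.chan}
      (.par (.react o₁ (.bind (.read c) R₁))
        (.react o₂ (.bind (.read c) (.bind (.read o₁) (R₂.rename Ren.weaken.lift)))))
      (.par (.react o₁ (.bind (.read c) R₁)) (.react o₂ (.bind (.read o₁) R₂))) := by
  let r : Proto S M.Lit Δ → Proto S M.Lit Δ → Prop := fun X Y => ∃ R₁ R₂,
    R₁.ReadsIn (I ∪ {o₁.chan, o₂.chan}) ∧ R₂.ReadsIn (I ∪ {o₁.chan, o₂.chan}) ∧
    X = .par (.react o₁ (.bind (.read c) R₁))
        (.react o₂ (.bind (.read c) (.bind (.read o₁) (R₂.rename Ren.weaken.lift)))) ∧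
    Y = .par (.react o₁ (.bind (.read c) R₁)) (.react o₂ (.bind (.read o₁) R₂))
  have htyped : ∀ X Y, r X Y → X.Typed I {o₁.chan, o₂.chan} ∧ Y.Typed I {o₁.chan, o₂.chan} := by
    rintro _ _ ⟨A, B, hA, hB, rfl, rfl⟩
    exact ⟨Proto.typed_react_pair hne ho₁ ho₂ ⟨.inl hc, hA⟩ ⟨.inl hc, by simp [React.ReadsIn],
      (React.readsIn_rename _ _).2 hB⟩, Proto.typed_react_pair hne ho₁ ho₂ ⟨.inl hc, hA⟩
      ⟨by simp [React.ReadsIn], hB⟩⟩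
  refine TestEq.coinduct r htyped ?_ ?_ ?_ ⟨R₁, R₂, h₁, h₂, rfl, rfl⟩
  · rintro _ _ ⟨A, B, hA, hB, rfl, rfl⟩
    rfl
  · rintro _ _ h ρ i v hi f hf ih
    have ht := (htyped _ _ h).1.input i v
    obtain ⟨A, B, hA, hB, rfl, rfl⟩ := h
    have hi₁ : Asg.single i v τ₁ o₁ = none := Asg.single_of_mem hi ho₁ v
    by_cases hic : i.chan = c.chan
    · cases hic
      refine (TestEq.of_red ht ?_ (by simp only [Proto.vals_assign]; rfl)).test f hf
      simp only [Proto.input, Proto.assign, React.assign, Asg.single_self, hi₁,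
        React.assign_rename]
      have hstep : (React.bind (.val v) (.bind (.read o₁)
          ((B.assign (Asg.single c v)).rename Ren.weaken.lift)) : React S M.Lit Δ [] τ₂).step =
          some (PMF.pure (.bind (.read o₁) (B.assign (Asg.single c v)))) := by
        rw [React.step_eq, React.stepIn_bind_val]
        simp only [React.inst, React.subst, React.subst_rename, Sub.lift_rename]
        congr
        -- The value is substituted for a variable that was introduced by weakening, so the combined
        -- substitution is the identity.
        refine Eq.trans (congrArg (React.subst · _) ?_) (React.subst_var _)
        exact Sub.lift_var
      have := (Step.parRight (.react o₁ (.bind (.val v) (A.assign (Asg.single c v))))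
        (Step.react o₂ hstep)).red
      rwa [PMF.pure_map, PMF.pure_map] at this
    · have hic' : Asg.single i v σ c = none := Asg.single_ne hic
      refine ih _ _ ⟨A.assign (Asg.single i v), B.assign (Asg.single i v),
        (hA.assign _).mono fun _ h => h.1, (hB.assign _).mono fun _ h => h.1, ?_, ?_⟩
      · simp only [Proto.input, Proto.assign, React.assign, hi₁, hic', React.assign_rename]
      · simp only [Proto.input, Proto.assign, React.assign, hi₁, hic']
  · rintro _ _ ⟨A, B, hA, hB, rfl, rfl⟩ f hf ih
    -- Both reactions on either side start by reading a channel without a value, so evaluation does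
    -- nothing.
    rw [Proto.Halted.eval, Proto.Halted.eval, expect_pure, expect_pure]
    · exact ih _ _ ⟨A, B, hA, hB, rfl, rfl⟩
    · exact ⟨⟨rfl, rfl⟩, rfl, rfl⟩
    · exact ⟨⟨rfl, rfl⟩, rfl, rfl⟩

/-- By `hdet`, for given channel values `R₁` either surely waits or surely yields one value `v`. In
the first case no output appears on either side. In the second case `R₁` is run first, and reading
`v` from `o₁` amounts to running `R₁` once more. -/
theorem TestEq.subst {R₁ : React S M.Lit Δ [] τ₁} {R₂ : React S M.Lit Δ [τ₁] τ₂}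
    (hne : o₁.chan ≠ o₂.chan) (ho₁ : o₁.chan ∉ I) (ho₂ : o₂.chan ∉ I)
    (h₁ : R₁.ReadsIn (I ∪ {o₁.chan, o₂.chan})) (h₂ : R₂.ReadsIn (I ∪ {o₁.chan, o₂.chan}))
    (hdet : ∀ a : Asg M.Lit Δ, ∃ x, R₁.den a Env.nil = PMF.pure x) :
    TestEq I {o₁.chan, o₂.chan}
      (.par (.react o₁ R₁) (.react o₂ (.bind (.read o₁) R₂)))
      (.par (.react o₁ R₁) (.react o₂ (.bind R₁ R₂))) := by
  let r : Proto S M.Lit Δ → Proto S M.Lit Δ → Prop := fun X Y => ∃ R₁ R₂,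
    R₁.ReadsIn (I ∪ {o₁.chan, o₂.chan}) ∧ R₂.ReadsIn (I ∪ {o₁.chan, o₂.chan}) ∧
    (∀ a : Asg M.Lit Δ, ∃ x, R₁.den a Env.nil = PMF.pure x) ∧
    X = .par (.react o₁ R₁) (.react o₂ (.bind (.read o₁) R₂)) ∧
    Y = .par (.react o₁ R₁) (.react o₂ (.bind R₁ R₂))
  have htyped : ∀ X Y, r X Y → X.Typed I {o₁.chan, o₂.chan} ∧ Y.Typed I {o₁.chan, o₂.chan} := by
    rintro _ _ ⟨A, B, hA, hB, -, rfl, rfl⟩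
    exact ⟨Proto.typed_react_pair hne ho₁ ho₂ hA ⟨by simp [React.ReadsIn], hB⟩,
      Proto.typed_react_pair hne ho₁ ho₂ hA ⟨hA, hB⟩⟩
  refine TestEq.of_sim_upto r htyped ?_ ?_ ?_ ⟨R₁, R₂, h₁, h₂, hdet, rfl, rfl⟩
  · rintro _ _ ⟨A, B, -, -, -, rfl, rfl⟩
    rfl
  · rintro _ _ ⟨A, B, hA, hB, hd, rfl, rfl⟩ ρ i v hi
    refine ⟨A.assign (Asg.single i v), B.assign (Asg.single i v),
        (hA.assign _).mono fun _ h => h.1, (hB.assign _).mono fun _ h => h.1, fun a => ?_, ?_, rfl⟩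
    · rw [React.den_assign]
      exact hd _
    · simp only [Proto.input, Proto.assign, React.assign, Asg.single_of_mem hi ho₁ v]
  · intro _ _ h
    have ht := htyped _ _ h
    obtain ⟨A, B, hA, hB, hd, rfl, rfl⟩ := h
    obtain ⟨_ | v, hv⟩ := hd Asg.none
    -- `R₁` waits: the second reaction waits for `o₁` on the left and inside its own copy of `R₁` on
    -- the right.
    · refine .inr (.inr ⟨ht.1.eval_vals_of_den hv ?_, ht.2.eval_vals_of_den hv ?_⟩)
      · exact obind_none _
      · rw [React.den, hv, obind_none]
    · refine .inr (.inl ⟨_, _, Proto.eval_par_of_den hv ht.1, Proto.eval_par_of_den hv ht.2, ?_⟩)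
      rw [Set.insert_eq, Set.union_comm]
      have hsub : I ∪ {o₁.chan, o₂.chan} = I ∪ {o₁.chan} ∪ {o₂.chan} := by
        rw [Set.insert_eq, Set.union_assoc]
      refine TestEq.par_right (TestEq.react (by simp [ho₂, hne.symm]) ?_ ?_ fun a ha => ?_)
        (.done (by simp [ho₁, hne])) rfl rfl
      · rw [← hsub]
        refine React.ReadsIn.mono (React.ReadsIn.assign _ (I := I ∪ {o₁.chan, o₂.chan})
          ⟨by simp [React.ReadsIn], hB⟩) fun _ h => h.1
      · rw [← hsub]
        exact React.ReadsIn.mono (React.ReadsIn.assign _ (I := I ∪ {o₁.chan, o₂.chan})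
          ⟨hA, hB⟩) fun _ h => h.1
      -- The copy of `R₁` may run later, when more channels have values; its sure result stays the
      -- same.
      · have := React.den_eq_pure_mono hv ((Asg.single o₁ v).or a)
        rw [Asg.none_or] at this
        rw [React.den_assign, React.den_assign, React.den, React.den, React.den, this,
          Asg.or_apply, Asg.single_self]
        rfl

/-- The side that waits for `o₁` differs from the other only if `R₁` gets stuck while `R₂` can
produce a result, which `hdrop` excludes. So `R₁` is run in parallel on both sides until it outputs
or gets stuck. -/
theorem TestEq.drop {R₁ : React S M.Lit Δ [] τ₁} {R₂ : React S M.Lit Δ [] τ₂}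
    (hne : o₁.chan ≠ o₂.chan) (ho₁ : o₁.chan ∉ I) (ho₂ : o₂.chan ∉ I)
    (h₁ : R₁.ReadsIn I) (h₂ : R₂.ReadsIn I)
    (hdrop : ∀ a : Asg M.Lit Δ, R₂.den a Env.nil = PMF.pure none ∨ R₁.den a Env.nil none = 0) :
    TestEq I {o₁.chan, o₂.chan}
      (.par (.react o₁ R₁) (.react o₂ (.bind (.read o₁) R₂.weaken)))
      (.par (.react o₁ R₁) (.react o₂ R₂)) := by
  let r : Proto S M.Lit Δ → Proto S M.Lit Δ → Prop := fun X Y => ∃ R₁ R₂,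
    R₁.ReadsIn I ∧ R₂.ReadsIn I ∧
    (∀ a : Asg M.Lit Δ, R₂.den a Env.nil = PMF.pure none ∨ R₁.den a Env.nil none = 0) ∧
    X = .par (.react o₁ R₁) (.react o₂ (.bind (.read o₁) R₂.weaken)) ∧
    Y = .par (.react o₁ R₁) (.react o₂ R₂)
  have htyped : ∀ X Y, r X Y → X.Typed I {o₁.chan, o₂.chan} ∧ Y.Typed I {o₁.chan, o₂.chan} := by
    rintro _ _ ⟨A, B, hA, hB, -, rfl, rfl⟩
    have hA' := hA.mono (J := I ∪ {o₁.chan, o₂.chan}) Set.subset_union_left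
    have hB' := hB.mono (J := I ∪ {o₁.chan, o₂.chan}) Set.subset_union_left
    exact ⟨Proto.typed_react_pair hne ho₁ ho₂ hA' ⟨by simp [React.ReadsIn],
      (React.readsIn_rename _ _).2 hB'⟩, Proto.typed_react_pair hne ho₁ ho₂ hA' hB'⟩
  refine TestEq.of_sim_upto r htyped ?_ ?_ ?_ ⟨R₁, R₂, h₁, h₂, hdrop, rfl, rfl⟩
  · rintro _ _ ⟨A, B, -, -, -, rfl, rfl⟩
    rfl
  · rintro _ _ ⟨A, B, hA, hB, hd, rfl, rfl⟩ ρ i v hi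
    refine ⟨A.assign (Asg.single i v), B.assign (Asg.single i v),
        (hA.assign _).mono fun _ h => h.1, (hB.assign _).mono fun _ h => h.1, fun a => ?_, ?_, rfl⟩
    · rw [React.den_assign, React.den_assign]
      exact hd _
    · simp only [Proto.input, Proto.assign, React.assign, Asg.single_of_mem hi ho₁ v,
        React.assign_rename]
  · intro _ _ h
    have ht := htyped _ _ h
    obtain ⟨A, B, hA, hB, hd, rfl, rfl⟩ := h
    cases hv : A.value? with
    | some u =>
      cases React.value?_eq_some hv
      have hout := fun Q : Proto S M.Lit Δ => OutStep.parLeft Q (.react o₁ u)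
      -- The second reaction reads only from `I`, so the output on `o₁` leaves it alone.
      have hBu : B.assign (Asg.single o₁ u) = B :=
        hB.assign_eq fun c hc => Asg.single_ne fun h => ho₁ (by rwa [show o₁.chan = c from h])
      have hX : (Proto.react o₂ (.bind (.read o₁) B.weaken)).input o₁ u =
          .react o₂ (.bind (.val u) B.weaken) := by
        simp only [Proto.input, Proto.assign, React.assign, Asg.single_self, React.assign_rename,
          hBu]
      have hY : (Proto.react o₂ B).input o₁ u = .react o₂ B := by
        simp only [Proto.input, Proto.assign, hBu]
      have hstep : (React.bind (.val u) B.weaken).step = some (PMF.pure B) := by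
        rw [React.step_eq, React.stepIn_bind_val, React.weaken_inst]
      have htX := (hout _).typed ht.1
      have htY := (hout _).typed ht.2
      refine .inr (.inl ⟨.par (.done o₁ u) (.react o₂ B), .par (.done o₁ u) (.react o₂ B),
        ?_, ?_, .refl ?_⟩)
      · rw [(hout _).red.eval ht.1, PMF.pure_bind]
        rw [hX] at htX ⊢
        rw [(Step.parRight _ (Step.react o₂ hstep)).red.eval htX, PMF.pure_map, PMF.pure_map,
          PMF.pure_bind]
      · rw [(hout _).red.eval ht.2, PMF.pure_bind, hY]
      · rwa [hY] at htY
    | none =>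
      cases hs : A.step with
      | some η =>
        refine .inl ⟨_, _, (Step.parLeft _ (Step.react o₁ hs)).red,
          (Step.parLeft _ (Step.react o₁ hs)).red.eval ht.2, ?_⟩
        rw [PMF.map_comp, PMF.map_comp]
        refine .map fun A' hA' => ⟨A', B, React.readsIn_stepIn _ A hs hA A' hA', hB, fun a => ?_,
          rfl, rfl⟩
        -- If `A` fails with probability zero, so does each of its successors.
        refine (hd a).imp_right fun h => ?_
        rw [React.den_stepIn _ _ A (React.step_eq ▸ hs), PMF.apply_eq_zero_iff] at h
        rw [PMF.apply_eq_zero_iff]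
        exact fun h' => h ((PMF.mem_support_bind_iff _ _ _).2 ⟨A', hA', h'⟩)
      | none =>
        have hA₀ := React.den_of_stuck _ A hv (React.step_eq ▸ hs)
        -- A stuck `A` fails surely, so the alternative in `hd` forces `B` to fail as well, and
        -- neither side outputs anything.
        have hB₀ : B.den Asg.none Env.nil = PMF.pure none :=
          (hd Asg.none).resolve_right (by simp [hA₀])
        exact .inr (.inr ⟨ht.1.eval_vals_of_den hA₀ (obind_none _),
          ht.2.eval_vals_of_den hA₀ hB₀⟩)

end TwoOutputs

/-! ## Soundness -/

section Soundness

variable {S : Sig} {M : Interp S}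

/-- Comparing the masses at `(v, v)` gives `p v ^ 2 = p v`, so every result has mass 0 or 1. If all
have mass 0, then `p` is the point mass at `none`. -/
theorem exists_eq_pure_of_obind_pair {X : Type} {p : PMF (Option X)}
    (h : (obind p fun x => obind p fun y => PMF.pure (some (x, y))) =
      obind p fun x => PMF.pure (some (x, x))) : ∃ x, p = PMF.pure x := by
  classical
  have hsq : ∀ v, p (some v) * p (some v) = p (some v) := by
    intro v
    have h₁ := congrArg (· (some (v, v))) h
    simp only [obind_apply_some] at h₁
    rw [tsum_eq_single v, tsum_eq_single v, tsum_eq_single v] at h₁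
    · simpa using h₁
    · intro x hx
      simp [PMF.pure_apply, hx.symm]
    · intro x hx
      simp [PMF.pure_apply, hx.symm]
    · intro x hx
      rw [ENNReal.tsum_eq_zero.2, mul_zero]
      intro y
      simp [PMF.pure_apply, hx.symm]
  by_cases hv : ∃ v, p (some v) ≠ 0
  · obtain ⟨v, hv⟩ := hv
    refine ⟨some v, eq_pure_of_apply_eq_one ?_⟩
    exact (ENNReal.mul_right_inj hv (p.apply_ne_top _)).1 (by rw [hsq, mul_one])
  · push Not at hv
    refine ⟨none, eq_pure_of_support fun x hx => ?_⟩
    cases x with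
    | none => rfl
    | some v => exact absurd (hv v) ((PMF.mem_support_iff _ _).1 hx)

/-- At a result of `q` with positive mass, the equation says that the success probability of `p`
times this mass is this mass, so `p` succeeds with probability 1. -/
theorem apply_none_eq_zero_of_obind_const {X Y : Type} {p : PMF (Option X)} {q : PMF (Option Y)}
    (h : (obind p fun _ => q) = q) : q = PMF.pure none ∨ p none = 0 := by
  by_cases hv : ∃ v, q (some v) ≠ 0
  · obtain ⟨v, hv⟩ := hv
    right
    have h₁ := congrArg (· (some v)) h
    simp only [obind_apply_some] at h₁
    rw [ENNReal.tsum_mul_right] at h₁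
    have h₂ : ∑' x, p (some x) = 1 :=
      (ENNReal.mul_left_inj hv (q.apply_ne_top _)).1 (by rw [h₁, one_mul])
    -- Total success mass 1, written as a mixture that is a point mass, so that a failure in the
    -- support would be one of its components.
    have h₃ : (obind p fun _ => PMF.pure (some ())) = PMF.pure (some ()) :=
      eq_pure_of_apply_eq_one (by simpa [obind_apply_some] using h₂)
    rw [PMF.apply_eq_zero_iff]
    intro hn
    have := congrArg PMF.support (eq_pure_of_bind_eq_pure h₃ hn)
    simp at this
  · push Not at hv
    refine .inl (eq_pure_of_support fun x hx => ?_)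
    cases x with
    | none => rfl
    | some v => exact absurd (hv v) ((PMF.mem_support_iff _ _).1 hx)

theorem ReactEq.readsIn {Δ Γ : S.Ctx} {I : Set (Chan Δ)} {τ : S.Typ}
    {R R' : React S (NoVal S) Δ Γ τ} (h : ReactEq I R R') : R.ReadsIn I ∧ R'.ReadsIn I := by
  induction h with
  | refl hR => exact ⟨hR, hR⟩
  | symm h ih => exact ih.symm
  | trans h h' ih ih' => exact ⟨ih.1, ih'.2⟩
  | inputUnused c hc h ih =>
    exact ⟨ih.1.mono Set.subset_union_left, ih.2.mono Set.subset_union_left⟩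
  | subst θ h ih => exact ⟨(React.readsIn_subst _ _).2 ih.1, (React.readsIn_subst _ _).2 ih.2⟩
  | embed φ h ih => exact ⟨ih.1.mapChan _, ih.2.mapChan _⟩
  | congRet h => exact ⟨trivial, trivial⟩
  | congSamp d h => exact ⟨trivial, trivial⟩
  | congIf he h₁ h₂ ih₁ ih₂ => exact ⟨⟨ih₁.1, ih₂.1⟩, ih₁.2, ih₂.2⟩
  | congBind h₁ h₂ ih₁ ih₂ => exact ⟨⟨ih₁.1, ih₂.1⟩, ih₁.2, ih₂.2⟩
  | retBind e hK => exact ⟨⟨trivial, hK⟩, (React.readsIn_subst _ _).2 hK⟩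
  | bindRet hR => exact ⟨⟨hR, trivial⟩, hR⟩
  | bindBind h₁ h₂ hK => exact ⟨⟨⟨h₁, h₂⟩, hK⟩, h₁, h₂, (React.readsIn_rename _ _).2 hK⟩
  | exch h₁ h₂ hK =>
    exact ⟨⟨h₁, (React.readsIn_rename _ _).2 h₂, hK⟩, h₂, (React.readsIn_rename _ _).2 h₁,
      (React.readsIn_rename _ _).2 hK⟩
  | sampPure d e hR => exact ⟨⟨trivial, (React.readsIn_rename _ _).2 hR⟩, hR⟩
  | readDet hc hK => exact ⟨⟨hc, hc, hK⟩, hc, (React.readsIn_subst _ _).2 hK⟩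
  | ifLeft h₁ h₂ => exact ⟨⟨h₁, h₂⟩, h₁⟩
  | ifRight h₁ h₂ => exact ⟨⟨h₁, h₂⟩, h₂⟩
  | ifExt e hK =>
    exact ⟨⟨(React.readsIn_subst _ _).2 hK, (React.readsIn_subst _ _).2 hK⟩,
      (React.readsIn_subst _ _).2 hK⟩

/-- Protocols of the logic contain no intermediate values, so at the start nothing has been output.
This makes `TestEq.par_of_vals` applicable. -/
theorem Proto.vals_lit {Δ : S.Ctx} (P : Proto S (NoVal S) Δ) :
    (P.lit (V := M.Lit)).vals = Asg.none := by
  induction P with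
  | zero => rfl
  | react o R => rfl
  | done o v => exact v.elim
  | par P Q h₁ h₂ => rw [Proto.lit, Proto.mapVal, Proto.vals_par, h₁, h₂, Asg.or_none]
  | new τ P h => rw [Proto.lit, Proto.mapVal, Proto.vals_new, h]; rfl

theorem React.ReadsIn.lit {Δ Γ : S.Ctx} {I : Set (Chan Δ)} {τ : S.Typ}
    {R : React S (NoVal S) Δ Γ τ} (h : R.ReadsIn I) : (R.lit (M := M)).ReadsIn I :=
  (React.readsIn_mapVal _ _).2 h

/-- Derivable equations hold for all tests, in an interpretation in which the theory is sound. -/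
theorem ProtEq.testEq {T : Theory S} (hT : T.Sound M) {Δ : S.Ctx} {I O : Set (Chan Δ)}
    {P Q : Proto S (NoVal S) Δ} (h : ProtEq T I O P Q) :
    TestEq (M := M) I O P.lit Q.lit := by
  induction h with
  | refl hP => exact .refl (hP.mapVal _)
  | symm h ih => exact ih.symm
  | trans h h' ih ih' => exact ih.trans ih'
  | ax h => exact (hT _ _ _ _ _ h).testEq (T.typed_left h) (T.typed_right h)
  | inputUnused c hc h ih =>
    refine ih.mono Set.subset_union_left ?_
    rintro d hd (h | rfl)
    · exact ih.left.disjoint d hd h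
    · exact hc (.inr hd)
  | embed φ h ih =>
    rw [Proto.lit, Proto.lit, Proto.mapChan_mapVal, Proto.mapChan_mapVal]
    exact ih.mapChan φ.inj
  | congReact ho h =>
    exact .react ho h.readsIn.1.lit h.readsIn.2.lit fun a _ => h.den a _
  | congComp h hQ ih =>
    -- Without outputs there is nothing to hand to `Q`, so `Q.assign P.vals` is `Q` itself.
    refine ih.par_of_vals (hQ.mapVal _) ?_ ?_ <;>
    · rw [Proto.vals_lit, Proto.assign_none]
  | congNew h ih => exact ih.new
  | compComm hP hQ => exact .par_comm (hP.mapVal _) (hQ.mapVal _)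
  | compAssoc hP hQ hR => exact .par_assoc (hP.mapVal _) (hQ.mapVal _) (hR.mapVal _)
  | newExch hP =>
    simp only [Proto.lit, Proto.mapVal, Proto.mapChan_mapVal]
    exact .new_exch (hP.mapVal _)
  | compNew hP hQ =>
    simp only [Proto.lit, Proto.mapVal, Proto.mapChan_mapVal]
    exact .par_new (hP.mapVal _) (hQ.mapVal _)
  | absorb hP hQ => exact .absorb (hP.mapVal _) (hQ.mapVal _)
  | diverge ho hR => exact .diverge ho hR.lit
  | foldBind ho hR hK =>
    simp only [Proto.lit, Proto.mapVal, React.mapVal, React.mapChan_mapVal]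
    exact .foldBind ho hR.lit hK.lit
  | foldIfLeft ho hR h₁ h₂ =>
    simp only [Proto.lit, Proto.mapVal, React.mapVal, React.mapChan_mapVal, React.mapVal_rename,
      Expr.mapVal]
    exact .foldIfLeft ho hR.lit h₁.lit h₂.lit
  | foldIfRight ho hR h₁ h₂ =>
    simp only [Proto.lit, Proto.mapVal, React.mapVal, React.mapChan_mapVal, React.mapVal_rename,
      Expr.mapVal]
    exact .foldIfRight ho hR.lit h₁.lit h₂.lit
  | subsume hne ho₁ ho₂ hc h₁ h₂ =>
    simp only [Proto.lit, Proto.mapVal, React.mapVal, React.mapVal_rename]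
    exact .subsume hne ho₁ ho₂ hc h₁.lit h₂.lit
  | subst hne ho₁ ho₂ h₁ h₂ h =>
    refine .subst hne ho₁ ho₂ h₁.lit h₂.lit fun a => exists_eq_pure_of_obind_pair ?_
    have := h.den (M := M) a Env.nil
    simp only [React.lit, React.mapVal, React.mapVal_rename, React.den, React.den_weaken,
      Expr.mapVal, Expr.eval] at this
    exact this
  | drop hne ho₁ ho₂ h₁ h₂ h =>
    simp only [Proto.lit, Proto.mapVal, React.mapVal, React.mapVal_rename]
    refine .drop hne ho₁ ho₂ h₁.lit h₂.lit fun a => apply_none_eq_zero_of_obind_const ?_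
    have := h.den (M := M) a Env.nil
    simp only [React.lit, React.mapVal, React.mapVal_rename, React.den, React.den_weaken] at this
    exact this

end Soundness

end IPDL

theorem lemma1 (S : IPDL.Sig) (T : IPDL.Theory S) (M : IPDL.Interp S) (hT : T.Sound M)
    {Δ : S.Ctx} {I O : Set (IPDL.Chan Δ)} {P Q : IPDL.Proto S (IPDL.NoVal S) Δ}
    (h : IPDL.ProtEq T I O P Q) (A : IPDL.Adversary M Δ I O) :
    |A.probOne P - A.probOne Q| = 0 := by
  rw [(h.testEq hT).probOne_eq A, sub_self, abs_zero]
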